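/- Let $n\ge 0$ be an integer and let $C=\mathbb{R}_{\ge 0}^n$ be the positive orthant. A *lattice polyhedron* is a finite intersection of closed half-spaces in $\mathbb{R}^n$ all of whose vertices lie in $\mathbb{Z}^n$; only polyhedra $B$ whose symmetric difference with $C$ is bounded are considered. For positive $a_1,\dots,a_n$ put $$C_{a_1,\dots,a_n}=\Big\{x\in C : \sum_{j=1}^n x_j/a_j\ge 1\Big\}.$$ For a tuple $B_1,\dots,B_n$ of such polyhedra, the relative mixed volume is the mixed volume of the pairs $(C,B_1),\dots,(C,B_n)$, where the mixed volume of pairs is the symmetric function, additive in each argument under componentwise Minkowski addition of pairs, whose value on $n$ equal pairs $(A,B)$ is $V(A,B)=n!\,\big(\mathrm{vol}(A\setminus B)-\mathrm{vol}(B\setminus A)\big)$; explicitly, $$\mathrm{Vol}_C\big((C,B_1),\dots,(C,B_n)\big)=\frac1{n!}\sum_{I\subseteq\{1,\dots,n\}}(-1)^{n-|I|}\,V\Big(\sum_{i\in I}(C,B_i)\Big),$$ the empty sum being the pair $(\{0\},\{0\})$. The tuple is *minimal with mixed volume $V$* if its relative mixed volume equals $V$ and, for every $i$ and every lattice point $\delta\in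 C\setminus B_i$, replacing $B_i$ by $\mathrm{conv}(B_i\cup\{\delta\})$ makes the relative mixed volume strictly smaller than $V$. **Theorem.** For subsets $B_1,\dots,B_n$ of $\mathbb{R}^n$ the following are equivalent. 1. $B_1,\dots,B_n$ are lattice polyhedra having bounded symmetric difference with $C$, and the tuple is minimal with mixed volume $2$. 2. There is $k\in\{1,\dots,n\}$ such that, up to a permutation of the $B_i$ and a permutation of the coordinates of $\mathbb{R}^n$ (the same one for all $B_i$), the tuple consists of $k$ copies of $C_{1,\dots,1,2,\dots,2}$ (with $k-1$ ones and $n-k+1$ twos) and $n-k$ copies of $C_{1,\dots,1}$. -/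

import Mathlib

open scoped Pointwise symmDiff

/-- The positive orthant `C` of `ℝⁿ`. -/
def posOrthant (n : ℕ) : Set (Fin n → ℝ) := {x | ∀ j, 0 ≤ x j}

/-- A polyhedron: an intersection of finitely many closed half-spaces. -/
def IsPolyhedron {n : ℕ} (P : Set (Fin n → ℝ)) : Prop :=
  ∃ (m : ℕ) (a : Fin m → Fin n → ℝ) (b : Fin m → ℝ),
    P = {x | ∀ r, b r ≤ ∑ j, a r j * x j}

/-- A point of the lattice `ℤⁿ`. -/
def IsLatticePoint {n : ℕ} (x : Fin n → ℝ) : Prop :=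
  ∀ j, ∃ z : ℤ, x j = (z : ℝ)

/-- A lattice polyhedron: a polyhedron all of whose vertices (extreme points) lie in `ℤⁿ`. -/
def IsLatticePolyhedron {n : ℕ} (P : Set (Fin n → ℝ)) : Prop :=
  IsPolyhedron P ∧ ∀ v ∈ P.extremePoints ℝ, IsLatticePoint v

/-- `P` and the positive orthant have bounded symmetric difference. -/
def BoundedDiffOrthant {n : ℕ} (P : Set (Fin n → ℝ)) : Prop :=
  Bornology.IsBounded (posOrthant n ∆ P)

/-- The lattice volume of a pair of sets `(A, B)`: `n!` times the difference of the Lebesgue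
volumes of `A \ B` and `B \ A`. -/
noncomputable def pairVolume {n : ℕ} (p : Set (Fin n → ℝ) × Set (Fin n → ℝ)) : ℝ :=
  (n.factorial : ℝ) *
    (MeasureTheory.volume.real (p.1 \ p.2) - MeasureTheory.volume.real (p.2 \ p.1))

/-- The (lattice) mixed volume of an `n`-tuple of pairs in `ℝⁿ`, given by the polarization formula.
Sums of pairs are componentwise Minkowski sums. It is normalised by `MV(p, …, p) = pairVolume p`.
By `eq_pairMixedVolume` below, it is the only possible symmetric multi-additive
function with this diagonal. -/
noncomputable def pairMixedVolume {n : ℕ}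
    (p : Fin n → Set (Fin n → ℝ) × Set (Fin n → ℝ)) : ℝ :=
  (n.factorial : ℝ)⁻¹ *
    ∑ I : Finset (Fin n), (-1 : ℝ) ^ (n - I.card) * pairVolume (∑ i ∈ I, p i)

/-- The relative mixed volume of a tuple `B₁, …, Bₙ`: the mixed volume of the pairs `(C, Bᵢ)`. -/
noncomputable def relMixedVolume {n : ℕ} (B : Fin n → Set (Fin n → ℝ)) : ℝ :=
  pairMixedVolume fun i => (posOrthant n, B i)

/-- The tuple `B` is minimal with mixed volume `V`: its mixed volume is `V`, and enlarging any
one `Bᵢ` by a lattice point of `C \ Bᵢ` strictly decreases the mixed volume. -/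
def IsMinimalTuple {n : ℕ} (B : Fin n → Set (Fin n → ℝ)) (V : ℝ) : Prop :=
  relMixedVolume B = V ∧
    ∀ i, ∀ δ ∈ posOrthant n \ B i, IsLatticePoint δ →
      relMixedVolume (Function.update B i (convexHull ℝ (B i ∪ {δ}))) < V

/-- `C_{a₁,…,aₙ}`: the closed unbounded part of the positive orthant cut off by the hyperplane
through the points `aⱼ eⱼ` (used with all `aⱼ > 0`). -/
def cutOrthant {n : ℕ} (a : Fin n → ℝ) : Set (Fin n → ℝ) :=
  {x | x ∈ posOrthant n ∧ 1 ≤ ∑ j, x j / a j}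

/-- The tuple whose first `k` members are `C_{1,…,1,2,…,2}` with `k - 1` ones (and `n - k + 1`
twos) and whose last `n - k` members are `C_{1,…,1}`. -/
def standardTuple (n k : ℕ) (i : Fin n) : Set (Fin n → ℝ) :=
  if (i : ℕ) < k then cutOrthant fun j => if (j : ℕ) + 1 < k then 1 else 2
  else cutOrthant fun _ => 1

/-! The formula defining `pairMixedVolume` is forced by symmetry, additivity in each argument and
the value on the diagonal. -/

theorem multiadditive_expand {S ι : Type*} [Fintype ι] (w : ι → ℝ) (Q : ι → S) (s : S) :
    ∀ (m : ℕ) (G : (Fin m → S) → ℝ),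
      (∀ P i, G (Function.update P i s) = ∑ j, w j * G (Function.update P i (Q j))) →
      G (fun _ => s) = ∑ f : Fin m → ι, (∏ i, w (f i)) * G (fun i => Q (f i)) := by
  intro m
  induction m with
  | zero =>
    intro G _
    simp only [Finset.univ_unique, Finset.sum_singleton, Finset.univ_eq_empty,
      Finset.prod_empty, one_mul]
    congr 1
    exact Subsingleton.elim _ _
  | succ m ih =>
    intro G hG
    have h0 : ∀ P : Fin m → S, G (Fin.cons s P) = ∑ j, w j * G (Fin.cons (Q j) P) := by
      intro P
      have := hG (Fin.cons s P) 0
      simpa only [Fin.update_cons_zero] using this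
    have h1 := ih (fun P => G (Fin.cons s P)) (by
      intro P i
      have := hG (Fin.cons s P) i.succ
      simpa only [← Fin.cons_update] using this)
    have h2 : (fun _ => s : Fin (m + 1) → S) = Fin.cons s (fun _ => s) := by
      funext i
      refine Fin.cases ?_ (fun _ => ?_) i <;> simp
    rw [h2, h1, ← (Fin.consEquiv fun _ => ι).sum_comp, Fintype.sum_prod_type, Finset.sum_comm]
    refine Finset.sum_congr rfl fun f _ => ?_
    rw [h0, Finset.mul_sum]
    refine Finset.sum_congr rfl fun j _ => ?_
    have h3 : (fun i => Q ((Fin.consEquiv fun _ => ι) (j, f) i) : Fin (m + 1) → S)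
        = Fin.cons (Q j) (fun i => Q (f i)) := by
      funext i
      refine Fin.cases ?_ (fun _ => ?_) i <;> simp [Fin.consEquiv]
    rw [h3, Fin.prod_univ_succ]
    simp only [Fin.consEquiv, Equiv.coe_fn_mk, Fin.cons_zero, Fin.cons_succ]
    ring

theorem signed_sum_eq {n : ℕ} (f : Fin n → Fin n) :
    ∑ I : Finset (Fin n), (-1 : ℝ) ^ (n - I.card) * ∏ i, (if f i ∈ I then (1 : ℝ) else 0)
      = if Function.Bijective f then 1 else 0 := by
  classical
  have key := Finset.prod_add (fun _ : Fin n => (1 : ℝ))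
    (fun j => -(if ∃ i, f i = j then (0 : ℝ) else 1)) Finset.univ
  have hL : ∏ j : Fin n, ((1 : ℝ) + -(if ∃ i, f i = j then (0 : ℝ) else 1))
      = if Function.Bijective f then 1 else 0 := by
    split_ifs with h
    · refine Finset.prod_eq_one fun j _ => ?_
      simp [h.2 j]
    · have : ¬ Function.Surjective f := fun h' => h (Finite.surjective_iff_bijective.mp h')
      obtain ⟨j, hj⟩ := not_forall.mp this
      exact Finset.prod_eq_zero (Finset.mem_univ j) (by simp [hj])
  rw [← hL, key, Finset.powerset_univ]
  refine Finset.sum_congr rfl fun I _ => ?_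
  rw [Finset.prod_const_one, one_mul, Finset.prod_neg, Finset.card_sdiff_of_subset
    (Finset.subset_univ I), Finset.card_univ, Fintype.card_fin]
  congr 1
  by_cases h : ∀ i, f i ∈ I
  · rw [Finset.prod_eq_one (by simp [h]), Finset.prod_eq_one]
    intro j hj
    rw [if_neg]
    rintro ⟨i, rfl⟩
    simp [h i] at hj
  · obtain ⟨i, hi⟩ := not_forall.mp h
    rw [Finset.prod_eq_zero (Finset.mem_univ i) (by simp [hi]),
      Finset.prod_eq_zero (i := f i) (by simp [hi]) (by simp)]

theorem eq_pairMixedVolume {n : ℕ} (hn : n ≠ 0)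
    (S : AddSubsemigroup (Set (Fin n → ℝ) × Set (Fin n → ℝ)))
    (F : (Fin n → S) → ℝ)
    (hsymm : ∀ P (σ : Equiv.Perm (Fin n)), F (fun i => P (σ i)) = F P)
    (hadd : ∀ P i x y, F (Function.update P i (x + y))
      = F (Function.update P i x) + F (Function.update P i y))
    (hdiag : ∀ p : S, F (fun _ => p) = pairVolume (p : Set (Fin n → ℝ) × Set (Fin n → ℝ)))
    (P : Fin n → S) :
    F P = pairMixedVolume fun i => (P i : Set (Fin n → ℝ) × Set (Fin n → ℝ)) := by
  classical
  have hA : ∀ I : Finset (Fin n), I.Nonempty → ∃ s : S,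
      (s : Set (Fin n → ℝ) × Set (Fin n → ℝ)) = ∑ i ∈ I, (P i : _ × _) ∧
      ∀ R i, F (Function.update R i s) = ∑ j ∈ I, F (Function.update R i (P j)) := by
    intro I hI
    induction hI using Finset.Nonempty.cons_induction with
    | singleton a => exact ⟨P a, by simp, by simp⟩
    | cons a I ha _ ih =>
      obtain ⟨s, hs, hs'⟩ := ih
      exact ⟨P a + s, by rw [Finset.sum_cons, AddMemClass.coe_add, hs], fun R i => by rw [hadd, hs', Finset.sum_cons]⟩
  have hB : ∀ I : Finset (Fin n), pairVolume (∑ i ∈ I, (P i : Set (Fin n → ℝ) × Set (Fin n → ℝ)))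
      = ∑ f : Fin n → Fin n, (∏ i, (if f i ∈ I then (1 : ℝ) else 0)) * F (fun i => P (f i)) := by
    intro I
    rcases I.eq_empty_or_nonempty with rfl | hI
    · simp [pairVolume, hn]
    · obtain ⟨s, hs, hs'⟩ := hA I hI
      rw [← hs, ← hdiag]
      refine multiadditive_expand (fun j => if j ∈ I then (1 : ℝ) else 0) P s n F fun R i => ?_
      rw [hs']
      simp
  have hC : ∑ I : Finset (Fin n), (-1 : ℝ) ^ (n - I.card) *
      pairVolume (∑ i ∈ I, (P i : Set (Fin n → ℝ) × Set (Fin n → ℝ)))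
      = (n.factorial : ℝ) * F P := by
    simp_rw [hB, Finset.mul_sum, ← mul_assoc]
    rw [Finset.sum_comm]
    simp_rw [← Finset.sum_mul, signed_sum_eq, ite_mul, one_mul, zero_mul]
    rw [← Finset.sum_filter]
    rw [Finset.sum_congr rfl (g := fun _ => F P)]
    · rw [Finset.sum_const, nsmul_eq_mul]
      congr 2
      rw [← Fintype.card_subtype, ← Fintype.card_congr (Equiv.ofBijective
        (fun σ : Equiv.Perm (Fin n) => (⟨σ, σ.bijective⟩ : {f : Fin n → Fin n // f.Bijective}))
        ⟨fun a b h => by simpa using h, fun ⟨f, hf⟩ => ⟨Equiv.ofBijective f hf, rfl⟩⟩),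
        Fintype.card_perm, Fintype.card_fin]
    · intro f hf
      exact hsymm P (Equiv.ofBijective f (Finset.mem_filter.mp hf).2)
  rw [pairMixedVolume, hC, inv_mul_cancel_left₀ (by positivity)]

/-!
Let `C` be the positive orthant and `e j` the standard basis vectors. Up to the two permutations,
the tuples in the second condition are described by nonempty sets `I` of members and `J` of
coordinates with `|I| + |J| = n + 1`: the `i`-th member is `cutOrthant a` with `a j = 2` if `i ∈ I`
and `j ∈ J`, and `a j = 1` otherwise (`blockTuple`, `standardTuple_iff_blockTuple`). The proof rests
on two bounds for the relative mixed volume.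

* If `B i ⊆ {x ∈ C | d i ≤ ∑ j, w j * x j}` for all `i`, then it is at least `(∏ d) / ∏ w`
  (`IsGeneratedBy.prod_div_prod_le_relMixedVolume`).
* If `c i • e (σ i) ∈ B i` for all `i` and a permutation `σ`, then it is at most `∏ c`
  (`IsGeneratedBy.relMixedVolume_le_prod`).

Given a minimal tuple of mixed volume `2`, no permutation `σ` has `e (σ i) ∈ B i` for all `i`, since
the volume would be at most `1`. By Hall's marriage theorem there are `I` and `J` as above with
`e j ∉ B i` for `i ∈ I` and `j ∈ J`. As `B i` is the sum of `C` and the convex hull of nonzero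
lattice points of `C`, it is contained in `blockTuple I J i`. If the inclusion were strict, a
missing vertex of `blockTuple I J i` could be added to `B i`, and the volume would still be at least
`2` by the first bound (with `w j = 1 / 2` on `J` and `d i = 1 / 2` off `I`), against minimality.
Conversely, both bounds together show that `blockTuple I J` has volume `2`, and a lattice point of
`C` outside `blockTuple I J i` is `0` or some `e j` with `i ∈ I` and `j ∈ J`; after adding it the
second bound gives at most `0` or `1`.

For the two bounds, cut all members off at `∑ j, x j ≤ N`. With `n!` times the usual mixed volume of
convex bodies (`signedVolume`), the relative mixed volume is `N ^ n` minus the mixed volume of the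
truncations (`IsGeneratedBy.relMixedVolume_eq`). So what is needed is that mixed volumes of
polytopes are monotone (`signedVolume_mono`), and that the polytopes spanned by `c i • e i` and all
`N • e j` have mixed volume at least `N ^ n - ∏ c` (`sub_prod_le_signedVolume_axis`).

Both come from one integral formula. The gradient of the log-sum-exp function
`x ↦ log ∑ k, exp (θ k + a k ⬝ᵥ x)` maps `ℝⁿ` injectively onto the interior of the convex hull of
the `a k`, up to null sets, so that by a change of variables and polarization the mixed volume of
such hulls is the integral of the mixed discriminant of the Hessians, for every choice of the `θ`
(`lintegral_mixedDisc_gibbsCov`). The integrand is nonnegative. When `θ = M • g` and `M → ∞`, the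
Hessians converge to those of the faces on which the `g` are maximal, and Fatou's lemma bounds the
integral for the faces by the mixed volume (`lintegral_initialFace_le`). Points with `g` smaller can
thus be discarded, which is monotonicity. After a translation by `M • y` the limit sees other faces,
and since the two regions of `ℝⁿ` drift apart, both contributions add up
(`lintegral_initialFace_add_le`); an induction on the dimension turns this into the lower bound
`N ^ n - ∏ c`.
-/

/-! ### Signed sums over subsets and mixed discriminants -/

theorem sum_ite_bijective {n : ℕ} (G : (Fin n → Fin n) → ℝ) :
    ∑ f : Fin n → Fin n, (if Function.Bijective f then 1 else 0) * G f
      = ∑ σ : Equiv.Perm (Fin n), G σ := by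
  classical
  simp only [ite_mul, one_mul, zero_mul]
  rw [← Finset.sum_filter]
  symm
  refine Finset.sum_bij (fun σ _ => (σ : Fin n → Fin n)) ?_ ?_ ?_ ?_
  · intro σ _
    exact Finset.mem_filter.mpr ⟨Finset.mem_univ _, σ.bijective⟩
  · intro σ _ τ _ h
    exact DFunLike.coe_injective h
  · intro f hf
    exact ⟨Equiv.ofBijective f (Finset.mem_filter.mp hf).2, Finset.mem_univ _, rfl⟩
  · intro σ _
    rfl

/-- If `P I` is the part of a sum over all maps `f` in which the values of `f` lie in `I`, then
inclusion–exclusion over `I` leaves the bijective `f`. -/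
theorem sum_signed_expand {n : ℕ} (G : (Fin n → Fin n) → ℝ) (P : Finset (Fin n) → ℝ)
    (hP : ∀ I, P I = ∑ f : Fin n → Fin n, (∏ i, (if f i ∈ I then (1 : ℝ) else 0)) * G f) :
    ∑ I : Finset (Fin n), (-1 : ℝ) ^ (n - I.card) * P I = ∑ σ : Equiv.Perm (Fin n), G σ := by
  simp_rw [hP, Finset.mul_sum, ← mul_assoc]
  rw [Finset.sum_comm]
  simp_rw [← Finset.sum_mul, signed_sum_eq]
  exact sum_ite_bijective G

theorem signed_sum_pow_sum {n : ℕ} (d : Fin n → ℝ) :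
    ∑ I : Finset (Fin n), (-1 : ℝ) ^ (n - I.card) * (∑ i ∈ I, d i) ^ n
      = n.factorial * ∏ i, d i := by
  rw [sum_signed_expand (fun f => ∏ i, d (f i))]
  · have : ∀ σ : Equiv.Perm (Fin n), ∏ i, d (σ i) = ∏ i, d i := fun σ => Equiv.prod_comp σ d
    simp [this, Finset.card_univ, Fintype.card_perm]
  · intro I
    have h : ∑ i ∈ I, d i = ∑ i, (if i ∈ I then (1 : ℝ) else 0) * d i := by simp
    have h2 := Finset.prod_univ_sum (fun _ : Fin n => (Finset.univ : Finset (Fin n)))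
      (fun _ i => (if i ∈ I then (1 : ℝ) else 0) * d i)
    rw [h]
    simp only [Finset.prod_const, Finset.card_univ, Fintype.card_fin,
      Fintype.piFinset_univ] at h2
    rw [h2]
    simp_rw [Finset.prod_mul_distrib]

/-- The mixed discriminant of `n` matrices of size `n`, as a sum over all ways to take each row from
a different matrix. It is normalized so that `n` equal matrices `H` give `n! * H.det`. -/
noncomputable def mixedDisc {n : ℕ} (H : Fin n → Matrix (Fin n) (Fin n) ℝ) : ℝ :=
  ∑ σ : Equiv.Perm (Fin n), (Matrix.of fun r c => H (σ r) r c).det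

/-- The mixed discriminant is the polarization of the determinant. -/
theorem signed_sum_det {n : ℕ} (H : Fin n → Matrix (Fin n) (Fin n) ℝ) :
    ∑ I : Finset (Fin n), (-1 : ℝ) ^ (n - I.card) * (∑ i ∈ I, H i).det = mixedDisc H := by
  classical
  rw [sum_signed_expand (fun f => (Matrix.of fun r c => H (f r) r c).det)]
  · rfl
  · intro I
    have h : (∑ i ∈ I, H i)
        = Matrix.of (fun r => ∑ i, (if i ∈ I then (1 : ℝ) else 0) • (H i r)) := by
      ext r c
      simp [Matrix.sum_apply, Finset.sum_apply]
    have h2 := (Matrix.detRowAlternating (n := Fin n) (R := ℝ)).toMultilinearMap.map_sum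
      (fun r i => (if i ∈ I then (1 : ℝ) else 0) • (H i r))
    rw [h]
    refine h2.trans (Finset.sum_congr rfl fun f _ => ?_)
    rw [MultilinearMap.map_smul_univ, smul_eq_mul]
    rfl

open scoped MatrixOrder in
theorem exists_eq_transpose_mul_self {n : ℕ} {H : Matrix (Fin n) (Fin n) ℝ}
    (hH : H.PosSemidef) : ∃ U : Matrix (Fin n) (Fin n) ℝ, H = U.transpose * U := by
  obtain ⟨U, hU⟩ := CStarAlgebra.nonneg_iff_eq_star_mul_self.mp hH.nonneg
  exact ⟨U, by simpa [Matrix.star_eq_conjTranspose] using hU⟩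

/-- The mixed discriminant of positive semidefinite matrices is nonnegative: writing
`H i = (U i)ᵀ * U i`, it is a sum of squares of determinants formed from the rows of the `U i`. -/
theorem mixedDisc_nonneg {n : ℕ} (H : Fin n → Matrix (Fin n) (Fin n) ℝ)
    (hH : ∀ i, (H i).PosSemidef) : 0 ≤ mixedDisc H := by
  classical
  choose U hU using fun i => exists_eq_transpose_mul_self (hH i)
  have h1 : ∀ σ : Equiv.Perm (Fin n), (Matrix.of fun r c => H (σ r) r c).det
      = ∑ g : Fin n → Fin n, (Matrix.of fun i => U i (g i)).det *
        ((Equiv.Perm.sign σ : ℤ) * ∏ r, (Matrix.of fun i => U i (g i)) (σ r) r) := by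
    intro σ
    have h : (Matrix.of fun r c => H (σ r) r c)
        = Matrix.of (fun r => ∑ k, U (σ r) k r • U (σ r) k) := by
      ext r c
      rw [Matrix.of_apply, hU]
      simp [Matrix.mul_apply, Finset.sum_apply]
    have h2 := (Matrix.detRowAlternating (n := Fin n) (R := ℝ)).toMultilinearMap.map_sum
      (fun r k => U (σ r) k r • U (σ r) k)
    rw [h]
    refine h2.trans ?_
    rw [← (Equiv.arrowCongr σ.symm (Equiv.refl (Fin n))).sum_comp]
    refine Finset.sum_congr rfl fun g _ => ?_
    rw [MultilinearMap.map_smul_univ, smul_eq_mul]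
    have h3 := Matrix.det_permute σ (Matrix.of fun i => U i (g i))
    have h4 : (∏ i, U (σ i) ((Equiv.arrowCongr σ.symm (Equiv.refl (Fin n))) g i) i)
        = ∏ r, (Matrix.of fun i => U i (g i)) (σ r) r := by
      simp
    rw [h4]
    refine (congrArg _ (Eq.trans ?_ h3)).trans (by ring)
    refine congrArg Matrix.det (?_ : (Matrix.of fun r => U (σ r) (g (σ.symm.symm r))) = _)
    ext r c
    simp
  unfold mixedDisc
  simp_rw [h1]
  rw [Finset.sum_comm]
  refine Finset.sum_nonneg fun g _ => ?_
  rw [← Finset.mul_sum, ← Matrix.det_apply']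
  exact mul_self_nonneg _

theorem continuous_mixedDisc {n : ℕ} {X : Type*} [TopologicalSpace X]
    {H : X → Fin n → Matrix (Fin n) (Fin n) ℝ} (hH : ∀ i, Continuous fun x => H x i) :
    Continuous fun x => mixedDisc (H x) := by
  unfold mixedDisc
  refine continuous_finsetSum _ fun σ _ => Continuous.matrix_det ?_
  refine continuous_matrix fun r c => ?_
  exact (hH (σ r)).matrix_elem r c

/-- The first matrix has no entry other than the one in the upper left corner. -/
theorem mixedDisc_succ_of_head {n : ℕ} (H : Fin (n + 1) → Matrix (Fin (n + 1)) (Fin (n + 1)) ℝ)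
    (h0 : ∀ r c, (r ≠ 0 ∨ c ≠ 0) → H 0 r c = 0) :
    mixedDisc H = H 0 0 0 *
      mixedDisc fun i => (H i.succ).submatrix Fin.succ Fin.succ := by
  unfold mixedDisc
  rw [← Equiv.Perm.decomposeFin.symm.sum_comp, Fintype.sum_prod_type,
    Finset.sum_eq_single_of_mem 0 (Finset.mem_univ _), Finset.mul_sum]
  · refine Finset.sum_congr rfl fun e _ => ?_
    rw [Matrix.det_succ_row_zero, Finset.sum_eq_single_of_mem 0 (Finset.mem_univ _)]
    · simp only [Matrix.of_apply, Equiv.Perm.decomposeFin_symm_apply_zero, Fin.val_zero, pow_zero,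
        one_mul]
      congr 2
    · intro c _ hc
      simp [Matrix.of_apply, h0 0 c (Or.inr hc)]
  · intro p _ hp
    refine Finset.sum_eq_zero fun e _ => ?_
    set σ := Equiv.Perm.decomposeFin.symm (p, e) with hσ
    -- the row taken from `H 0` is not the first one, hence zero
    refine Matrix.det_eq_zero_of_row_eq_zero (σ.symm 0) fun c => ?_
    rw [Matrix.of_apply, Equiv.apply_symm_apply]
    refine h0 _ _ (Or.inl fun h => hp ?_)
    rw [Equiv.symm_apply_eq, hσ, Equiv.Perm.decomposeFin_symm_apply_zero] at h
    exact h.symm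

/-- All matrices but the first have vanishing first row and column. -/
theorem mixedDisc_succ_of_tail {n : ℕ} (H : Fin (n + 1) → Matrix (Fin (n + 1)) (Fin (n + 1)) ℝ)
    (h0 : ∀ i c, H (Fin.succ i) 0 c = 0) (h1 : ∀ i r, H (Fin.succ i) r 0 = 0) :
    mixedDisc H = H 0 0 0 *
      mixedDisc fun i => (H i.succ).submatrix Fin.succ Fin.succ := by
  unfold mixedDisc
  rw [← Equiv.Perm.decomposeFin.symm.sum_comp, Fintype.sum_prod_type,
    Finset.sum_eq_single_of_mem 0 (Finset.mem_univ _), Finset.mul_sum]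
  · refine Finset.sum_congr rfl fun e _ => ?_
    rw [Matrix.det_succ_column_zero, Finset.sum_eq_single_of_mem 0 (Finset.mem_univ _)]
    · simp only [Matrix.of_apply, Equiv.Perm.decomposeFin_symm_apply_zero, Fin.val_zero, pow_zero,
        one_mul]
      congr 2
    · intro r _ hr
      obtain ⟨r, rfl⟩ := Fin.exists_succ_eq.mpr hr
      simp [Matrix.of_apply, h1]
  · intro p _ hp
    refine Finset.sum_eq_zero fun e _ => ?_
    -- the first row is taken from a matrix other than `H 0`
    refine Matrix.det_eq_zero_of_row_eq_zero 0 fun c => ?_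
    obtain ⟨q, rfl⟩ := Fin.exists_succ_eq.mpr hp
    simp [Matrix.of_apply, h0]

/-! ### Log-sum-exp potentials: mixed volumes as integrals of mixed discriminants -/

section Gibbs

variable {ι : Type*} {n : ℕ}

/-- The exponential weight at `x` of the point `a k`, with coefficient `exp (θ k)`. -/
noncomputable def gibbsWeight (a : ι → Fin n → ℝ) (θ : ι → ℝ) (x : Fin n → ℝ) (k : ι) : ℝ :=
  Real.exp (θ k + a k ⬝ᵥ x)

/-- The partition function: the sum of the exponential weights of the points `a k`, `k ∈ S`. Its
logarithm is the log-sum-exp potential of these points. -/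
noncomputable def gibbsZ (a : ι → Fin n → ℝ) (S : Finset ι) (θ : ι → ℝ) (x : Fin n → ℝ) : ℝ :=
  ∑ k ∈ S, gibbsWeight a θ x k

/-- The Gibbs probability of the index `k ∈ S` at `x`. The value is meaningful only for `k ∈ S`. -/
noncomputable def gibbsProb (a : ι → Fin n → ℝ) (S : Finset ι) (θ : ι → ℝ) (x : Fin n → ℝ)
    (k : ι) : ℝ :=
  gibbsWeight a θ x k / gibbsZ a S θ x

/-- The mean of the points `a k` under the Gibbs probabilities at `x`; this is the gradient of the
potential `log (gibbsZ a S θ)`. -/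
noncomputable def gibbsMean (a : ι → Fin n → ℝ) (S : Finset ι) (θ : ι → ℝ) (x : Fin n → ℝ) :
    Fin n → ℝ :=
  fun j => ∑ k ∈ S, gibbsProb a S θ x k * a k j

/-- The covariance matrix of the points `a k` under the Gibbs probabilities at `x`; this is the
Hessian of the potential `log (gibbsZ a S θ)`. -/
noncomputable def gibbsCov (a : ι → Fin n → ℝ) (S : Finset ι) (θ : ι → ℝ) (x : Fin n → ℝ) :
    Matrix (Fin n) (Fin n) ℝ :=
  Matrix.of fun r c => ∑ k ∈ S, gibbsProb a S θ x k *
    ((a k r - gibbsMean a S θ x r) * (a k c - gibbsMean a S θ x c))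

variable (a : ι → Fin n → ℝ) {S : Finset ι} (θ : ι → ℝ)

theorem gibbsWeight_pos (x : Fin n → ℝ) (k : ι) : 0 < gibbsWeight a θ x k := Real.exp_pos _

theorem gibbsZ_pos (hS : S.Nonempty) (x : Fin n → ℝ) : 0 < gibbsZ a S θ x :=
  Finset.sum_pos (fun k _ => gibbsWeight_pos a θ x k) hS

theorem gibbsProb_pos (hS : S.Nonempty) (x : Fin n → ℝ) (k : ι) : 0 < gibbsProb a S θ x k :=
  div_pos (gibbsWeight_pos a θ x k) (gibbsZ_pos a θ hS x)

theorem sum_gibbsProb (hS : S.Nonempty) (x : Fin n → ℝ) : ∑ k ∈ S, gibbsProb a S θ x k = 1 := by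
  unfold gibbsProb
  rw [← Finset.sum_div]
  exact div_self (gibbsZ_pos a θ hS x).ne'

theorem gibbsMean_mem_convexHull (hS : S.Nonempty) (x : Fin n → ℝ) :
    gibbsMean a S θ x ∈ convexHull ℝ (a '' S) := by
  have : gibbsMean a S θ x = ∑ k ∈ S, gibbsProb a S θ x k • a k := by
    ext j
    simp [gibbsMean, Finset.sum_apply]
  rw [this]
  exact (convex_convexHull ℝ _).sum_mem (fun k _ => (gibbsProb_pos a θ hS x k).le)
    (sum_gibbsProb a θ hS x) fun k hk => subset_convexHull ℝ _ ⟨k, hk, rfl⟩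

theorem gibbsCov_posSemidef (hS : S.Nonempty) (x : Fin n → ℝ) :
    (gibbsCov a S θ x).PosSemidef := by
  have : gibbsCov a S θ x = ∑ k ∈ S, gibbsProb a S θ x k •
      Matrix.vecMulVec (a k - gibbsMean a S θ x) (star (a k - gibbsMean a S θ x)) := by
    ext r c
    simp [gibbsCov, Matrix.sum_apply, Matrix.vecMulVec_apply]
  rw [this]
  exact Matrix.posSemidef_sum _ fun k _ =>
    (Matrix.posSemidef_vecMulVec_self_star _).smul (gibbsProb_pos a θ hS x k).le

theorem hasFDerivAt_gibbsWeight (x : Fin n → ℝ) (k : ι) :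
    HasFDerivAt (fun x => gibbsWeight a θ x k)
      (gibbsWeight a θ x k •
        (LinearMap.toContinuousLinearMap (dotProductBilin ℝ ℝ (a k) : (Fin n → ℝ) →ₗ[ℝ] ℝ))) x := by
  unfold gibbsWeight
  refine HasFDerivAt.exp ?_
  refine HasFDerivAt.const_add _ ?_
  exact (LinearMap.toContinuousLinearMap (dotProductBilin ℝ ℝ (a k) :
    (Fin n → ℝ) →ₗ[ℝ] ℝ)).hasFDerivAt

theorem hasFDerivAt_gibbsZ (S : Finset ι) (x : Fin n → ℝ) :
    HasFDerivAt (gibbsZ a S θ) (∑ k ∈ S, gibbsWeight a θ x k •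
        (LinearMap.toContinuousLinearMap (dotProductBilin ℝ ℝ (a k) : (Fin n → ℝ) →ₗ[ℝ] ℝ))) x := by
  exact HasFDerivAt.fun_sum fun k _ => hasFDerivAt_gibbsWeight a θ x k

theorem hasFDerivAt_log_gibbsZ (hS : S.Nonempty) (x : Fin n → ℝ) :
    HasFDerivAt (fun x => Real.log (gibbsZ a S θ x))
      (LinearMap.toContinuousLinearMap
        (dotProductBilin ℝ ℝ (gibbsMean a S θ x) : (Fin n → ℝ) →ₗ[ℝ] ℝ)) x := by
  convert! (hasFDerivAt_gibbsZ a θ S x).log (gibbsZ_pos a θ hS x).ne' using 1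
  ext v
  simp [gibbsMean, gibbsProb, dotProduct, Finset.mul_sum, Finset.sum_mul]
  rw [Finset.sum_comm]
  refine Finset.sum_congr rfl fun k _ => Finset.sum_congr rfl fun j _ => ?_
  ring

theorem gibbsProb_eq_exp (hS : S.Nonempty) (x : Fin n → ℝ) (k : ι) :
    gibbsProb a S θ x k = Real.exp (θ k + a k ⬝ᵥ x - Real.log (gibbsZ a S θ x)) := by
  rw [Real.exp_sub, Real.exp_log (gibbsZ_pos a θ hS x)]
  rfl

theorem hasFDerivAt_gibbsProb (hS : S.Nonempty) (x : Fin n → ℝ) (k : ι) :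
    HasFDerivAt (fun x => gibbsProb a S θ x k)
      (gibbsProb a S θ x k • LinearMap.toContinuousLinearMap
        (dotProductBilin ℝ ℝ (a k - gibbsMean a S θ x) : (Fin n → ℝ) →ₗ[ℝ] ℝ)) x := by
  simp_rw [gibbsProb_eq_exp a θ hS]
  refine HasFDerivAt.exp ?_
  have h1 : HasFDerivAt (fun x => θ k + a k ⬝ᵥ x) (LinearMap.toContinuousLinearMap
      (dotProductBilin ℝ ℝ (a k) : (Fin n → ℝ) →ₗ[ℝ] ℝ)) x :=
    HasFDerivAt.const_add _ (LinearMap.toContinuousLinearMap (dotProductBilin ℝ ℝ (a k) :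
      (Fin n → ℝ) →ₗ[ℝ] ℝ)).hasFDerivAt
  convert! h1.fun_sub (hasFDerivAt_log_gibbsZ a θ hS x) using 1
  ext v
  simp

theorem sum_gibbsProb_mul_sub (hS : S.Nonempty) (x : Fin n → ℝ) (j : Fin n) :
    ∑ k ∈ S, gibbsProb a S θ x k * (a k j - gibbsMean a S θ x j) = 0 := by
  simp_rw [mul_sub, Finset.sum_sub_distrib, ← Finset.sum_mul, sum_gibbsProb a θ hS]
  simp [gibbsMean]

theorem hasFDerivAt_gibbsMean (hS : S.Nonempty) (x : Fin n → ℝ) :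
    HasFDerivAt (gibbsMean a S θ)
      (LinearMap.toContinuousLinearMap (Matrix.toLin' (gibbsCov a S θ x))) x := by
  rw [hasFDerivAt_pi']
  intro j
  have h2 : HasFDerivAt (fun x => gibbsMean a S θ x j) _ x :=
    HasFDerivAt.fun_sum fun k _ => (hasFDerivAt_gibbsProb a θ hS x k).mul_const (a k j)
  convert! h2 using 1
  ext v
  have h3 : ∑ k ∈ S, gibbsProb a S θ x k * ((a k - gibbsMean a S θ x) ⬝ᵥ v) = 0 := by
    simp_rw [dotProduct, Finset.mul_sum, ← mul_assoc]
    rw [Finset.sum_comm]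
    simp_rw [← Finset.sum_mul, Pi.sub_apply, sum_gibbsProb_mul_sub a θ hS x]
    simp
  have h4 : ((gibbsCov a S θ x).mulVec v) j = ∑ k ∈ S, gibbsProb a S θ x k *
      (a k j - gibbsMean a S θ x j) * ((a k - gibbsMean a S θ x) ⬝ᵥ v) := by
    simp only [Matrix.mulVec, gibbsCov, Matrix.of_apply, dotProduct, Finset.sum_mul,
      Finset.mul_sum, Pi.sub_apply]
    rw [Finset.sum_comm]
    refine Finset.sum_congr rfl fun k _ => Finset.sum_congr rfl fun c _ => ?_
    ring
  simp only [ContinuousLinearMap.coe_comp, Function.comp_apply, ContinuousLinearMap.proj_apply,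
    Matrix.toLin'_apply, LinearMap.coe_toContinuousLinearMap', sum_apply, smul_apply, smul_eq_mul,
    dotProductBilin_apply_apply]
  rw [h4, ← sub_eq_zero, ← Finset.sum_sub_distrib, ← mul_zero (-gibbsMean a S θ x j), ← h3,
    Finset.mul_sum]
  refine Finset.sum_congr rfl fun k _ => ?_
  ring

/-- The monotonicity defect of the gradient is a symmetrized relative entropy. Its summands are
nonnegative, so that the vanishing of the defect is easy to analyse. -/
theorem dotProduct_gibbsMean_sub (hS : S.Nonempty) (x y : Fin n → ℝ) :
    (gibbsMean a S θ x - gibbsMean a S θ y) ⬝ᵥ (x - y) = ∑ k ∈ S,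
      (gibbsProb a S θ x k - gibbsProb a S θ y k) *
        (Real.log (gibbsProb a S θ x k) - Real.log (gibbsProb a S θ y k)) := by
  have hl : ∀ x k, Real.log (gibbsProb a S θ x k)
      = θ k + a k ⬝ᵥ x - Real.log (gibbsZ a S θ x) := by
    intro x k
    rw [gibbsProb, Real.log_div (gibbsWeight_pos a θ x k).ne' (gibbsZ_pos a θ hS x).ne',
      gibbsWeight, Real.log_exp]
  have h1 : (gibbsMean a S θ x - gibbsMean a S θ y) ⬝ᵥ (x - y) = ∑ k ∈ S,
      (gibbsProb a S θ x k - gibbsProb a S θ y k) * (a k ⬝ᵥ (x - y)) := by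
    simp only [gibbsMean, dotProduct, Pi.sub_apply, ← Finset.sum_sub_distrib, Finset.sum_mul,
      Finset.mul_sum]
    rw [Finset.sum_comm]
    refine Finset.sum_congr rfl fun k _ => Finset.sum_congr rfl fun j _ => ?_
    ring
  have h2 : ∑ k ∈ S, (gibbsProb a S θ x k - gibbsProb a S θ y k) *
      (Real.log (gibbsZ a S θ x) - Real.log (gibbsZ a S θ y)) = 0 := by
    rw [← Finset.sum_mul, Finset.sum_sub_distrib, sum_gibbsProb a θ hS, sum_gibbsProb a θ hS]
    simp
  rw [h1, ← sub_zero (∑ k ∈ S, _), ← h2, ← Finset.sum_sub_distrib]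
  refine Finset.sum_congr rfl fun k _ => ?_
  rw [hl, hl, dotProduct_sub]
  ring

theorem mul_log_sub_nonneg {p q : ℝ} (hp : 0 < p) (hq : 0 < q) :
    0 ≤ (p - q) * (Real.log p - Real.log q) := by
  rcases le_total p q with h | h
  · exact mul_nonneg_of_nonpos_of_nonpos (by linarith) (by linarith [Real.log_le_log hp h])
  · exact mul_nonneg (by linarith) (by linarith [Real.log_le_log hq h])

theorem dotProduct_gibbsMean_sub_nonneg (hS : S.Nonempty) (x y : Fin n → ℝ) :
    0 ≤ (gibbsMean a S θ x - gibbsMean a S θ y) ⬝ᵥ (x - y) := by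
  rw [dotProduct_gibbsMean_sub a θ hS]
  exact Finset.sum_nonneg fun k _ =>
    mul_log_sub_nonneg (gibbsProb_pos a θ hS x k) (gibbsProb_pos a θ hS y k)

theorem eq_of_dotProduct_gibbsMean_sub_eq_zero (hS : S.Nonempty) {x y : Fin n → ℝ}
    (h : (gibbsMean a S θ x - gibbsMean a S θ y) ⬝ᵥ (x - y) = 0) {k l : ι} (hk : k ∈ S)
    (hl : l ∈ S) : a k ⬝ᵥ (x - y) = a l ⬝ᵥ (x - y) := by
  rw [dotProduct_gibbsMean_sub a θ hS, Finset.sum_eq_zero_iff_of_nonneg (fun k _ =>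
    mul_log_sub_nonneg (gibbsProb_pos a θ hS x k) (gibbsProb_pos a θ hS y k))] at h
  have h1 : ∀ k ∈ S, a k ⬝ᵥ (x - y) = Real.log (gibbsZ a S θ x) - Real.log (gibbsZ a S θ y) := by
    intro k hk
    have hlog : Real.log (gibbsProb a S θ x k) = Real.log (gibbsProb a S θ y k) := by
      rcases mul_eq_zero.mp (h k hk) with h | h
      · rw [sub_eq_zero.mp h]
      · exact sub_eq_zero.mp h
    rw [gibbsProb, gibbsProb, Real.log_div (gibbsWeight_pos a θ x k).ne' (gibbsZ_pos a θ hS x).ne',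
      Real.log_div (gibbsWeight_pos a θ y k).ne' (gibbsZ_pos a θ hS y).ne',
      gibbsWeight, Real.log_exp, gibbsWeight, Real.log_exp] at hlog
    rw [dotProduct_sub]
    linarith
  rw [h1 k hk, h1 l hl]

/-- The points `a k`, `k ∈ S`, affinely span `ℝⁿ`: there are such points, and a linear functional
that is constant on them is zero. -/
def AffinelySpans (a : ι → Fin n → ℝ) (S : Finset ι) : Prop :=
  S.Nonempty ∧ ∀ v : Fin n → ℝ, (∀ k ∈ S, ∀ l ∈ S, a k ⬝ᵥ v = a l ⬝ᵥ v) → v = 0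

/-- The potential is bounded below, up to a constant, by the support function of the convex hull. -/
theorem exists_le_log_gibbsZ (hS : S.Nonempty) :
    ∃ t : ℝ, ∀ x, ∀ b ∈ convexHull ℝ (a '' S), b ⬝ᵥ x - t ≤ Real.log (gibbsZ a S θ x) := by
  obtain ⟨t, ht⟩ : ∃ t : ℝ, ∀ k ∈ S, - θ k ≤ t := by
    refine ⟨∑ k ∈ S, |θ k|, fun k hk => (neg_le_abs _).trans ?_⟩
    exact Finset.single_le_sum (f := fun k => |θ k|) (fun _ _ => abs_nonneg _) hk
  refine ⟨t, fun x b hb => ?_⟩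
  have hc : Convex ℝ {b : Fin n → ℝ | b ⬝ᵥ x ≤ Real.log (gibbsZ a S θ x) + t} :=
    convex_halfSpace_le (f := fun b => b ⬝ᵥ x) ⟨fun u v => add_dotProduct u v x,
      fun c u => smul_dotProduct c u x⟩ _
  have := convexHull_min (s := a '' S)
    (t := {b : Fin n → ℝ | b ⬝ᵥ x ≤ Real.log (gibbsZ a S θ x) + t}) ?_ hc hb
  · have h2 : b ⬝ᵥ x ≤ Real.log (gibbsZ a S θ x) + t := this
    linarith
  · rintro _ ⟨k, hk, rfl⟩
    have h1 : θ k + a k ⬝ᵥ x ≤ Real.log (gibbsZ a S θ x) := by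
      rw [Real.le_log_iff_exp_le (gibbsZ_pos a θ hS x)]
      exact Finset.single_le_sum (f := fun k => gibbsWeight a θ x k)
        (fun k _ => (gibbsWeight_pos a θ x k).le) hk
    have := ht k hk
    show a k ⬝ᵥ x ≤ _
    linarith

variable (a : ι → Fin n → ℝ) {S : Fin n → Finset ι} (θ : Fin n → ι → ℝ)

/-- Strict convexity of the potentials. -/
theorem injective_sum_gibbsMean {I : Finset (Fin n)} (hI : I.Nonempty)
    (hS : ∀ i, AffinelySpans a (S i)) :
    Function.Injective fun x => ∑ i ∈ I, gibbsMean a (S i) (θ i) x := by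
  intro x y hxy
  have h1 : ∑ i ∈ I, (gibbsMean a (S i) (θ i) x - gibbsMean a (S i) (θ i) y) ⬝ᵥ (x - y) = 0 := by
    rw [← sum_dotProduct, Finset.sum_sub_distrib, sub_eq_zero.mpr hxy, zero_dotProduct]
  rw [Finset.sum_eq_zero_iff_of_nonneg
    fun i _ => dotProduct_gibbsMean_sub_nonneg a (θ i) (hS i).1 x y] at h1
  obtain ⟨i, hi⟩ := hI
  exact sub_eq_zero.mp ((hS i).2 _ fun k hk l hl =>
    eq_of_dotProduct_gibbsMean_sub_eq_zero a (θ i) (hS i).1 (h1 i hi) hk hl)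

/-- An interior point `p` of the sum of the hulls is attained by the gradient: the sum of the
potentials minus `p ⬝ᵥ x` is coercive, and its minimum is a critical point. -/
theorem interior_subset_range_sum_gibbsMean (I : Finset (Fin n))
    (hS : ∀ i, (S i).Nonempty) :
    interior (∑ i ∈ I, convexHull ℝ (a '' S i))
      ⊆ Set.range fun x => ∑ i ∈ I, gibbsMean a (S i) (θ i) x := by
  intro p hp
  obtain ⟨r, hr, hrK⟩ := Metric.nhds_basis_closedBall.mem_iff.mp (mem_interior_iff_mem_nhds.mp hp)
  choose t ht using fun i => exists_le_log_gibbsZ a (θ i) (hS i)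
  set F : (Fin n → ℝ) → ℝ := fun x => ∑ i ∈ I, Real.log (gibbsZ a (S i) (θ i) x) - p ⬝ᵥ x with hF
  have hd : ∀ x, HasFDerivAt F (LinearMap.toContinuousLinearMap
      (dotProductBilin ℝ ℝ (∑ i ∈ I, gibbsMean a (S i) (θ i) x - p) : (Fin n → ℝ) →ₗ[ℝ] ℝ)) x := by
    intro x
    have h1 : HasFDerivAt (fun x => p ⬝ᵥ x) (LinearMap.toContinuousLinearMap
        (dotProductBilin ℝ ℝ p : (Fin n → ℝ) →ₗ[ℝ] ℝ)) x :=
      (LinearMap.toContinuousLinearMap (dotProductBilin ℝ ℝ p :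
        (Fin n → ℝ) →ₗ[ℝ] ℝ)).hasFDerivAt
    convert! (HasFDerivAt.fun_sum fun i (_ : i ∈ I) =>
      hasFDerivAt_log_gibbsZ a (θ i) (hS i) x).fun_sub h1 using 1
    ext v
    simp
  have hlow : ∀ x, r * ‖x‖ + - ∑ i ∈ I, t i ≤ F x := by
    intro x
    -- move from `p` in the direction of the signs of `x`, which pairs with `x` to at least
    -- `r * ‖x‖`
    set u : Fin n → ℝ := fun j => r * SignType.sign (x j) with hu
    have hmem : p + u ∈ ∑ i ∈ I, convexHull ℝ (a '' S i) := by
      refine hrK ?_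
      rw [mem_closedBall_iff_norm, add_sub_cancel_left, pi_norm_le_iff_of_nonneg hr.le]
      intro j
      rw [hu, Real.norm_eq_abs, abs_mul, abs_of_pos hr]
      refine mul_le_of_le_one_right hr.le ?_
      rcases lt_trichotomy (x j) 0 with h | h | h <;> simp [h]
    have hux : r * ‖x‖ ≤ u ⬝ᵥ x := by
      have : u ⬝ᵥ x = r * ∑ j, |x j| := by
        simp only [hu, dotProduct, mul_assoc, sign_mul_self, Finset.mul_sum]
      rw [this]
      refine mul_le_mul_of_nonneg_left ?_ hr.le
      refine (pi_norm_le_iff_of_nonneg (Finset.sum_nonneg fun _ _ => abs_nonneg _)).mpr fun j => ?_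
      exact Finset.single_le_sum (f := fun j => |x j|) (fun _ _ => abs_nonneg _) (Finset.mem_univ j)
    obtain ⟨b, hb, hbs⟩ := (Set.mem_finsetSum _ _ _).mp hmem
    have h2 : ∑ i ∈ I, (b i ⬝ᵥ x - t i) ≤ ∑ i ∈ I, Real.log (gibbsZ a (S i) (θ i) x) :=
      Finset.sum_le_sum fun i hi => ht i x (b i) (hb hi)
    rw [Finset.sum_sub_distrib, ← sum_dotProduct, hbs, add_dotProduct] at h2
    simp only [hF]
    linarith
  obtain ⟨x, hx⟩ := Continuous.exists_forall_le (f := F)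
    (continuous_iff_continuousAt.mpr fun x => (hd x).continuousAt)
    (Filter.tendsto_atTop_mono hlow (Filter.tendsto_atTop_add_const_right _ _
      ((tendsto_norm_cocompact_atTop).const_mul_atTop hr)))
  have hz := IsLocalMin.hasFDerivAt_eq_zero (Filter.Eventually.of_forall hx) (hd x)
  refine ⟨x, sub_eq_zero.mp (dotProduct_self_eq_zero.mp ?_)⟩
  exact DFunLike.congr_fun hz _

/-- The change of variables along the gradient of the sum of the potentials, whose image is the sum
of the convex hulls up to a part of the boundary. -/
theorem lintegral_det_sum_gibbsCov {I : Finset (Fin n)} (hI : I.Nonempty)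
    (hS : ∀ i, AffinelySpans a (S i)) :
    ∫⁻ x, ENNReal.ofReal (∑ i ∈ I, gibbsCov a (S i) (θ i) x).det
      = MeasureTheory.volume (∑ i ∈ I, convexHull ℝ (a '' S i)) := by
  have h1 := MeasureTheory.lintegral_abs_det_fderiv_eq_addHaar_image MeasureTheory.volume
    (s := Set.univ) (f := fun x => ∑ i ∈ I, gibbsMean a (S i) (θ i) x)
    (f' := fun x => LinearMap.toContinuousLinearMap
      (Matrix.toLin' (∑ i ∈ I, gibbsCov a (S i) (θ i) x))) MeasurableSet.univ
    (fun x _ => by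
      refine HasFDerivAt.hasFDerivWithinAt ?_
      convert! HasFDerivAt.fun_sum fun i (_ : i ∈ I) =>
        hasFDerivAt_gibbsMean a (θ i) (hS i).1 x using 1
      simp [map_sum])
    (injective_sum_gibbsMean a θ hI hS).injOn
  rw [MeasureTheory.Measure.restrict_univ, Set.image_univ] at h1
  have hdet : ∀ x, |(LinearMap.toContinuousLinearMap
      (Matrix.toLin' (∑ i ∈ I, gibbsCov a (S i) (θ i) x))).det|
      = (∑ i ∈ I, gibbsCov a (S i) (θ i) x).det := by
    intro x
    rw [LinearMap.det_toContinuousLinearMap, LinearMap.det_toLin', abs_of_nonneg]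
    exact (Matrix.posSemidef_sum _ fun i _ =>
      gibbsCov_posSemidef a (θ i) (hS i).1 x).det_nonneg
  simp_rw [hdet] at h1
  rw [h1]
  have hconv : Convex ℝ (∑ i ∈ I, convexHull ℝ (a '' S i)) := by
    rw [← convexHull_sum]
    exact convex_convexHull ℝ _
  have hint : MeasureTheory.volume (interior (∑ i ∈ I, convexHull ℝ (a '' S i)))
      = MeasureTheory.volume (∑ i ∈ I, convexHull ℝ (a '' S i)) := by
    refine le_antisymm (MeasureTheory.measure_mono interior_subset) ?_
    calc _ ≤ MeasureTheory.volume (interior (∑ i ∈ I, convexHull ℝ (a '' S i)) ∪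
          frontier (∑ i ∈ I, convexHull ℝ (a '' S i))) := by
            refine MeasureTheory.measure_mono ?_
            rw [← closure_eq_interior_union_frontier]
            exact subset_closure
      _ ≤ _ := MeasureTheory.measure_union_le _ _
      _ = _ := by rw [hconv.addHaar_frontier MeasureTheory.volume, add_zero]
  refine le_antisymm (MeasureTheory.measure_mono ?_) ?_
  · rintro _ ⟨x, rfl⟩
    exact Set.finsetSum_mem_finsetSum _ _ _ fun i _ => gibbsMean_mem_convexHull a (θ i) (hS i).1 x
  · rw [← hint]
    exact MeasureTheory.measure_mono
      (interior_subset_range_sum_gibbsMean a θ I fun i => (hS i).1)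

theorem continuous_gibbsProb (S : Finset ι) (θ : ι → ℝ) (k : ι) (hS : S.Nonempty) :
    Continuous fun x => gibbsProb a S θ x k :=
  continuous_iff_continuousAt.mpr fun x => (hasFDerivAt_gibbsProb a θ hS x k).continuousAt

theorem continuous_gibbsCov (S : Finset ι) (θ : ι → ℝ) (hS : S.Nonempty) :
    Continuous fun x => gibbsCov a S θ x := by
  have hm : ∀ j, Continuous fun x => gibbsMean a S θ x j := fun j =>
    continuous_finsetSum _ fun k _ => (continuous_gibbsProb a S θ k hS).mul continuous_const
  refine continuous_matrix fun r c => continuous_finsetSum _ fun k _ => ?_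
  exact (continuous_gibbsProb a S θ k hS).mul
    ((continuous_const.sub (hm r)).mul (continuous_const.sub (hm c)))

theorem finite_finsetSum {κ E : Type*} [AddCommMonoid E] (I : Finset κ) {A : κ → Set E}
    (hA : ∀ i, (A i).Finite) : (∑ i ∈ I, A i).Finite := by
  classical
  induction I using Finset.induction_on with
  | empty => simp
  | insert i I hi ih =>
    rw [Finset.sum_insert hi]
    exact (hA i).add ih

theorem measure_sum_convexHull_lt_top (I : Finset (Fin n)) :
    MeasureTheory.volume (∑ i ∈ I, convexHull ℝ (a '' S i)) < ⊤ := by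
  refine Bornology.IsBounded.measure_lt_top ?_
  rw [← convexHull_sum, isBounded_convexHull]
  exact (finite_finsetSum I fun i => (S i).finite_toSet.image a).isBounded

/-- For empty `I` both integrals are those of the zero matrix and of a point; when `n = 0`, both
are `1`, and otherwise both are `0`. -/
theorem integrable_det_and_integral_eq (I : Finset (Fin n)) (hS : ∀ i, AffinelySpans a (S i)) :
    MeasureTheory.Integrable (fun x => (∑ i ∈ I, gibbsCov a (S i) (θ i) x).det) ∧
    ∫ x, (∑ i ∈ I, gibbsCov a (S i) (θ i) x).det
      = MeasureTheory.volume.real (∑ i ∈ I, convexHull ℝ (a '' S i)) := by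
  rcases I.eq_empty_or_nonempty with rfl | hI
  · rcases Nat.eq_zero_or_pos n with rfl | hn
    · have : (0 : Set (Fin 0 → ℝ)) = Set.univ := by
        ext x
        simp [Subsingleton.elim x 0]
      simp [this]
    · have : Nonempty (Fin n) := ⟨⟨0, hn⟩⟩
      have : MeasureTheory.NullSingletonClass
          (MeasureTheory.volume : MeasureTheory.Measure (Fin n → ℝ)) :=
        MeasureTheory.Measure.pi_nullSingletonClass ⟨0, hn⟩
      have h0 : (0 : Set (Fin n → ℝ)) = {0} := rfl
      simp [h0, MeasureTheory.Measure.real]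
  · have hnn : ∀ x, 0 ≤ (∑ i ∈ I, gibbsCov a (S i) (θ i) x).det := fun x =>
      (Matrix.posSemidef_sum _ fun i _ => gibbsCov_posSemidef a (θ i) (hS i).1 x).det_nonneg
    have hc : Continuous fun x => (∑ i ∈ I, gibbsCov a (S i) (θ i) x).det :=
      (continuous_finsetSum _ fun i _ => continuous_gibbsCov a (S i) (θ i) (hS i).1).matrix_det
    have h := lintegral_det_sum_gibbsCov a θ hI hS
    constructor
    · refine ⟨hc.aestronglyMeasurable, ?_⟩
      rw [MeasureTheory.hasFiniteIntegral_iff_ofReal (Filter.Eventually.of_forall hnn), h]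
      exact measure_sum_convexHull_lt_top a I
    · rw [MeasureTheory.integral_eq_lintegral_of_nonneg_ae (Filter.Eventually.of_forall hnn)
        hc.aestronglyMeasurable, h]
      rfl

/-- The mixed volume of `n` convex bodies in `ℝⁿ`, defined by the polarization formula and
normalized so that `n` equal bodies `K` give `n!` times the volume of `K`. -/
noncomputable def signedVolume {n : ℕ} (K : Fin n → Set (Fin n → ℝ)) : ℝ :=
  ∑ I : Finset (Fin n), (-1 : ℝ) ^ (n - I.card) * MeasureTheory.volume.real (∑ i ∈ I, K i)

theorem mixedDisc_gibbsCov_nonneg (hS : ∀ i, (S i).Nonempty) (x : Fin n → ℝ) :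
    0 ≤ mixedDisc fun i => gibbsCov a (S i) (θ i) x :=
  mixedDisc_nonneg _ fun i => gibbsCov_posSemidef a (θ i) (hS i) x

theorem continuous_mixedDisc_gibbsCov (hS : ∀ i, (S i).Nonempty) :
    Continuous fun x => mixedDisc fun i => gibbsCov a (S i) (θ i) x :=
  continuous_mixedDisc fun i => continuous_gibbsCov a (S i) (θ i) (hS i)

theorem integrable_mixedDisc_and_integral_eq (hS : ∀ i, AffinelySpans a (S i)) :
    MeasureTheory.Integrable (fun x => mixedDisc fun i => gibbsCov a (S i) (θ i) x) ∧
    ∫ x, mixedDisc (fun i => gibbsCov a (S i) (θ i) x)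
      = signedVolume fun i => convexHull ℝ (a '' S i) := by
  simp_rw [← signed_sum_det]
  have h := fun I => integrable_det_and_integral_eq a θ I hS
  constructor
  · exact MeasureTheory.integrable_finsetSum _ fun I _ => (h I).1.const_mul _
  · rw [MeasureTheory.integral_finsetSum _ fun I _ => (h I).1.const_mul _]
    refine Finset.sum_congr rfl fun I _ => ?_
    rw [MeasureTheory.integral_const_mul, (h I).2]

theorem signedVolume_nonneg (hS : ∀ i, AffinelySpans a (S i)) :
    0 ≤ signedVolume fun i => convexHull ℝ (a '' S i) := by
  rw [← (integrable_mixedDisc_and_integral_eq a (fun _ _ => 0) hS).2]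
  exact MeasureTheory.integral_nonneg fun x => mixedDisc_gibbsCov_nonneg a _ (fun i => (hS i).1) x

/-- The mixed volume of convex hulls of finite sets is the integral of the mixed discriminant of the
Hessians of their potentials, whatever the coefficients `θ` are. -/
theorem lintegral_mixedDisc_gibbsCov (hS : ∀ i, AffinelySpans a (S i)) :
    ∫⁻ x, ENNReal.ofReal (mixedDisc fun i => gibbsCov a (S i) (θ i) x)
      = ENNReal.ofReal (signedVolume fun i => convexHull ℝ (a '' S i)) := by
  have h := integrable_mixedDisc_and_integral_eq a θ hS
  rw [← h.2, MeasureTheory.ofReal_integral_eq_lintegral_ofReal h.1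
    (Filter.Eventually.of_forall fun x => mixedDisc_gibbsCov_nonneg a θ (fun i => (hS i).1) x)]

end Gibbs

/-! ### Degeneration to faces and monotonicity -/

section Degeneration

open Filter Topology

variable {ι : Type*} {n : ℕ} (a : ι → Fin n → ℝ)

/-- `T` consists of the indices in `S` at which the weight `g` attains its maximum over `S`. -/
structure IsInitialFace (S T : Finset ι) (g : ι → ℝ) : Prop where
  subset : T ⊆ S
  nonempty : T.Nonempty
  exists_max : ∃ m, (∀ k ∈ T, g k = m) ∧ ∀ k ∈ S, k ∉ T → g k < m

variable {a}

theorem gibbsWeight_add (θ : ι → ℝ) (x y : Fin n → ℝ) (k : ι) :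
    gibbsWeight a θ (x + y) k = gibbsWeight a (fun k => θ k + a k ⬝ᵥ y) x k := by
  unfold gibbsWeight
  rw [dotProduct_add]
  congr 1
  ring

/-- A translation of the argument amounts to a change of the coefficients by a linear functional. -/
theorem gibbsCov_add (S : Finset ι) (θ : ι → ℝ) (x y : Fin n → ℝ) :
    gibbsCov a S θ (x + y) = gibbsCov a S (fun k => θ k + a k ⬝ᵥ y) x := by
  unfold gibbsCov gibbsMean gibbsProb gibbsZ
  simp only [gibbsWeight_add]

variable {S T : Finset ι} {g : ι → ℝ}

/-- The Gibbs measures with coefficients `M * g` concentrate on the initial face. -/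
theorem IsInitialFace.tendsto_gibbsProb [DecidableEq ι] (h : IsInitialFace S T g)
    (x : Fin n → ℝ) {k : ι} (hk : k ∈ S) :
    Tendsto (fun M : ℕ => gibbsProb a S (fun k => M * g k) x k) atTop
      (𝓝 (if k ∈ T then gibbsProb a T (fun _ => 0) x k else 0)) := by
  obtain ⟨m, hT, hS⟩ := h.exists_max
  have h1 : ∀ k ∈ S, Tendsto (fun M : ℕ => Real.exp (M * (g k - m)) * Real.exp (a k ⬝ᵥ x)) atTop
      (𝓝 (if k ∈ T then gibbsWeight a (fun _ => 0) x k else 0)) := by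
    intro k hk
    split_ifs with hkT
    · simp [hT k hkT, gibbsWeight]
    · have : Tendsto (fun M : ℕ => Real.exp (M * (g k - m))) atTop (𝓝 0) :=
        Real.tendsto_exp_atBot.comp
          ((tendsto_natCast_atTop_atTop).atTop_mul_const_of_neg (by linarith [hS k hk hkT]))
      simpa using this.mul_const (Real.exp (a k ⬝ᵥ x))
  have h2 : ∀ M : ℕ, gibbsProb a S (fun k => M * g k) x k
      = Real.exp (M * (g k - m)) * Real.exp (a k ⬝ᵥ x) /
        ∑ l ∈ S, Real.exp (M * (g l - m)) * Real.exp (a l ⬝ᵥ x) := by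
    intro M
    have h3 : ∀ l, Real.exp (M * (g l - m)) * Real.exp (a l ⬝ᵥ x)
        = Real.exp (-(M * m)) * gibbsWeight a (fun k => M * g k) x l := by
      intro l
      rw [gibbsWeight, ← Real.exp_add, ← Real.exp_add]
      congr 1
      ring
    simp_rw [h3, ← Finset.mul_sum]
    rw [mul_div_mul_left _ _ (Real.exp_pos _).ne']
    rfl
  simp_rw [h2]
  have h4 := tendsto_finsetSum S h1
  have h5 : ∑ l ∈ S, (if l ∈ T then gibbsWeight a (fun _ => 0) x l else 0)
      = gibbsZ a T (fun _ => 0) x := by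
    rw [Finset.sum_ite_mem, Finset.inter_eq_right.mpr h.subset]
    rfl
  rw [h5] at h4
  have h6 := (h1 k hk).div h4 (gibbsZ_pos a _ h.nonempty x).ne'
  convert! h6 using 2
  split_ifs
  · rfl
  · simp

theorem IsInitialFace.tendsto_gibbsCov (h : IsInitialFace S T g) (x : Fin n → ℝ) :
    Tendsto (fun M : ℕ => gibbsCov a S (fun k => M * g k) x) atTop
      (𝓝 (gibbsCov a T (fun _ => 0) x)) := by
  classical
  have hp := fun k (hk : k ∈ S) => h.tendsto_gibbsProb (a := a) x hk
  have hm : ∀ j, Tendsto (fun M : ℕ => gibbsMean a S (fun k => M * g k) x j) atTop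
      (𝓝 (gibbsMean a T (fun _ => 0) x j)) := by
    intro j
    have h1 := tendsto_finsetSum S fun k hk => (hp k hk).mul_const (a k j)
    simp_rw [ite_mul, zero_mul] at h1
    rw [Finset.sum_ite_mem, Finset.inter_eq_right.mpr h.subset] at h1
    exact h1
  refine tendsto_pi_nhds.mpr fun r => tendsto_pi_nhds.mpr fun c => ?_
  have h1 := tendsto_finsetSum S fun k hk => (hp k hk).mul
    (((hm r).const_sub (a k r)).mul ((hm c).const_sub (a k c)))
  simp_rw [ite_mul, zero_mul] at h1
  rw [Finset.sum_ite_mem, Finset.inter_eq_right.mpr h.subset] at h1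
  exact h1

theorem tendsto_mixedDisc {X : Type*} {l : Filter X} {H : X → Fin n → Matrix (Fin n) (Fin n) ℝ}
    {H₀ : Fin n → Matrix (Fin n) (Fin n) ℝ} (h : ∀ i, Tendsto (fun x => H x i) l (𝓝 (H₀ i))) :
    Tendsto (fun x => mixedDisc (H x)) l (𝓝 (mixedDisc H₀)) := by
  have hc : Continuous fun H : Fin n → Matrix (Fin n) (Fin n) ℝ => mixedDisc H :=
    continuous_mixedDisc fun i => continuous_apply i
  exact (hc.tendsto H₀).comp (tendsto_pi_nhds.mpr h)

theorem tendsto_mixedDisc_gibbsCov {S T : Fin n → Finset ι} {g : Fin n → ι → ℝ}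
    (h : ∀ i, IsInitialFace (S i) (T i) (g i)) (x : Fin n → ℝ) :
    Tendsto (fun M : ℕ => mixedDisc fun i => gibbsCov a (S i) (fun k => M * g i k) x) atTop
      (𝓝 (mixedDisc fun i => gibbsCov a (T i) (fun _ => 0) x)) :=
  tendsto_mixedDisc fun i => (h i).tendsto_gibbsCov x

/-- Fatou's lemma for the coefficients `M * g i` as `M → ∞`. No spanning hypothesis is made on the
faces `T i`. -/
theorem lintegral_initialFace_le {S T : Fin n → Finset ι} {g : Fin n → ι → ℝ}
    (hS : ∀ i, AffinelySpans a (S i)) (h : ∀ i, IsInitialFace (S i) (T i) (g i)) :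
    ∫⁻ x, ENNReal.ofReal (mixedDisc fun i => gibbsCov a (T i) (fun _ => 0) x)
      ≤ ENNReal.ofReal (signedVolume fun i => convexHull ℝ (a '' S i)) := by
  have h1 := MeasureTheory.lintegral_liminf_le (μ := MeasureTheory.volume) (u := atTop)
    (f := fun (M : ℕ) x => ENNReal.ofReal
      (mixedDisc fun i => gibbsCov a (S i) (fun k => M * g i k) x))
    (fun M => ((continuous_mixedDisc_gibbsCov a (fun i k => M * g i k)
      fun i => (hS i).1).measurable).ennreal_ofReal)
  simp_rw [fun x => (ENNReal.tendsto_ofReal (tendsto_mixedDisc_gibbsCov (a := a) h x)).liminf_eq]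
    at h1
  simp_rw [fun M : ℕ => lintegral_mixedDisc_gibbsCov a (fun i k => M * g i k) hS] at h1
  rwa [liminf_const] at h1

/-- If a second family of initial faces is selected after adding the linear functional of `y` to the
weights, then the contributions of both families add up. They are the limits of the integrand near
the origin and near `M • y`, and these regions are separated by the half-space
`x ⬝ᵥ y < M * (y ⬝ᵥ y / 2)`. -/
theorem lintegral_initialFace_add_le {S T T' : Fin n → Finset ι} {g : Fin n → ι → ℝ}
    {y : Fin n → ℝ} (hy : y ≠ 0) (hS : ∀ i, AffinelySpans a (S i))
    (h : ∀ i, IsInitialFace (S i) (T i) (g i))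
    (h' : ∀ i, IsInitialFace (S i) (T' i) fun k => g i k + a k ⬝ᵥ y) :
    (∫⁻ x, ENNReal.ofReal (mixedDisc fun i => gibbsCov a (T i) (fun _ => 0) x))
      + ∫⁻ x, ENNReal.ofReal (mixedDisc fun i => gibbsCov a (T' i) (fun _ => 0) x)
      ≤ ENNReal.ofReal (signedVolume fun i => convexHull ℝ (a '' S i)) := by
  have hyy : 0 < y ⬝ᵥ y := lt_of_le_of_ne
    (Finset.sum_nonneg fun j _ => mul_self_nonneg _)
    (fun h => hy (dotProduct_self_eq_zero.mp h.symm))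
  set D : ℕ → (Fin n → ℝ) → ENNReal := fun M x => ENNReal.ofReal
    (mixedDisc fun i => gibbsCov a (S i) (fun k => M * g i k) x) with hD
  set H : ℕ → Set (Fin n → ℝ) := fun M => {x | x ⬝ᵥ y < M * (y ⬝ᵥ y / 2)} with hH
  have hHm : ∀ M, MeasurableSet (H M) := fun M =>
    (isOpen_lt (Continuous.dotProduct continuous_id continuous_const)
      continuous_const).measurableSet
  have hDm : ∀ M, Measurable (D M) := fun M =>
    ((continuous_mixedDisc_gibbsCov a (fun i k => M * g i k)
      fun i => (hS i).1).measurable).ennreal_ofReal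
  set P : ℕ → (Fin n → ℝ) → ENNReal := fun M => (H M).indicator (D M) with hP
  set Q : ℕ → (Fin n → ℝ) → ENNReal := fun M => (H M)ᶜ.indicator (D M) with hQ
  have hPm : ∀ M, Measurable (P M) := fun M => (hDm M).indicator (hHm M)
  have hQm : ∀ M, Measurable (Q M) := fun M => (hDm M).indicator (hHm M).compl
  have hQs : ∀ M : ℕ, Measurable fun x => Q M (x + (M : ℝ) • y) := fun M =>
    (hQm M).comp (measurable_id.add_const _)
  have htot : ∀ M : ℕ, ∫⁻ x, (P M x + Q M (x + (M : ℝ) • y))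
      = ENNReal.ofReal (signedVolume fun i => convexHull ℝ (a '' S i)) := by
    intro M
    rw [MeasureTheory.lintegral_add_left (hPm M),
      MeasureTheory.lintegral_add_right_eq_self (Q M), ← MeasureTheory.lintegral_add_left (hPm M)]
    have : ∀ x, P M x + Q M x = D M x := fun x =>
      congrFun (Set.indicator_self_add_compl (H M) (D M)) x
    simp_rw [this]
    exact lintegral_mixedDisc_gibbsCov a (fun i k => M * g i k) hS
  have hMT : Tendsto (fun M : ℕ => (M : ℝ) * (y ⬝ᵥ y / 2)) atTop atTop :=
    tendsto_natCast_atTop_atTop.atTop_mul_const (by positivity)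
  -- pointwise, both half-spaces eventually contain `x` and `x + M • y`, respectively
  have hlim : ∀ x, Tendsto (fun M : ℕ => P M x + Q M (x + (M : ℝ) • y)) atTop
      (𝓝 (ENNReal.ofReal (mixedDisc fun i => gibbsCov a (T i) (fun _ => 0) x)
        + ENNReal.ofReal (mixedDisc fun i => gibbsCov a (T' i) (fun _ => 0) x))) := by
    intro x
    refine Tendsto.add ?_ ?_
    · refine (ENNReal.tendsto_ofReal (tendsto_mixedDisc_gibbsCov (a := a) h x)).congr' ?_
      filter_upwards [hMT.eventually_gt_atTop (x ⬝ᵥ y)] with M hM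
      exact (Set.indicator_of_mem (s := H M) hM (D M)).symm
    · refine (ENNReal.tendsto_ofReal (tendsto_mixedDisc_gibbsCov (a := a) h' x)).congr' ?_
      filter_upwards [hMT.eventually_ge_atTop (-(x ⬝ᵥ y))] with M hM
      have hmem : x + (M : ℝ) • y ∈ (H M)ᶜ := by
        simp only [hH, Set.mem_compl_iff, Set.mem_ofPred_eq, not_lt, add_dotProduct,
          smul_dotProduct, smul_eq_mul]
        linarith
      refine Eq.trans ?_ (Set.indicator_of_mem hmem (D M)).symm
      refine congrArg ENNReal.ofReal (congrArg mixedDisc ?_)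
      funext i
      rw [gibbsCov_add]
      congr 1
      funext k
      rw [dotProduct_smul, smul_eq_mul]
      ring
  have h1 := MeasureTheory.lintegral_liminf_le (μ := MeasureTheory.volume) (u := atTop)
    (f := fun (M : ℕ) x => P M x + Q M (x + (M : ℝ) • y))
    (fun M => (hPm M).add (hQs M))
  simp_rw [fun x => (hlim x).liminf_eq, htot] at h1
  rw [liminf_const, MeasureTheory.lintegral_add_left] at h1
  · exact h1
  · exact ((continuous_mixedDisc_gibbsCov a (fun _ _ => 0)
      fun i => (h i).nonempty).measurable).ennreal_ofReal

/-- Fatou's lemma with weight `0` on `T i` and `-1` on the remaining points, combined with the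
integral formula for the `T i`. -/
theorem signedVolume_mono_of_subset {S T : Fin n → Finset ι} (hTS : ∀ i, T i ⊆ S i)
    (hT : ∀ i, AffinelySpans a (T i)) (hS : ∀ i, AffinelySpans a (S i)) :
    signedVolume (fun i => convexHull ℝ (a '' T i))
      ≤ signedVolume fun i => convexHull ℝ (a '' S i) := by
  classical
  have h1 := lintegral_initialFace_le (a := a) (T := T)
    (g := fun i k => if k ∈ T i then 0 else -1) hS
    fun i => ⟨hTS i, (hT i).1, 0, fun k hk => by simp [hk], fun k _ hk => by simp [hk]⟩
  rw [lintegral_mixedDisc_gibbsCov a (fun _ _ => 0) hT] at h1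
  exact (ENNReal.ofReal_le_ofReal_iff (signedVolume_nonneg a hS)).mp h1

theorem AffinelySpans.mono {S T : Finset ι} (hTS : T ⊆ S) (hT : AffinelySpans a T) :
    AffinelySpans a S :=
  ⟨hT.1.mono hTS, fun v hv => hT.2 v fun k hk l hl => hv k (hTS hk) l (hTS hl)⟩

theorem signedVolume_mono {V V' : Fin n → Finset (Fin n → ℝ)}
    (hV : ∀ i, AffinelySpans id (V i))
    (h : ∀ i, (V i : Set (Fin n → ℝ)) ⊆ convexHull ℝ (V' i)) :
    signedVolume (fun i => convexHull ℝ (V i : Set (Fin n → ℝ)))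
      ≤ signedVolume fun i => convexHull ℝ (V' i : Set (Fin n → ℝ)) := by
  classical
  have h1 := signedVolume_mono_of_subset (a := id) (T := V) (S := fun i => V i ∪ V' i)
    (fun i => Finset.subset_union_left) hV
    fun i => (hV i).mono Finset.subset_union_left
  have h2 : ∀ i, convexHull ℝ ((V i ∪ V' i : Finset (Fin n → ℝ)) : Set (Fin n → ℝ))
      = convexHull ℝ (V' i : Set (Fin n → ℝ)) := by
    intro i
    refine Set.Subset.antisymm (convexHull_min ?_ (convex_convexHull ℝ _)) (convexHull_mono ?_)
    · rw [Finset.coe_union]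
      exact Set.union_subset (h i) (subset_convexHull ℝ _)
    · simp
  simpa only [Set.image_id, h2] using h1

end Degeneration

/-! ### Corner simplices -/

section CornerSimplex

open MeasureTheory

/-- The simplex cut off from the positive orthant by `∑ j, w j * x j ≤ t`. -/
def cornerSimplex {n : ℕ} (w : Fin n → ℝ) (t : ℝ) : Set (Fin n → ℝ) :=
  {x | (∀ j, 0 ≤ x j) ∧ ∑ j, w j * x j ≤ t}

theorem isClosed_cornerSimplex {n : ℕ} (w : Fin n → ℝ) (t : ℝ) :
    IsClosed (cornerSimplex w t) := by
  have : cornerSimplex w t = (⋂ j, {x | 0 ≤ x j}) ∩ {x | ∑ j, w j * x j ≤ t} := by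
    ext x
    simp [cornerSimplex]
  rw [this]
  exact (isClosed_iInter fun j => isClosed_le continuous_const (continuous_apply j)).inter
    (isClosed_le (by fun_prop) continuous_const)

theorem convex_cornerSimplex {n : ℕ} (w : Fin n → ℝ) (t : ℝ) : Convex ℝ (cornerSimplex w t) := by
  intro x hx y hy a b ha hb hab
  refine ⟨fun j => ?_, ?_⟩
  · have := hx.1 j
    have := hy.1 j
    simp only [Pi.add_apply, Pi.smul_apply, smul_eq_mul]
    positivity
  · have h1 : ∑ j, w j * (a • x + b • y) j = a * ∑ j, w j * x j + b * ∑ j, w j * y j := by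
      simp only [Pi.add_apply, Pi.smul_apply, smul_eq_mul, Finset.mul_sum,
        ← Finset.sum_add_distrib]
      exact Finset.sum_congr rfl fun j _ => by ring
    rw [h1]
    calc _ ≤ a * t + b * t := by
          gcongr
          · exact hx.2
          · exact hy.2
      _ = t := by rw [← add_mul, hab, one_mul]

/-- Cavalieri's principle along the first coordinate, whose slices are corner simplices. -/
theorem volume_cornerSimplex {n : ℕ} {w : Fin n → ℝ} (hw : ∀ j, 0 < w j) {t : ℝ} (ht : 0 ≤ t) :
    volume (cornerSimplex w t) = ENNReal.ofReal (t ^ n / (n.factorial * ∏ j, w j)) := by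
  induction n generalizing t with
  | zero =>
    have : cornerSimplex w t = Set.univ := by
      ext x
      simp [cornerSimplex, ht]
    rw [this, volume_pi, Measure.pi_univ]
    simp
  | succ n ih =>
    have hmp := (volume_preserving_piFinSuccAbove (fun _ : Fin (n + 1) => ℝ) 0).symm
    rw [← hmp.measure_preimage (isClosed_cornerSimplex w t).measurableSet.nullMeasurableSet,
      Measure.volume_eq_prod, Measure.prod_apply
        (hmp.measurable (isClosed_cornerSimplex w t).measurableSet)]
    have hfib : ∀ s : ℝ, volume (Prod.mk s ⁻¹'
        ((MeasurableEquiv.piFinSuccAbove (fun _ : Fin (n + 1) => ℝ) 0).symm ⁻¹'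
          (cornerSimplex w t)))
        = (Set.Icc 0 (t / w 0)).indicator (fun s => ENNReal.ofReal
          ((t - w 0 * s) ^ n / (n.factorial * ∏ j : Fin n, w j.succ))) s := by
      intro s
      have hset : (Prod.mk s ⁻¹' ((MeasurableEquiv.piFinSuccAbove (fun _ : Fin (n + 1) => ℝ) 0).symm
          ⁻¹' (cornerSimplex w t)))
          = {x | 0 ≤ s ∧ x ∈ cornerSimplex (fun j : Fin n => w j.succ) (t - w 0 * s)} := by
        ext x
        simp [cornerSimplex, MeasurableEquiv.piFinSuccAbove, Fin.forall_fin_succ,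
          Fin.sum_univ_succ, and_assoc, le_sub_iff_add_le']
      rw [hset]
      by_cases hs : s ∈ Set.Icc 0 (t / w 0)
      · rw [Set.indicator_of_mem hs]
        have h1 : 0 ≤ t - w 0 * s := by
          have := (le_div_iff₀ (hw 0)).mp hs.2
          linarith
        simp only [hs.1, true_and]
        exact ih (fun j => hw j.succ) h1
      · rw [Set.indicator_of_notMem hs]
        refine (congrArg _ ?_).trans measure_empty
        refine Set.eq_empty_of_forall_notMem ?_
        rintro x ⟨h0, hx⟩
        refine hs ⟨h0, (le_div_iff₀ (hw 0)).mpr ?_⟩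
        have := Finset.sum_nonneg fun j (_ : j ∈ Finset.univ) =>
          mul_nonneg (hw (Fin.succ j)).le (hx.1 j)
        have := hx.2
        linarith
    simp_rw [hfib]
    have hts : 0 ≤ t / w 0 := div_nonneg ht (hw 0).le
    have hP : 0 < ∏ j : Fin n, w j.succ := Finset.prod_pos fun j _ => hw _
    rw [lintegral_indicator measurableSet_Icc, ← ofReal_integral_eq_lintegral_ofReal]
    · congr 1
      rw [integral_Icc_eq_integral_Ioc, ← intervalIntegral.integral_of_le hts]
      have hd : ∀ s ∈ Set.uIcc 0 (t / w 0), HasDerivAt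
          (fun s => - ((t - w 0 * s) ^ (n + 1) / ((n + 1).factorial * ∏ j, w j)))
          ((t - w 0 * s) ^ n / (n.factorial * ∏ j : Fin n, w j.succ)) s := by
        intro s _
        have h1 : HasDerivAt (fun s => t - w 0 * s) (-(w 0)) s := by
          simpa using ((hasDerivAt_id s).const_mul (w 0)).const_sub t
        have h2 := ((h1.fun_pow (n + 1)).div_const ((n + 1).factorial * ∏ j, w j)).neg
        refine HasDerivAt.congr_deriv h2 ?_
        have := (hw 0).ne'
        rw [Fin.prod_univ_succ, Nat.factorial_succ]
        push_cast
        field_simp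
      rw [intervalIntegral.integral_eq_sub_of_hasDerivAt hd
        (by apply Continuous.intervalIntegrable; fun_prop)]
      have := (hw 0).ne'
      field_simp
      simp
    · refine Continuous.integrableOn_Icc ?_
      fun_prop
    · refine (ae_restrict_iff' measurableSet_Icc).mpr (Filter.Eventually.of_forall fun s hs => ?_)
      have := (le_div_iff₀ (hw 0)).mp hs.2
      have h1 : 0 ≤ t - w 0 * s := by linarith
      dsimp
      positivity

theorem volume_real_cornerSimplex {n : ℕ} {w : Fin n → ℝ} (hw : ∀ j, 0 < w j) {t : ℝ}
    (ht : 0 ≤ t) :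
    volume.real (cornerSimplex w t) = t ^ n / (n.factorial * ∏ j, w j) := by
  have hP : 0 < ∏ j : Fin n, w j := Finset.prod_pos fun j _ => hw _
  rw [Measure.real, volume_cornerSimplex hw ht, ENNReal.toReal_ofReal (by positivity)]

theorem sum_cornerSimplex {n : ℕ} {ι : Type*} {w : Fin n → ℝ} (hw : ∀ j, 0 < w j) (I : Finset ι)
    {t : ι → ℝ} (ht : ∀ i, 0 ≤ t i) :
    ∑ i ∈ I, cornerSimplex w (t i) = cornerSimplex w (∑ i ∈ I, t i) := by
  ext x
  rw [Set.mem_finsetSum]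
  constructor
  · rintro ⟨g, hg, rfl⟩
    refine ⟨fun j => ?_, ?_⟩
    · rw [Finset.sum_apply]
      exact Finset.sum_nonneg fun i hi => (hg hi).1 j
    · simp_rw [Finset.sum_apply, Finset.mul_sum]
      rw [Finset.sum_comm]
      exact Finset.sum_le_sum fun i hi => (hg hi).2
  · intro hx
    have hT : 0 ≤ ∑ i ∈ I, t i := Finset.sum_nonneg fun i _ => ht i
    rcases hT.eq_or_lt with h0 | hpos
    · have hx0 : x = 0 := by
        have h1 : ∑ j, w j * x j = 0 := le_antisymm (h0 ▸ hx.2)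
          (Finset.sum_nonneg fun j _ => mul_nonneg (hw j).le (hx.1 j))
        rw [Finset.sum_eq_zero_iff_of_nonneg
          fun j _ => mul_nonneg (hw j).le (hx.1 j)] at h1
        ext j
        exact (mul_eq_zero.mp (h1 j (Finset.mem_univ j))).resolve_left (hw j).ne'
      refine ⟨fun _ => 0, fun {i} _ => ⟨fun _ => le_rfl, by simp [ht i]⟩, by simp [hx0]⟩
    · refine ⟨fun i => (t i / ∑ i ∈ I, t i) • x, fun {i} _ => ⟨fun j => ?_, ?_⟩, ?_⟩
      · exact mul_nonneg (div_nonneg (ht i) hT) (hx.1 j)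
      · have h1 : ∑ j, w j * ((t i / ∑ i ∈ I, t i) • x) j
            = (t i / ∑ i ∈ I, t i) * ∑ j, w j * x j := by
          rw [Finset.mul_sum]
          exact Finset.sum_congr rfl fun j _ => by simp; ring
        rw [h1]
        calc _ ≤ (t i / ∑ i ∈ I, t i) * ∑ i ∈ I, t i :=
              mul_le_mul_of_nonneg_left hx.2 (div_nonneg (ht i) hT)
          _ = t i := div_mul_cancel₀ _ hpos.ne'
      · rw [← Finset.sum_smul, ← Finset.sum_div, div_self hpos.ne', one_smul]

theorem signedVolume_cornerSimplex {n : ℕ} {w : Fin n → ℝ} (hw : ∀ j, 0 < w j)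
    {t : Fin n → ℝ} (ht : ∀ i, 0 ≤ t i) :
    signedVolume (fun i => cornerSimplex w (t i)) = (∏ i, t i) / ∏ j, w j := by
  have hP : 0 < ∏ j : Fin n, w j := Finset.prod_pos fun j _ => hw _
  unfold signedVolume
  simp_rw [sum_cornerSimplex hw _ ht,
    volume_real_cornerSimplex hw (Finset.sum_nonneg fun i _ => ht i), mul_div_assoc']
  rw [← Finset.sum_div, signed_sum_pow_sum]
  have := n.factorial_ne_zero
  field_simp

end CornerSimplex

/-! ### Splitting off one coordinate -/

section Peel

open MeasureTheory

variable {ι : Type*} {n : ℕ}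

/-- With `x 0` fixed, the weights are those of the projected points, with `x 0` absorbed into the
coefficients. -/
theorem gibbsWeight_cons (a : ι → Fin (n + 1) → ℝ) (θ : ι → ℝ) (x : Fin (n + 1) → ℝ) (k : ι) :
    gibbsWeight a θ x k
      = gibbsWeight (fun k => Fin.tail (a k)) (fun k => θ k + a k 0 * x 0) (Fin.tail x) k := by
  unfold gibbsWeight
  simp only [dotProduct, Fin.sum_univ_succ, Fin.tail, add_assoc]

theorem gibbsCov_submatrix_succ (a : ι → Fin (n + 1) → ℝ) (S : Finset ι) (θ : ι → ℝ)
    (x : Fin (n + 1) → ℝ) :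
    (gibbsCov a S θ x).submatrix Fin.succ Fin.succ
      = gibbsCov (fun k => Fin.tail (a k)) S (fun k => θ k + a k 0 * x 0) (Fin.tail x) := by
  ext r c
  simp only [gibbsCov, gibbsMean, gibbsProb, gibbsZ, gibbsWeight_cons a θ x, Matrix.submatrix_apply,
    Matrix.of_apply, Fin.tail]

theorem gibbsCov_congr (a : ι → Fin n → ℝ) {S : Finset ι} {θ θ' : ι → ℝ}
    (h : ∀ k ∈ S, θ k = θ' k) (x : Fin n → ℝ) : gibbsCov a S θ x = gibbsCov a S θ' x := by
  have hw : ∀ k ∈ S, gibbsWeight a θ x k = gibbsWeight a θ' x k := fun k hk => by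
    rw [gibbsWeight, gibbsWeight, h k hk]
  have hZ : gibbsZ a S θ x = gibbsZ a S θ' x := Finset.sum_congr rfl hw
  have hp : ∀ k ∈ S, gibbsProb a S θ x k = gibbsProb a S θ' x k := fun k hk => by
    rw [gibbsProb, gibbsProb, hw k hk, hZ]
  have hm : gibbsMean a S θ x = gibbsMean a S θ' x := by
    ext j
    exact Finset.sum_congr rfl fun k hk => by rw [hp k hk]
  ext r c
  exact Finset.sum_congr rfl fun k hk => by rw [hp k hk, hm]

/-- With the last coordinates fixed, the upper left entry is the variance of a one-dimensional
Gibbs measure. -/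
theorem gibbsCov_zero_zero (a : ι → Fin (n + 1) → ℝ) (S : Finset ι) (θ : ι → ℝ)
    (x : Fin (n + 1) → ℝ) :
    gibbsCov a S θ x 0 0 = gibbsCov (fun k (_ : Fin 1) => a k 0) S
      (fun k => θ k + Fin.tail (a k) ⬝ᵥ Fin.tail x) (fun _ => x 0) 0 0 := by
  have h : ∀ k, gibbsWeight a θ x k = gibbsWeight (fun k (_ : Fin 1) => a k 0)
      (fun k => θ k + Fin.tail (a k) ⬝ᵥ Fin.tail x) (fun _ => x 0) k := by
    intro k
    simp only [gibbsWeight, dotProduct, Fin.sum_univ_succ, Fin.tail, Finset.univ_unique,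
      Finset.sum_singleton]
    congr 1
    ring
  simp only [gibbsCov, gibbsMean, gibbsProb, gibbsZ, h, Matrix.of_apply]

theorem gibbsCov_eq_zero_left (a : ι → Fin n → ℝ) (S : Finset ι) (θ : ι → ℝ)
    (x : Fin n → ℝ) {r : Fin n} (hr : ∀ k ∈ S, a k r = 0) (c : Fin n) :
    gibbsCov a S θ x r c = 0 := by
  have h1 : gibbsMean a S θ x r = 0 := Finset.sum_eq_zero fun k hk => by simp [hr k hk]
  exact Finset.sum_eq_zero fun k hk => by simp [h1, hr k hk]

theorem gibbsCov_eq_zero_right (a : ι → Fin n → ℝ) (S : Finset ι) (θ : ι → ℝ)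
    (x : Fin n → ℝ) {c : Fin n} (hc : ∀ k ∈ S, a k c = 0) (r : Fin n) :
    gibbsCov a S θ x r c = 0 := by
  have h1 : gibbsMean a S θ x c = 0 := Finset.sum_eq_zero fun k hk => by simp [hc k hk]
  exact Finset.sum_eq_zero fun k hk => by simp [h1, hc k hk]

/-- In dimension one, the variance integrates to the length of the hull, which contains the segment
between any two of the points. -/
theorem ofReal_sub_le_lintegral_gibbsCov_one (b : ι → ℝ) {S : Finset ι} (θ : ι → ℝ) {k l : ι}
    (hk : k ∈ S) (hl : l ∈ S) (hlk : b l < b k) :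
    ENNReal.ofReal (b k - b l) ≤ ∫⁻ s : ℝ, ENNReal.ofReal
      (gibbsCov (fun k (_ : Fin 1) => b k) S θ (fun _ => s) 0 0) := by
  have hS : AffinelySpans (fun k (_ : Fin 1) => b k) S := by
    refine ⟨⟨k, hk⟩, fun v hv => ?_⟩
    have h1 := hv k hk l hl
    simp only [dotProduct, Finset.univ_unique, Finset.sum_singleton] at h1
    ext j
    rw [Subsingleton.elim j default, Pi.zero_apply]
    have h2 : (b k - b l) * v default = 0 := by linarith
    exact (mul_eq_zero.mp h2).resolve_left (by linarith)
  have h1 := lintegral_det_sum_gibbsCov (fun k (_ : Fin 1) => b k) (S := fun _ => S)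
    (fun _ => θ) Finset.univ_nonempty fun _ => hS
  have h2 := (volume_preserving_funUnique (Fin 1) ℝ).symm.lintegral_comp_emb
    (MeasurableEquiv.measurableEmbedding _)
    (fun x => ENNReal.ofReal (∑ _i : Fin 1, gibbsCov (fun k (_ : Fin 1) => b k) S θ x).det)
  simp only [Finset.univ_unique, Finset.sum_singleton, Matrix.det_unique] at h1 h2
  have h3 : ∀ s : ℝ, (MeasurableEquiv.funUnique (Fin 1) ℝ).symm s = fun _ => s := fun s => rfl
  simp_rw [h3] at h2
  change _ ≤ ∫⁻ s : ℝ, ENNReal.ofReal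
      (gibbsCov (fun k (_ : Fin 1) => b k) S θ (fun _ => s) default default)
  refine le_of_le_of_eq ?_ (h2.trans h1).symm
  have h4 : Set.Icc (fun _ : Fin 1 => b l) (fun _ => b k)
      ⊆ convexHull ℝ ((fun k (_ : Fin 1) => b k) '' S) := by
    intro x hx
    have h5 := segment_subset_convexHull (𝕜 := ℝ) (s := (fun k (_ : Fin 1) => b k) '' S)
      ⟨l, hl, rfl⟩ ⟨k, hk, rfl⟩
    refine h5 ?_
    have hx0 : x 0 ∈ segment ℝ (b l) (b k) := by
      rw [segment_eq_Icc hlk.le]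
      exact ⟨hx.1 0, hx.2 0⟩
    obtain ⟨p, q, hp, hq, hpq, h⟩ := hx0
    refine ⟨p, q, hp, hq, hpq, ?_⟩
    ext j
    rw [Subsingleton.elim j 0]
    exact h
  refine le_trans ?_ (measure_mono h4)
  rw [Real.volume_Icc_pi]
  simp

theorem piFinSuccAbove_symm_eq_cons :
    ((MeasurableEquiv.piFinSuccAbove (fun _ : Fin (n + 1) => ℝ) 0).symm :
      ℝ × (Fin n → ℝ) → Fin (n + 1) → ℝ) = fun p => Fin.cons p.1 p.2 := by
  funext p
  exact Fin.insertNth_zero' p.1 p.2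

theorem measurable_fin_cons :
    Measurable fun p : ℝ × (Fin n → ℝ) => (Fin.cons p.1 p.2 : Fin (n + 1) → ℝ) := by
  rw [← piFinSuccAbove_symm_eq_cons]
  exact MeasurableEquiv.measurable _

theorem lintegral_fin_succ {f : (Fin (n + 1) → ℝ) → ENNReal} :
    ∫⁻ x, f x = ∫⁻ p : ℝ × (Fin n → ℝ), f (Fin.cons p.1 p.2) := by
  have h := (volume_preserving_piFinSuccAbove (fun _ : Fin (n + 1) => ℝ) 0).symm.lintegral_comp_emb
    (MeasurableEquiv.measurableEmbedding _) f
  rw [← h, piFinSuccAbove_symm_eq_cons]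

/-- The first polytope lies on the first coordinate axis. Then the mixed discriminant splits off its
variance, and the other factor is integrated over the last coordinates first. -/
theorem ofReal_mul_signedVolume_le_lintegral_of_head {a : ι → Fin (n + 1) → ℝ}
    {T : Fin (n + 1) → Finset ι}
    (hT : ∀ i, (T i).Nonempty)
    (h0 : ∀ k ∈ T 0, ∀ j : Fin n, a k j.succ = 0) {k l : ι} (hk : k ∈ T 0) (hl : l ∈ T 0)
    (hlk : a l 0 < a k 0)
    (hs : ∀ i : Fin n, AffinelySpans (fun k => Fin.tail (a k)) (T i.succ)) :
    ENNReal.ofReal ((a k 0 - a l 0) * signedVolume fun i : Fin n =>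
      convexHull ℝ ((fun k => Fin.tail (a k)) '' T i.succ))
      ≤ ∫⁻ x, ENNReal.ofReal (mixedDisc fun i => gibbsCov a (T i) (fun _ => 0) x) := by
  have hmeas : Measurable fun p : ℝ × (Fin n → ℝ) => ENNReal.ofReal
      (mixedDisc fun i => gibbsCov a (T i) (fun _ => 0) (Fin.cons p.1 p.2)) := by
    have h1 := (continuous_mixedDisc_gibbsCov a (fun _ _ => 0) hT).measurable.ennreal_ofReal
    exact h1.comp measurable_fin_cons
  rw [lintegral_fin_succ, Measure.volume_eq_prod, lintegral_prod _ hmeas.aemeasurable]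
  have hD : ∀ (s : ℝ) (x : Fin n → ℝ), ENNReal.ofReal
      (mixedDisc fun i => gibbsCov a (T i) (fun _ => 0) (Fin.cons s x : Fin (n + 1) → ℝ))
      = ENNReal.ofReal (gibbsCov (fun k (_ : Fin 1) => a k 0) (T 0) (fun _ => 0) (fun _ => s) 0 0) *
        ENNReal.ofReal (mixedDisc fun i : Fin n => gibbsCov (fun k => Fin.tail (a k)) (T i.succ)
          (fun k => a k 0 * s) x) := by
    intro s x
    rw [mixedDisc_succ_of_head, ENNReal.ofReal_mul]
    · simp_rw [gibbsCov_submatrix_succ]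
      rw [gibbsCov_zero_zero]
      simp only [Fin.cons_zero, Fin.tail_cons, zero_add]
      rw [gibbsCov_congr (θ' := fun _ => 0)]
      intro k hk
      exact Finset.sum_eq_zero fun j _ => by rw [Fin.tail, h0 k hk j, zero_mul]
    · exact (gibbsCov_posSemidef a _ (hT 0) _).diag_nonneg
    · rintro r c (h | h)
      · obtain ⟨j, rfl⟩ := Fin.exists_succ_eq.mpr h
        exact gibbsCov_eq_zero_left a _ _ _ (fun k hk => h0 k hk j) c
      · obtain ⟨j, rfl⟩ := Fin.exists_succ_eq.mpr h
        exact gibbsCov_eq_zero_right a _ _ _ (fun k hk => h0 k hk j) r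
  simp_rw [hD]
  have hin : ∀ s : ℝ, ∫⁻ x : Fin n → ℝ, ENNReal.ofReal
        (gibbsCov (fun k (_ : Fin 1) => a k 0) (T 0) (fun _ => 0) (fun _ => s) 0 0) *
        ENNReal.ofReal (mixedDisc fun i : Fin n => gibbsCov (fun k => Fin.tail (a k)) (T i.succ)
          (fun k => a k 0 * s) x)
      = ENNReal.ofReal
        (gibbsCov (fun k (_ : Fin 1) => a k 0) (T 0) (fun _ => 0) (fun _ => s) 0 0) *
        ENNReal.ofReal (signedVolume fun i : Fin n =>
          convexHull ℝ ((fun k => Fin.tail (a k)) '' T i.succ)) := by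
    intro s
    rw [lintegral_const_mul' _ _ ENNReal.ofReal_ne_top,
      lintegral_mixedDisc_gibbsCov _ (fun _ k => a k 0 * s) hs]
  simp_rw [hin]
  rw [lintegral_mul_const' _ _ ENNReal.ofReal_ne_top, ENNReal.ofReal_mul (by linarith)]
  gcongr
  exact ofReal_sub_le_lintegral_gibbsCov_one (fun k => a k 0) _ hk hl hlk

/-- All polytopes but the first lie in the hyperplane `x 0 = 0`. Then the mixed discriminant splits
off the upper left entry of the first Hessian, which is integrated over `x 0` first. -/
theorem ofReal_mul_signedVolume_le_lintegral_of_tail {a : ι → Fin (n + 1) → ℝ}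
    {T : Fin (n + 1) → Finset ι}
    (hT : ∀ i, (T i).Nonempty)
    (h0 : ∀ i : Fin n, ∀ k ∈ T i.succ, a k 0 = 0) {k l : ι} (hk : k ∈ T 0) (hl : l ∈ T 0)
    (hlk : a l 0 < a k 0)
    (hs : ∀ i : Fin n, AffinelySpans (fun k => Fin.tail (a k)) (T i.succ)) :
    ENNReal.ofReal ((a k 0 - a l 0) * signedVolume fun i : Fin n =>
      convexHull ℝ ((fun k => Fin.tail (a k)) '' T i.succ))
      ≤ ∫⁻ x, ENNReal.ofReal (mixedDisc fun i => gibbsCov a (T i) (fun _ => 0) x) := by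
  have hmeas : Measurable fun p : ℝ × (Fin n → ℝ) => ENNReal.ofReal
      (mixedDisc fun i => gibbsCov a (T i) (fun _ => 0) (Fin.cons p.1 p.2)) := by
    have h1 := (continuous_mixedDisc_gibbsCov a (fun _ _ => 0) hT).measurable.ennreal_ofReal
    exact h1.comp measurable_fin_cons
  rw [lintegral_fin_succ, Measure.volume_eq_prod, lintegral_prod_symm _ hmeas.aemeasurable]
  have hD : ∀ (s : ℝ) (x : Fin n → ℝ), ENNReal.ofReal
      (mixedDisc fun i => gibbsCov a (T i) (fun _ => 0) (Fin.cons s x : Fin (n + 1) → ℝ))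
      = ENNReal.ofReal (gibbsCov (fun k (_ : Fin 1) => a k 0) (T 0)
          (fun k => Fin.tail (a k) ⬝ᵥ x) (fun _ => s) 0 0) *
        ENNReal.ofReal (mixedDisc fun i : Fin n => gibbsCov (fun k => Fin.tail (a k)) (T i.succ)
          (fun _ => 0) x) := by
    intro s x
    rw [mixedDisc_succ_of_tail, ENNReal.ofReal_mul]
    · simp_rw [gibbsCov_submatrix_succ]
      rw [gibbsCov_zero_zero]
      simp only [Fin.cons_zero, Fin.tail_cons, zero_add]
      congr 2
      refine congrArg mixedDisc (funext fun i => gibbsCov_congr _ (fun k hk => ?_) _)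
      rw [h0 i k hk, zero_mul]
    · exact (gibbsCov_posSemidef a _ (hT 0) _).diag_nonneg
    · exact fun i c => gibbsCov_eq_zero_left a _ _ _ (h0 i) c
    · exact fun i r => gibbsCov_eq_zero_right a _ _ _ (h0 i) r
  simp_rw [hD]
  have hin : ∀ x : Fin n → ℝ, ENNReal.ofReal (a k 0 - a l 0) *
        ENNReal.ofReal (mixedDisc fun i : Fin n => gibbsCov (fun k => Fin.tail (a k)) (T i.succ)
          (fun _ => 0) x)
      ≤ ∫⁻ s : ℝ, ENNReal.ofReal (gibbsCov (fun k (_ : Fin 1) => a k 0) (T 0)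
          (fun k => Fin.tail (a k) ⬝ᵥ x) (fun _ => s) 0 0) *
        ENNReal.ofReal (mixedDisc fun i : Fin n => gibbsCov (fun k => Fin.tail (a k)) (T i.succ)
          (fun _ => 0) x) := by
    intro x
    rw [lintegral_mul_const' _ _ ENNReal.ofReal_ne_top]
    gcongr
    exact ofReal_sub_le_lintegral_gibbsCov_one (fun k => a k 0) _ hk hl hlk
  refine le_trans ?_ (lintegral_mono hin)
  rw [lintegral_const_mul' _ _ ENNReal.ofReal_ne_top,
    lintegral_mixedDisc_gibbsCov _ (fun _ _ => 0) hs, ENNReal.ofReal_mul (by linarith)]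

end Peel

/-! ### Polytopes spanned by multiples of the basis vectors -/

section Axis

variable {n : ℕ}

/-- The points `N • e j` on the coordinate axes. -/
noncomputable def axisPoints (n : ℕ) (N : ℝ) : Finset (Fin n → ℝ) :=
  Finset.univ.image fun j => Pi.single j N

theorem mem_axisPoints {N : ℝ} {x : Fin n → ℝ} :
    x ∈ axisPoints n N ↔ ∃ j, Pi.single j N = x := by
  simp [axisPoints]

theorem affinelySpans_insert_axisPoints {N : ℝ} (hN : N ≠ 0) {v : Fin n → ℝ}
    (hv : ∑ j, v j ≠ N) : AffinelySpans id (insert v (axisPoints n N)) := by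
  refine ⟨⟨v, Finset.mem_insert_self _ _⟩, fun u hu => ?_⟩
  have h1 : ∀ j, N * u j = v ⬝ᵥ u := by
    intro j
    have := hu (Pi.single j N) (Finset.mem_insert_of_mem (mem_axisPoints.mpr ⟨j, rfl⟩)) v
      (Finset.mem_insert_self _ _)
    simpa using this
  have h2 : (N - ∑ j, v j) * (v ⬝ᵥ u) = 0 := by
    have h3 : N * (v ⬝ᵥ u) = (∑ j, v j) * (v ⬝ᵥ u) := by
      rw [dotProduct, Finset.mul_sum, Finset.sum_mul]
      refine Finset.sum_congr rfl fun j _ => ?_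
      rw [← dotProduct, ← h1 j]
      ring
    rw [sub_mul, h3, sub_self]
  have h4 := (mul_eq_zero.mp h2).resolve_left (sub_ne_zero.mpr hv.symm)
  ext j
  have := h1 j
  rw [h4] at this
  exact (mul_eq_zero.mp this).resolve_left hN

theorem affinelySpans_of_image {ι κ : Type*} {a : ι → Fin n → ℝ} {b : κ → Fin n → ℝ}
    {S : Finset ι} {T : Finset κ} (h : b '' T ⊆ a '' S) (hT : AffinelySpans b T) :
    AffinelySpans a S := by
  refine ⟨?_, fun v hv => hT.2 v fun k hk l hl => ?_⟩
  · obtain ⟨k, hk⟩ := hT.1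
    obtain ⟨s, hs, -⟩ := h ⟨k, hk, rfl⟩
    exact ⟨s, hs⟩
  · obtain ⟨s, hs, hs'⟩ := h ⟨k, hk, rfl⟩
    obtain ⟨t, ht, ht'⟩ := h ⟨l, hl, rfl⟩
    rw [← hs', ← ht']
    exact hv s hs t ht

theorem cornerSimplex_subset_convexHull {N : ℝ} (hN : 0 < N) {s : Set (Fin n → ℝ)}
    (h0 : 0 ∈ convexHull ℝ s) (hs : ∀ j, Pi.single j N ∈ convexHull ℝ s) :
    cornerSimplex (fun _ => 1) N ⊆ convexHull ℝ s := by
  intro x hx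
  have hc := convex_convexHull ℝ s
  have h1 := hc.sum_mem (t := Finset.univ) (w := fun o : Option (Fin n) =>
      o.elim (1 - ∑ j, x j / N) fun j => x j / N) (z := fun o => o.elim 0 fun j => Pi.single j N)
    ?_ ?_ ?_
  · convert! h1 using 1
    rw [Fintype.sum_option]
    ext j
    simp [Finset.sum_apply, Pi.single_apply, hN.ne']
  · rintro (_ | j) _
    · have h2 := hx.2
      simp only [one_mul] at h2
      rw [Option.elim_none, ← Finset.sum_div, sub_nonneg, div_le_one hN]
      exact h2
    · exact div_nonneg (hx.1 j) hN.le
  · rw [Fintype.sum_option]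
    simp
  · rintro (_ | j) _
    · exact h0
    · exact hs j

theorem single_mem_cornerSimplex {N c : ℝ} (h0 : 0 ≤ c) (h : c ≤ N) (i : Fin n) :
    Pi.single i c ∈ cornerSimplex (fun _ => 1) N := by
  refine ⟨fun j => ?_, ?_⟩
  · by_cases hij : j = i
    · subst hij; simpa using h0
    · simp [hij]
  · simpa using h

theorem tail_single_zero (c : ℝ) :
    (Fin.tail (Pi.single 0 c : Fin (n + 1) → ℝ) : Fin n → ℝ) = 0 := by
  ext j
  simp [Fin.tail]

theorem tail_single_succ (i : Fin n) (c : ℝ) :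
    Fin.tail (Pi.single i.succ c : Fin (n + 1) → ℝ) = Pi.single i c := by
  ext j
  simp [Fin.tail, Pi.single_apply]

/-- Induction on the dimension. Two families of faces contribute. In the first, the first polytope
is replaced by the segment from `c 0 • e 0` to `N • e 0`, and the others are kept; this gives
`(N - c 0) * N ^ n`, since projecting along `e 0` yields the simplex of size `N` for each of them.
In the second, `N • e 0` is omitted everywhere, and all polytopes but the first lie in the
hyperplane `x 0 = 0`; this gives `c 0` times the bound in dimension `n`. -/
theorem sub_prod_le_signedVolume_axis {N : ℝ} (hN : 0 < N) (c : Fin n → ℝ) (hc0 : ∀ i, 0 ≤ c i)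
    (hcN : ∀ i, c i < N) :
    N ^ n - ∏ i, c i ≤ signedVolume fun i =>
      convexHull ℝ (insert (Pi.single i (c i)) (axisPoints n N) : Finset (Fin n → ℝ)) := by
  classical
  induction n with
  | zero =>
    have := signedVolume_nonneg (n := 0) id (S := fun i => insert (Pi.single i (c i))
      (axisPoints 0 N)) fun i => i.elim0
    simpa using this
  | succ n ih =>
    set S : Fin (n + 1) → Finset (Fin (n + 1) → ℝ) := fun i =>
      insert (Pi.single i (c i)) (axisPoints (n + 1) N) with hS
    have hmem : ∀ {i k}, k ∈ S i ↔ k = Pi.single i (c i) ∨ k = Pi.single 0 N ∨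
        ∃ j : Fin n, k = Pi.single j.succ N := by
      intro i k
      simp only [hS, Finset.mem_insert, mem_axisPoints, Fin.exists_fin_succ]
      simp only [eq_comm]
    have hspan : ∀ i, AffinelySpans id (S i) := fun i =>
      affinelySpans_insert_axisPoints hN.ne' (by simpa using (hcN i).ne)
    have hSV0 := signedVolume_nonneg id hspan
    suffices h : N ^ (n + 1) - ∏ i, c i ≤ signedVolume fun i =>
        convexHull ℝ (id '' (S i : Set (Fin (n + 1) → ℝ))) by
      simpa only [Set.image_id] using h
    -- the family with a segment on the first axis, of weight `0` there and `-1` elsewhere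
    set T : Fin (n + 1) → Finset (Fin (n + 1) → ℝ) := fun i =>
      if i = 0 then {Pi.single 0 (c 0), Pi.single 0 N} else S i with hT
    set g : Fin (n + 1) → (Fin (n + 1) → ℝ) → ℝ := fun i k => if k ∈ T i then 0 else -1 with hg
    have hTS : ∀ i, T i ⊆ S i := by
      intro i
      by_cases hi : i = 0
      · subst hi
        intro k hk
        simp only [hT, if_true, Finset.mem_insert, Finset.mem_singleton] at hk
        exact hmem.mpr (hk.imp id Or.inl)
      · simp [hT, hi]
    have hTne : ∀ i, (T i).Nonempty := by
      intro i
      by_cases hi : i = 0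
      · exact ⟨Pi.single 0 N, by simp [hT, hi]⟩
      · simpa [hT, hi] using (hspan i).1
    have hface : ∀ i, IsInitialFace (S i) (T i) (g i) := fun i =>
      ⟨hTS i, hTne i, 0, fun k hk => by simp [hg, hk], fun k _ hk => by simp [hg, hk]⟩
    have htailS : ∀ i : Fin n, ((insert 0 (axisPoints n N) : Finset (Fin n → ℝ)) : Set _)
        ⊆ (fun k : Fin (n + 1) → ℝ => Fin.tail k) '' (S i.succ) := by
      intro i x hx
      rw [Finset.mem_coe, Finset.mem_insert, mem_axisPoints] at hx
      rcases hx with rfl | ⟨j, rfl⟩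
      · exact ⟨Pi.single 0 N, hmem.mpr (Or.inr (Or.inl rfl)), tail_single_zero N⟩
      · exact ⟨Pi.single j.succ N, hmem.mpr (Or.inr (Or.inr ⟨j, rfl⟩)), tail_single_succ j N⟩
    have hhull : ∀ i : Fin n, convexHull ℝ ((fun k : Fin (n + 1) → ℝ => Fin.tail k) '' (S i.succ))
        = cornerSimplex (fun _ => 1) N := by
      intro i
      refine Set.Subset.antisymm (convexHull_min ?_ (convex_cornerSimplex _ _)) ?_
      · rintro _ ⟨k, hk, rfl⟩
        dsimp only
        rcases hmem.mp hk with rfl | rfl | ⟨j, rfl⟩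
        · rw [tail_single_succ]
          exact single_mem_cornerSimplex (hc0 _) (hcN _).le i
        · rw [tail_single_zero]
          exact ⟨fun _ => le_rfl, by simpa using hN.le⟩
        · rw [tail_single_succ]
          exact single_mem_cornerSimplex hN.le le_rfl j
      · refine cornerSimplex_subset_convexHull hN ?_ fun j => ?_
        · exact subset_convexHull ℝ _ (htailS i (Finset.mem_insert_self _ _))
        · exact subset_convexHull ℝ _ (htailS i (Finset.mem_insert_of_mem
            (mem_axisPoints.mpr ⟨j, rfl⟩)))
    have hpiece1 : ENNReal.ofReal ((N - c 0) * N ^ n) ≤ ∫⁻ x, ENNReal.ofReal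
        (mixedDisc fun i => gibbsCov id (T i) (fun _ => 0) x) := by
      have h1 := ofReal_mul_signedVolume_le_lintegral_of_head (a := id) (T := T) hTne
        (k := Pi.single 0 N) (l := Pi.single 0 (c 0)) ?_ (by simp [hT]) (by simp [hT])
        (by simpa using hcN 0) ?_
      · have h2 : ∀ i : Fin n, T i.succ = S i.succ := fun i => by simp [hT]
        simp only [h2, id_eq, hhull] at h1
        rw [signedVolume_cornerSimplex (fun _ => one_pos) fun _ => hN.le] at h1
        simpa using h1
      · intro k hk j
        simp only [hT, if_true, Finset.mem_insert, Finset.mem_singleton] at hk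
        rcases hk with rfl | rfl <;> simp
      · intro i
        have h2 : T i.succ = S i.succ := by simp [hT]
        rw [h2]
        refine affinelySpans_of_image ?_
          (affinelySpans_insert_axisPoints hN.ne' (v := (0 : Fin n → ℝ)) (by simpa using hN.ne))
        simpa using htailS i
    -- in dimension one, and if `c 0 = 0`, the first family suffices
    rcases Nat.eq_zero_or_pos n with hn | hn
    · subst hn
      have h1 := hpiece1.trans (lintegral_initialFace_le hspan hface)
      rw [ENNReal.ofReal_le_ofReal_iff hSV0] at h1
      simpa using h1
    rcases (hc0 0).eq_or_lt with h0 | h0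
    · have h1 := hpiece1.trans (lintegral_initialFace_le hspan hface)
      rw [ENNReal.ofReal_le_ofReal_iff hSV0] at h1
      rw [Fin.prod_univ_succ, ← h0]
      rw [← h0] at h1
      refine le_trans (le_of_eq ?_) h1
      ring
    -- the family without `N • e 0`, selected after adding to the weights the functional that is
    -- `-1` at `c 0 • e 0` and `0` at the other basis vectors
    set T' : Fin (n + 1) → Finset (Fin (n + 1) → ℝ) := fun i =>
      (S i).erase (Pi.single 0 N) with hT'
    set y : Fin (n + 1) → ℝ := Pi.single 0 (-(c 0)⁻¹) with hy
    have hne0 : ∀ {i : Fin n} {r : ℝ},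
        (Pi.single i.succ r : Fin (n + 1) → ℝ) ≠ Pi.single 0 N := by
      intro i r h
      have := congrFun h 0
      simp only [Pi.single_eq_same] at this
      rw [Pi.single_eq_of_ne (Fin.succ_ne_zero i).symm] at this
      exact hN.ne this
    have hne1 : (Pi.single 0 (c 0) : Fin (n + 1) → ℝ) ≠ Pi.single 0 N := by
      intro h
      have := congrFun h 0
      simp only [Pi.single_eq_same] at this
      exact (hcN 0).ne this
    have hmem0 : ∀ {k}, k ∈ T' 0 ↔ k = Pi.single 0 (c 0) ∨ ∃ j : Fin n, k = Pi.single j.succ N := by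
      intro k
      rw [hT', Finset.mem_erase, hmem]
      constructor
      · rintro ⟨h, h1 | h1 | h1⟩
        · exact Or.inl h1
        · exact absurd h1 h
        · exact Or.inr h1
      · rintro (rfl | ⟨j, rfl⟩)
        · exact ⟨hne1, Or.inl rfl⟩
        · exact ⟨hne0, Or.inr (Or.inr ⟨j, rfl⟩)⟩
    have hmem1 : ∀ {i : Fin n} {k}, k ∈ T' i.succ ↔
        k = Pi.single i.succ (c i.succ) ∨ ∃ j : Fin n, k = Pi.single j.succ N := by
      intro i k
      rw [hT', Finset.mem_erase, hmem]
      constructor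
      · rintro ⟨h, h1 | h1 | h1⟩
        · exact Or.inl h1
        · exact absurd h1 h
        · exact Or.inr h1
      · rintro (rfl | ⟨j, rfl⟩)
        · exact ⟨hne0, Or.inl rfl⟩
        · exact ⟨hne0, Or.inr (Or.inr ⟨j, rfl⟩)⟩
    have hgy : ∀ k : Fin (n + 1) → ℝ, id k ⬝ᵥ y = - (k 0 / c 0) := by
      intro k
      rw [hy, dotProduct_single, id, div_eq_mul_inv]
      ring
    have hface' : ∀ i, IsInitialFace (S i) (T' i) fun k => g i k + id k ⬝ᵥ y := by
      intro i
      have hj0 : (Pi.single (Fin.succ ⟨0, hn⟩) N : Fin (n + 1) → ℝ) ∈ T' i := by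
        rw [hT', Finset.mem_erase, hmem]
        exact ⟨hne0, Or.inr (Or.inr ⟨_, rfl⟩)⟩
      refine ⟨Finset.erase_subset _ _, ⟨_, hj0⟩, ?_⟩
      have hlast : ∀ k ∈ S i, k ∉ T' i → k = Pi.single 0 N := by
        intro k hk hk'
        by_contra h
        exact hk' (Finset.mem_erase.mpr ⟨h, hk⟩)
      have hNc : 1 < N / c 0 := (one_lt_div h0).mpr (hcN 0)
      rcases Fin.eq_zero_or_eq_succ i with rfl | ⟨i, rfl⟩
      · refine ⟨-1, fun k hk => ?_, fun k hk hk' => ?_⟩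
        · rw [hgy]
          rcases hmem0.mp hk with rfl | ⟨j, rfl⟩
          · simp [hg, hT, h0.ne']
          · have h1 : (Pi.single j.succ N : Fin (n + 1) → ℝ) ≠ Pi.single 0 (c 0) := by
              intro h
              have := congrFun h 0
              simp only [Pi.single_eq_same] at this
              rw [Pi.single_eq_of_ne (Fin.succ_ne_zero j).symm] at this
              exact h0.ne this
            simp [hg, hT, hne0, h1]
        · rw [hgy, hlast k hk hk']
          simp [hg, hT, hNc]
      · have hg0 : ∀ k ∈ S i.succ, g i.succ k = 0 := fun k hk => by simp [hg, hT, hk]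
        refine ⟨0, fun k hk => ?_, fun k hk hk' => ?_⟩
        · rw [hgy, hg0 k (Finset.erase_subset _ _ hk)]
          rcases hmem1.mp hk with rfl | ⟨j, rfl⟩ <;> simp
        · rw [hgy, hg0 k hk, hlast k hk hk']
          simp only [Pi.single_eq_same]
          linarith
    have hpiece2 : ENNReal.ofReal (c 0 * (N ^ n - ∏ i : Fin n, c i.succ)) ≤ ∫⁻ x, ENNReal.ofReal
        (mixedDisc fun i => gibbsCov id (T' i) (fun _ => 0) x) := by
      have himg : ∀ i : Fin n, (fun k : Fin (n + 1) → ℝ => Fin.tail k) '' (T' i.succ)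
          = (insert (Pi.single i (c i.succ)) (axisPoints n N) : Finset (Fin n → ℝ)) := by
        intro i
        ext x
        simp only [Set.mem_image, Finset.mem_coe, hmem1, Finset.mem_insert, mem_axisPoints]
        constructor
        · rintro ⟨k, rfl | ⟨j, rfl⟩, rfl⟩
          · exact Or.inl (tail_single_succ _ _)
          · exact Or.inr ⟨j, (tail_single_succ _ _).symm⟩
        · rintro (rfl | ⟨j, rfl⟩)
          · exact ⟨_, Or.inl rfl, tail_single_succ _ _⟩
          · exact ⟨_, Or.inr ⟨j, rfl⟩, tail_single_succ _ _⟩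
      have h1 := ofReal_mul_signedVolume_le_lintegral_of_tail (a := id) (T := T')
        (fun i => (hface' i).nonempty) ?_ (k := Pi.single 0 (c 0))
        (l := Pi.single (Fin.succ ⟨0, hn⟩) N) (hmem0.mpr (Or.inl rfl))
        (hmem0.mpr (Or.inr ⟨_, rfl⟩)) (by simpa using h0) ?_
      · simp only [id_eq, himg] at h1
        refine le_trans (ENNReal.ofReal_le_ofReal ?_) h1
        have h2 := ih (fun i => c i.succ) (fun i => hc0 _) fun i => hcN _
        have h3 : (Pi.single 0 (c 0) : Fin (n + 1) → ℝ) 0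
            - (Pi.single (Fin.succ ⟨0, hn⟩) N : Fin (n + 1) → ℝ) 0 = c 0 := by
          simp
        rw [h3]
        exact mul_le_mul_of_nonneg_left h2 h0.le
      · intro i k hk
        rcases hmem1.mp hk with rfl | ⟨j, rfl⟩ <;> simp
      · intro i
        refine affinelySpans_of_image ?_ (affinelySpans_insert_axisPoints hN.ne'
          (v := Pi.single i (c i.succ)) (by simpa using (hcN i.succ).ne))
        simp only [id_eq, himg, Set.image_id', le_refl]
    have hy0 : y ≠ 0 := by
      rw [hy, Ne, Pi.single_eq_zero_iff]
      simpa using h0.ne'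
    have hfin := (add_le_add hpiece1 hpiece2).trans
      (lintegral_initialFace_add_le hy0 hspan hface hface')
    have hprod : ∏ i : Fin n, c i.succ ≤ N ^ n := by
      calc _ ≤ ∏ i : Fin n, N := Finset.prod_le_prod (fun i _ => hc0 _) fun i _ => (hcN _).le
        _ = N ^ n := by simp
    rw [← ENNReal.ofReal_add (mul_nonneg (by linarith [hcN 0]) (by positivity))
      (mul_nonneg h0.le (by linarith)), ENNReal.ofReal_le_ofReal_iff hSV0] at hfin
    rw [Fin.prod_univ_succ]
    refine le_trans (le_of_eq ?_) hfin
    ring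

end Axis

/-! ### Relative mixed volumes as defects of mixed volumes of polytopes -/

section Relative

open MeasureTheory

variable {n : ℕ}

theorem signedVolume_comp_perm (K : Fin n → Set (Fin n → ℝ)) (σ : Equiv.Perm (Fin n)) :
    signedVolume (fun i => K (σ i)) = signedVolume K := by
  unfold signedVolume
  refine Fintype.sum_equiv (Equiv.finsetCongr σ) _ _ fun I => ?_
  rw [Equiv.finsetCongr_apply, Finset.card_map, Finset.sum_map]
  rfl

theorem convex_posOrthant (n : ℕ) : Convex ℝ (posOrthant n) := by
  intro x hx y hy a b ha hb _ j
  have := hx j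
  have := hy j
  simp only [Pi.add_apply, Pi.smul_apply, smul_eq_mul]
  positivity

theorem sum_posOrthant {I : Finset (Fin n)} (hI : I.Nonempty) :
    ∑ _i ∈ I, posOrthant n = posOrthant n := by
  refine Set.Subset.antisymm ?_ fun x hx => ?_
  · intro x hx
    obtain ⟨g, hg, rfl⟩ := (Set.mem_finsetSum _ _ _).mp hx
    intro j
    rw [Finset.sum_apply]
    exact Finset.sum_nonneg fun i hi => hg hi j
  · have hI0 : (0 : ℝ) < I.card := by exact_mod_cast hI.card_pos
    have h1 : x = ∑ i ∈ I, (I.card : ℝ)⁻¹ • x := by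
      rw [Finset.sum_const, ← Nat.cast_smul_eq_nsmul ℝ, smul_inv_smul₀ hI0.ne']
    rw [h1]
    exact Set.finsetSum_mem_finsetSum _ _ _ fun i _ j => mul_nonneg (inv_nonneg.mpr hI0.le) (hx j)

theorem pairVolume_sum {B : Fin n → Set (Fin n → ℝ)} (hB : ∀ i, B i ⊆ posOrthant n)
    {I : Finset (Fin n)} (hI : I.Nonempty) :
    pairVolume (∑ i ∈ I, (posOrthant n, B i))
      = n.factorial * volume.real (posOrthant n \ ∑ i ∈ I, B i) := by
  have h1 : (∑ i ∈ I, B i) \ posOrthant n = ∅ := by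
    rw [Set.sdiff_eq_empty]
    intro x hx
    rw [← sum_posOrthant hI]
    exact Set.finsetSum_subset_finsetSum _ _ _ (fun i _ => hB i) hx
  unfold pairVolume
  rw [Prod.fst_sum, Prod.snd_sum]
  dsimp only
  rw [sum_posOrthant hI, h1, measureReal_empty, sub_zero]

theorem pairVolume_zero : pairVolume (0 : Set (Fin n → ℝ) × Set (Fin n → ℝ)) = 0 := by
  simp [pairVolume]

/-- A size at which all the sets of generators can be cut off. -/
theorem exists_forall_sum_lt (V : Fin n → Finset (Fin n → ℝ)) :
    ∃ N₀ : ℝ, 0 < N₀ ∧ ∀ i, ∀ v ∈ V i, ∑ j, v j < N₀ := by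
  refine ⟨∑ i, ∑ v ∈ V i, |∑ j, v j| + 1, by positivity, fun i v hv => ?_⟩
  have h1 : |∑ j, v j| ≤ ∑ v ∈ V i, |∑ j, v j| :=
    Finset.single_le_sum (f := fun v : Fin n → ℝ => |∑ j, v j|) (fun _ _ => abs_nonneg _) hv
  have h2 : ∑ v ∈ V i, |∑ j, v j| ≤ ∑ i, ∑ v ∈ V i, |∑ j, v j| :=
    Finset.single_le_sum (f := fun i => ∑ v ∈ V i, |∑ j, v j|)
      (fun _ _ => Finset.sum_nonneg fun _ _ => abs_nonneg _) (Finset.mem_univ i)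
  linarith [le_abs_self (∑ j, v j)]

theorem mem_convexHull_axisPoints {N : ℝ} (hN : 0 < N) {u : Fin n → ℝ} (hu : u ∈ posOrthant n)
    (hs : ∑ j, u j = N) : u ∈ convexHull ℝ (axisPoints n N : Set (Fin n → ℝ)) := by
  have h1 := (convex_convexHull ℝ (axisPoints n N : Set (Fin n → ℝ))).sum_mem
    (t := Finset.univ) (w := fun j => u j / N) (z := fun j => Pi.single j N)
    (fun j _ => div_nonneg (hu j) hN.le) (by rw [← Finset.sum_div, hs, div_self hN.ne'])
    fun j _ => subset_convexHull ℝ _ (mem_axisPoints.mpr ⟨j, rfl⟩)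
  convert! h1 using 1
  ext j
  simp [Finset.sum_apply, Pi.single_apply, hN.ne']

/-- `B` is the sum of the positive orthant and the convex hull of the finite set `V` of points of
the orthant. Having a point of `V` on each coordinate axis makes the complement of `B` in the
orthant bounded. -/
structure IsGeneratedBy (B : Set (Fin n → ℝ)) (V : Finset (Fin n → ℝ)) : Prop where
  subset_posOrthant : (V : Set (Fin n → ℝ)) ⊆ posOrthant n
  exists_axis : ∀ j, ∃ r, Pi.single j r ∈ V
  eq_add : B = convexHull ℝ (V : Set (Fin n → ℝ)) + posOrthant n

namespace IsGeneratedBy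

variable {B : Set (Fin n → ℝ)} {V : Finset (Fin n → ℝ)}

theorem convex (h : IsGeneratedBy B V) : Convex ℝ B := by
  rw [h.eq_add]
  exact (convex_convexHull ℝ _).add (convex_posOrthant n)

theorem le_posOrthant (h : IsGeneratedBy B V) : B ⊆ posOrthant n := by
  rw [h.eq_add]
  rintro _ ⟨v, hv, c, hc, rfl⟩ j
  have := convexHull_min h.subset_posOrthant (convex_posOrthant n) hv j
  exact add_nonneg this (hc j)

theorem add_mem (h : IsGeneratedBy B V) {b c : Fin n → ℝ} (hb : b ∈ B) (hc : c ∈ posOrthant n) :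
    b + c ∈ B := by
  rw [h.eq_add] at hb ⊢
  obtain ⟨v, hv, d, hd, rfl⟩ := hb
  exact ⟨v, hv, d + c, fun j => add_nonneg (hd j) (hc j), (add_assoc _ _ _).symm⟩

theorem convexHull_subset (h : IsGeneratedBy B V) :
    convexHull ℝ (V : Set (Fin n → ℝ)) ⊆ B := by
  rw [h.eq_add]
  exact fun v hv => ⟨v, hv, 0, fun _ => le_rfl, add_zero v⟩

theorem single_mem (h : IsGeneratedBy B V) {N : ℝ} (hN : ∀ v ∈ V, ∑ j, v j < N) (j : Fin n) :
    Pi.single j N ∈ B := by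
  obtain ⟨r, hr⟩ := h.exists_axis j
  have h1 := hN _ hr
  simp only [Finset.sum_pi_single', Finset.mem_univ, if_true] at h1
  have h2 := h.add_mem (h.convexHull_subset (subset_convexHull ℝ _ hr))
    (c := Pi.single j (N - r)) (by
      intro i
      by_cases hij : i = j
      · subst hij; simpa using h1.le
      · simp [hij])
  rwa [← Pi.single_add, add_sub_cancel] at h2

theorem mem_of_le_sum (h : IsGeneratedBy B V) {N : ℝ} (hN0 : 0 < N)
    (hN : ∀ v ∈ V, ∑ j, v j < N) {x : Fin n → ℝ} (hx : x ∈ posOrthant n) (hs : N ≤ ∑ j, x j) :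
    x ∈ B := by
  have hpos : 0 < ∑ j, x j := hN0.trans_le hs
  have h1 : (N / ∑ j, x j) • x ∈ B := by
    refine convexHull_min ?_ h.convex (mem_convexHull_axisPoints hN0 (fun j => ?_) ?_)
    · intro u hu
      obtain ⟨j, rfl⟩ := mem_axisPoints.mp hu
      exact h.single_mem hN j
    · exact mul_nonneg (div_nonneg hN0.le hpos.le) (hx j)
    · simp_rw [Pi.smul_apply, smul_eq_mul, ← Finset.mul_sum]
      exact div_mul_cancel₀ _ hpos.ne'
  have h2 := h.add_mem h1 (c := (1 - N / ∑ j, x j) • x) fun j =>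
    mul_nonneg (sub_nonneg.mpr ((div_le_one hpos).mpr hs)) (hx j)
  rwa [← add_smul, add_sub_cancel, one_smul] at h2

variable {B : Fin n → Set (Fin n → ℝ)} {V : Fin n → Finset (Fin n → ℝ)} {N : ℝ}

theorem truncation_subset (h : ∀ i, IsGeneratedBy (B i) (V i)) (hN0 : 0 < N)
    (hN : ∀ i, ∀ v ∈ V i, ∑ j, v j < N) (i : Fin n) :
    convexHull ℝ ((V i ∪ axisPoints n N : Finset (Fin n → ℝ)) : Set (Fin n → ℝ))
      ⊆ B i ∩ cornerSimplex (fun _ => 1) N := by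
  refine convexHull_min ?_ ((h i).convex.inter (convex_cornerSimplex _ _))
  intro u hu
  rw [Finset.mem_coe, Finset.mem_union] at hu
  rcases hu with hu | hu
  · exact ⟨(h i).convexHull_subset (subset_convexHull ℝ _ hu), (h i).subset_posOrthant hu,
      by simpa using (hN i u hu).le⟩
  · obtain ⟨j, rfl⟩ := mem_axisPoints.mp hu
    exact ⟨(h i).single_mem (hN i) j, single_mem_cornerSimplex hN0.le le_rfl j⟩

/-- The Minkowski sum of the truncations is the truncation of the Minkowski sum. -/
theorem sum_truncation (h : ∀ i, IsGeneratedBy (B i) (V i)) (hN0 : 0 < N)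
    (hN : ∀ i, ∀ v ∈ V i, ∑ j, v j < N) {I : Finset (Fin n)} (hI : I.Nonempty) :
    ∑ i ∈ I, convexHull ℝ ((V i ∪ axisPoints n N : Finset (Fin n → ℝ)) : Set (Fin n → ℝ))
      = (∑ i ∈ I, B i) ∩ cornerSimplex (fun _ => 1) (I.card * N) := by
  have hI0 : (0 : ℝ) < I.card := by exact_mod_cast hI.card_pos
  refine Set.Subset.antisymm ?_ ?_
  · intro x hx
    obtain ⟨g, hg, rfl⟩ := (Set.mem_finsetSum _ _ _).mp hx
    have h1 := fun i (hi : i ∈ I) => truncation_subset h hN0 hN i (hg hi)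
    refine ⟨Set.finsetSum_mem_finsetSum _ _ _ fun i hi => (h1 i hi).1, ?_⟩
    have h2 : (I.card : ℝ) * N = ∑ i ∈ I, N := by simp
    rw [h2, ← sum_cornerSimplex (fun _ => one_pos) I fun _ => hN0.le]
    exact Set.finsetSum_mem_finsetSum _ _ _ fun i hi => (h1 i hi).2
  · rintro x ⟨hx, hxs⟩
    obtain ⟨b, hb, rfl⟩ := (Set.mem_finsetSum _ _ _).mp hx
    have hex : ∀ i, ∃ v c : Fin n → ℝ, i ∈ I →
        v ∈ convexHull ℝ (V i : Set (Fin n → ℝ)) ∧ c ∈ posOrthant n ∧ v + c = b i := by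
      intro i
      by_cases hi : i ∈ I
      · have := hb hi
        rw [(h i).eq_add] at this
        obtain ⟨v, hv, c, hc, hvc⟩ := this
        exact ⟨v, c, fun _ => ⟨hv, hc, hvc⟩⟩
      · exact ⟨0, 0, fun h => absurd h hi⟩
    choose v c hvc using hex
    have hv := fun i hi => (hvc i hi).1
    have hc := fun i hi => (hvc i hi).2.1
    have hsum : ∑ i ∈ I, b i = ∑ i ∈ I, v i + ∑ i ∈ I, c i := by
      rw [← Finset.sum_add_distrib]
      exact Finset.sum_congr rfl fun i hi => (hvc i hi).2.2.symm
    have hvK : ∀ i ∈ I, v i ∈ convexHull ℝ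
        ((V i ∪ axisPoints n N : Finset (Fin n → ℝ)) : Set (Fin n → ℝ)) := fun i hi =>
      convexHull_mono (by simp) (hv i hi)
    have hcC : ∑ i ∈ I, c i ∈ posOrthant n := fun j => by
      rw [Finset.sum_apply]
      exact Finset.sum_nonneg fun i hi => hc i hi j
    have hvC : ∑ i ∈ I, v i ∈ posOrthant n := fun j => by
      rw [Finset.sum_apply]
      exact Finset.sum_nonneg fun i hi =>
        convexHull_min (h i).subset_posOrthant (convex_posOrthant n) (hv i hi) j
    set C := ∑ i ∈ I, c i with hC
    set W := ∑ i ∈ I, v i with hW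
    rw [hsum] at hxs ⊢
    have hxs2 := hxs.2
    simp only [one_mul, Pi.add_apply, Finset.sum_add_distrib] at hxs2
    rcases (Finset.sum_nonneg fun j (_ : j ∈ Finset.univ) => hcC j).eq_or_lt with h0 | hpos
    · have hC0 : C = 0 := by
        rw [eq_comm, Finset.sum_eq_zero_iff_of_nonneg fun j _ => hcC j] at h0
        ext j
        exact h0 j (Finset.mem_univ j)
      rw [hC0, add_zero]
      exact Set.finsetSum_mem_finsetSum _ _ _ hvK
    · -- a point of the sum is `W + C` with `W` in the sum of the hulls of the `V i` and `C` in the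
      -- orthant; the ray from `W` through `W + C` leaves the simplex at `card I • u`, and `W + C`
      -- divides the segment between these points at parameter `l`
      set s := I.card * N - ∑ j, W j with hs
      have hs0 : 0 < s := by linarith
      set l := (∑ j, C j) / s with hl
      have hl0 : 0 < l := div_pos hpos hs0
      have hl1 : l ≤ 1 := (div_le_one hs0).mpr (by linarith)
      set u : Fin n → ℝ := (I.card : ℝ)⁻¹ • (W + l⁻¹ • C) with hu
      have huK : u ∈ convexHull ℝ (axisPoints n N : Set (Fin n → ℝ)) := by
        refine mem_convexHull_axisPoints hN0 (fun j => ?_) ?_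
        · exact mul_nonneg (inv_nonneg.mpr hI0.le)
            (add_nonneg (hvC j) (mul_nonneg (inv_nonneg.mpr hl0.le) (hcC j)))
        · simp only [hu, Pi.smul_apply, Pi.add_apply, smul_eq_mul, ← Finset.mul_sum,
            Finset.sum_add_distrib]
          have : l⁻¹ * ∑ j, C j = s := by
            rw [hl, inv_div, div_mul_cancel₀ _ hpos.ne']
          rw [this, hs]
          field_simp
          ring
      have hx : W + C = ∑ i ∈ I, ((1 - l) • v i + l • u) := by
        rw [Finset.sum_add_distrib, ← Finset.smul_sum, Finset.sum_const, ← hW, hu,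
          ← Nat.cast_smul_eq_nsmul ℝ, smul_comm l, smul_inv_smul₀ hI0.ne', smul_add,
          smul_inv_smul₀ hl0.ne', ← add_assoc, ← add_smul, sub_add_cancel, one_smul]
      rw [hx]
      exact Set.finsetSum_mem_finsetSum _ _ _ fun i hi => (convex_convexHull ℝ _) (hvK i hi)
        (convexHull_mono (by simp) huK) (sub_nonneg.mpr hl1) hl0.le (by ring)

/-- Truncation does not change the complement in the orthant. -/
theorem posOrthant_diff_sum (h : ∀ i, IsGeneratedBy (B i) (V i)) (hN0 : 0 < N)
    (hN : ∀ i, ∀ v ∈ V i, ∑ j, v j < N) {I : Finset (Fin n)} (hI : I.Nonempty) :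
    posOrthant n \ ∑ i ∈ I, B i = cornerSimplex (fun _ => 1) (I.card * N) \
      ∑ i ∈ I, convexHull ℝ ((V i ∪ axisPoints n N : Finset (Fin n → ℝ)) : Set (Fin n → ℝ)) := by
  have hI0 : (0 : ℝ) < I.card := by exact_mod_cast hI.card_pos
  rw [sum_truncation h hN0 hN hI]
  ext x
  constructor
  · rintro ⟨hx, hxB⟩
    refine ⟨⟨hx, ?_⟩, fun h => hxB h.1⟩
    by_contra! hlt
    refine hxB ?_
    have h1 : x = ∑ i ∈ I, (I.card : ℝ)⁻¹ • x := by
      rw [Finset.sum_const, ← Nat.cast_smul_eq_nsmul ℝ, smul_inv_smul₀ hI0.ne']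
    rw [h1]
    refine Set.finsetSum_mem_finsetSum _ _ _ fun i _ => (h i).mem_of_le_sum hN0 (hN i) ?_ ?_
    · exact fun j => mul_nonneg (inv_nonneg.mpr hI0.le) (hx j)
    · simp only [Pi.smul_apply, smul_eq_mul, ← Finset.mul_sum]
      rw [inv_mul_eq_div, le_div_iff₀ hI0, mul_comm]
      simpa using hlt.le
  · rintro ⟨hx, hxB⟩
    exact ⟨hx.1, fun h => hxB ⟨h, hx⟩⟩

/-- The relative mixed volume is the defect between the mixed volume `N ^ n` of `n` copies of the
simplex of size `N` and the mixed volume of the truncations of the `B i`. -/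
theorem relMixedVolume_eq (hn : n ≠ 0) (h : ∀ i, IsGeneratedBy (B i) (V i)) (hN0 : 0 < N)
    (hN : ∀ i, ∀ v ∈ V i, ∑ j, v j < N) :
    relMixedVolume B = N ^ n - signedVolume fun i =>
      convexHull ℝ ((V i ∪ axisPoints n N : Finset (Fin n → ℝ)) : Set (Fin n → ℝ)) := by
  have hI : ∀ I : Finset (Fin n), pairVolume (∑ i ∈ I, (posOrthant n, B i))
      = (∑ i ∈ I, N) ^ n - n.factorial * volume.real (∑ i ∈ I,
        convexHull ℝ ((V i ∪ axisPoints n N : Finset (Fin n → ℝ)) : Set (Fin n → ℝ))) := by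
    intro I
    rcases I.eq_empty_or_nonempty with rfl | hI
    · have h0 : volume.real (0 : Set (Fin n → ℝ)) = 0 := by
        have : NullSingletonClass (volume : Measure (Fin n → ℝ)) :=
          Measure.pi_nullSingletonClass ⟨0, Nat.pos_of_ne_zero hn⟩
        simp [Measure.real, ← Set.singleton_zero]
      rw [Finset.sum_empty, pairVolume_zero, Finset.sum_empty, Finset.sum_empty, h0]
      simp [hn]
    · have hcl : MeasurableSet (∑ i ∈ I,
          convexHull ℝ ((V i ∪ axisPoints n N : Finset (Fin n → ℝ)) : Set (Fin n → ℝ))) := by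
        refine IsClosed.measurableSet ?_
        rw [← convexHull_sum]
        refine Set.Finite.isClosed_convexHull (𝕜 := ℝ) ?_
        exact finite_finsetSum I fun i => Finset.finite_toSet _
      have hfin : volume (cornerSimplex (fun _ : Fin n => 1) (I.card * N)) ≠ ⊤ := by
        rw [volume_cornerSimplex (fun _ => one_pos) (by positivity)]
        exact ENNReal.ofReal_ne_top
      rw [pairVolume_sum (fun i => (h i).le_posOrthant) hI, posOrthant_diff_sum h hN0 hN hI,
        measureReal_sdiff ?_ hcl hfin, volume_real_cornerSimplex (fun _ => one_pos) (by positivity)]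
      · have := n.factorial_ne_zero
        simp
        field_simp
      · rw [sum_truncation h hN0 hN hI]
        exact Set.inter_subset_right
  unfold relMixedVolume pairMixedVolume
  simp_rw [hI, mul_sub, Finset.sum_sub_distrib]
  rw [signed_sum_pow_sum]
  unfold signedVolume
  have hf : (n.factorial : ℝ) ≠ 0 := by exact_mod_cast n.factorial_ne_zero
  simp_rw [mul_left_comm _ (n.factorial : ℝ)]
  rw [← Finset.mul_sum, ← mul_sub, inv_mul_cancel_left₀ hf]
  simp

end IsGeneratedBy

end Relative

/-! ### Upper and lower bounds for relative mixed volumes -/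

section Bounds

open MeasureTheory

variable {n : ℕ}

/-- The half-space `d ≤ ∑ j, w j * x j` meets the axes at `d / w j`. -/
theorem mem_cutOrthant_div {w : Fin n → ℝ} {d : ℝ} (hd : 0 < d)
    {x : Fin n → ℝ} :
    x ∈ cutOrthant (fun j => d / w j) ↔ x ∈ posOrthant n ∧ d ≤ ∑ j, w j * x j := by
  have h : ∑ j, x j / (d / w j) = (∑ j, w j * x j) / d := by
    rw [Finset.sum_div]
    refine Finset.sum_congr rfl fun j _ => ?_
    rw [div_div_eq_mul_div, mul_comm]
  rw [cutOrthant, Set.mem_ofPred_eq, h, one_le_div hd]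

theorem sum_cutOrthant {w : Fin n → ℝ} {d : Fin n → ℝ}
    (hd : ∀ i, 0 < d i) {I : Finset (Fin n)} (hI : I.Nonempty) :
    ∑ i ∈ I, cutOrthant (fun j => d i / w j) = cutOrthant fun j => (∑ i ∈ I, d i) / w j := by
  have hD : 0 < ∑ i ∈ I, d i := Finset.sum_pos (fun i _ => hd i) hI
  ext x
  rw [Set.mem_finsetSum, mem_cutOrthant_div hD]
  constructor
  · rintro ⟨g, hg, rfl⟩
    have hg' := fun i (hi : i ∈ I) => (mem_cutOrthant_div (hd i)).mp (hg hi)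
    refine ⟨fun j => ?_, ?_⟩
    · rw [Finset.sum_apply]
      exact Finset.sum_nonneg fun i hi => (hg' i hi).1 j
    · simp_rw [Finset.sum_apply, Finset.mul_sum]
      rw [Finset.sum_comm]
      exact Finset.sum_le_sum fun i hi => (hg' i hi).2
  · rintro ⟨hx, hxs⟩
    refine ⟨fun i => (d i / ∑ i ∈ I, d i) • x, fun {i} _ => ?_, ?_⟩
    · rw [mem_cutOrthant_div (hd i)]
      refine ⟨fun j => mul_nonneg (div_nonneg (hd i).le hD.le) (hx j), ?_⟩
      have h1 : ∑ j, w j * ((d i / ∑ i ∈ I, d i) • x) j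
          = (d i / ∑ i ∈ I, d i) * ∑ j, w j * x j := by
        rw [Finset.mul_sum]
        exact Finset.sum_congr rfl fun j _ => by simp; ring
      rw [h1]
      calc d i = (d i / ∑ i ∈ I, d i) * ∑ i ∈ I, d i := (div_mul_cancel₀ _ hD.ne').symm
        _ ≤ _ := mul_le_mul_of_nonneg_left hxs (div_nonneg (hd i).le hD.le)
    · rw [← Finset.sum_smul, ← Finset.sum_div, div_self hD.ne', one_smul]

/-- The complement is a half-open simplex; its volume is found from the closed simplices inside. -/
theorem volume_real_posOrthant_diff_cutOrthant {w : Fin n → ℝ} (hw : ∀ j, 0 < w j) {d : ℝ}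
    (hd : 0 < d) :
    volume.real (posOrthant n \ cutOrthant fun j => d / w j)
      = d ^ n / (n.factorial * ∏ j, w j) := by
  have hset : posOrthant n \ cutOrthant (fun j => d / w j)
      = {x | x ∈ posOrthant n ∧ ∑ j, w j * x j < d} := by
    ext x
    rw [Set.mem_sdiff, mem_cutOrthant_div hd, Set.mem_ofPred_eq, not_and, not_le]
    exact ⟨fun h => ⟨h.1, h.2 h.1⟩, fun h => ⟨h.1, fun _ => h.2⟩⟩
  rw [hset]
  have hfin : ∀ t : ℝ, 0 ≤ t → volume (cornerSimplex w t) ≠ ⊤ := fun t ht => by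
    rw [volume_cornerSimplex hw ht]
    exact ENNReal.ofReal_ne_top
  refine le_antisymm ?_ ?_
  · rw [← volume_real_cornerSimplex hw hd.le]
    exact measureReal_mono (fun x hx => ⟨hx.1, hx.2.le⟩) (hfin d hd.le)
  · have hlim : Filter.Tendsto (fun t : ℝ => t ^ n / (n.factorial * ∏ j, w j))
        (nhdsWithin d (Set.Iio d)) (nhds (d ^ n / (n.factorial * ∏ j, w j))) :=
      ((continuous_id.pow n).div_const _).continuousWithinAt
    refine le_of_tendsto hlim ?_
    filter_upwards [Ioo_mem_nhdsLT hd] with t ht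
    rw [← volume_real_cornerSimplex hw ht.1.le]
    refine measureReal_mono (fun x hx => ⟨hx.1, hx.2.trans_lt ht.2⟩) ?_
    exact measure_ne_top_of_subset
      (show {x | x ∈ posOrthant n ∧ ∑ j, w j * x j < d} ⊆ cornerSimplex w d from
        fun x hx => ⟨hx.1, hx.2.le⟩) (hfin d hd.le)

theorem relMixedVolume_cutOrthant {w : Fin n → ℝ} (hw : ∀ j, 0 < w j) {d : Fin n → ℝ}
    (hd : ∀ i, 0 < d i) (hn : n ≠ 0) :
    relMixedVolume (fun i => cutOrthant fun j => d i / w j) = (∏ i, d i) / ∏ j, w j := by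
  have hf : (n.factorial : ℝ) ≠ 0 := by exact_mod_cast n.factorial_ne_zero
  have hI : ∀ I : Finset (Fin n), pairVolume (∑ i ∈ I, (posOrthant n,
      cutOrthant fun j => d i / w j)) = (∑ i ∈ I, d i) ^ n / ∏ j, w j := by
    intro I
    rcases I.eq_empty_or_nonempty with rfl | hI
    · rw [Finset.sum_empty, pairVolume_zero]
      simp [hn]
    · rw [pairVolume_sum (fun i x hx => hx.1) hI, sum_cutOrthant hd hI,
        volume_real_posOrthant_diff_cutOrthant hw (Finset.sum_pos (fun i _ => hd i) hI)]
      have : ∏ j, w j ≠ 0 := (Finset.prod_pos fun j _ => hw j).ne'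
      field_simp
  unfold relMixedVolume pairMixedVolume
  simp_rw [hI, mul_div_assoc']
  rw [← Finset.sum_div, signed_sum_pow_sum, mul_div_assoc', inv_mul_cancel_left₀ hf]

theorem isGeneratedBy_cutOrthant {b : Fin n → ℝ} (hb : ∀ j, 0 < b j) :
    IsGeneratedBy (cutOrthant b) (Finset.univ.image fun j => Pi.single j (b j)) := by
  classical
  have hnn : ∀ j, (Pi.single j (b j) : Fin n → ℝ) ∈ posOrthant n := by
    intro j i
    by_cases h : i = j
    · subst h; simpa using (hb i).le
    · simp [h]
  refine ⟨?_, fun j => ⟨b j, by simp⟩, ?_⟩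
  · intro v hv
    obtain ⟨j, -, rfl⟩ := Finset.mem_image.mp hv
    exact hnn j
  · refine Set.Subset.antisymm ?_ ?_
    · rintro x ⟨hx, hs⟩
      have hpos : 0 < ∑ j, x j / b j := by linarith
      set s := ∑ j, x j / b j with hsdef
      refine ⟨s⁻¹ • x, ?_, (1 - s⁻¹) • x, fun j => mul_nonneg
        (sub_nonneg.mpr (inv_le_one_of_one_le₀ hs)) (hx j), ?_⟩
      · have h1 := (convex_convexHull ℝ ((Finset.univ.image fun j => Pi.single j (b j) :
            Finset (Fin n → ℝ)) : Set (Fin n → ℝ))).sum_mem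
          (t := Finset.univ) (w := fun j => s⁻¹ * (x j / b j)) (z := fun j => Pi.single j (b j))
          (fun j _ => mul_nonneg (inv_nonneg.mpr hpos.le) (div_nonneg (hx j) (hb j).le))
          (by rw [← Finset.mul_sum, ← hsdef, inv_mul_cancel₀ hpos.ne'])
          fun j _ => subset_convexHull ℝ _ (by simp)
        convert! h1 using 1
        ext j
        simp [Finset.sum_apply, Pi.single_apply]
        have := (hb j).ne'
        field_simp
      · dsimp only
        rw [← add_smul, add_sub_cancel, one_smul]
    · rintro _ ⟨v, hv, c, hc, rfl⟩
      have hconv : Convex ℝ (cutOrthant b) := by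
        intro x hx y hy p q hp hq hpq
        refine ⟨convex_posOrthant n hx.1 hy.1 hp hq hpq, ?_⟩
        have h1 : ∑ j, (p • x + q • y) j / b j = p * ∑ j, x j / b j + q * ∑ j, y j / b j := by
          rw [Finset.mul_sum, Finset.mul_sum, ← Finset.sum_add_distrib]
          exact Finset.sum_congr rfl fun j _ => by simp; ring
        rw [h1, ← hpq]
        have := mul_le_mul_of_nonneg_left hx.2 hp
        have := mul_le_mul_of_nonneg_left hy.2 hq
        linarith
      have hv' : v ∈ cutOrthant b := by
        refine convexHull_min ?_ hconv hv
        intro u hu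
        obtain ⟨j, -, rfl⟩ := Finset.mem_image.mp hu
        refine ⟨hnn j, ?_⟩
        rw [Finset.sum_eq_single_of_mem j (Finset.mem_univ j)]
        · rw [Pi.single_eq_same, div_self (hb j).ne']
        · intro i _ hij
          simp [hij]
      refine ⟨fun j => add_nonneg (hv'.1 j) (hc j), hv'.2.trans ?_⟩
      refine Finset.sum_le_sum fun j _ => ?_
      exact div_le_div_of_nonneg_right (le_add_of_nonneg_right (hc j)) (hb j).le

namespace IsGeneratedBy

variable {B B' : Fin n → Set (Fin n → ℝ)} {V V' : Fin n → Finset (Fin n → ℝ)} {N : ℝ}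

theorem truncation_eq (h : ∀ i, IsGeneratedBy (B i) (V i)) (hN0 : 0 < N)
    (hN : ∀ i, ∀ v ∈ V i, ∑ j, v j < N) (i : Fin n) :
    convexHull ℝ ((V i ∪ axisPoints n N : Finset (Fin n → ℝ)) : Set (Fin n → ℝ))
      = B i ∩ cornerSimplex (fun _ => 1) N := by
  have := sum_truncation h hN0 hN (Finset.singleton_nonempty i)
  simpa using this

theorem affinelySpans_truncation (h : ∀ i, IsGeneratedBy (B i) (V i)) (hN0 : 0 < N)
    (hN : ∀ i, ∀ v ∈ V i, ∑ j, v j < N) (i : Fin n) :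
    AffinelySpans id (V i ∪ axisPoints n N) := by
  classical
  obtain ⟨r, hr⟩ := (h i).exists_axis i
  refine (affinelySpans_insert_axisPoints hN0.ne' (hN i _ hr).ne).mono ?_
  exact Finset.insert_subset (Finset.mem_union_left _ hr) Finset.subset_union_right

/-- Larger members leave less of the orthant uncovered. -/
theorem relMixedVolume_anti (hn : n ≠ 0) (h : ∀ i, IsGeneratedBy (B i) (V i))
    (h' : ∀ i, IsGeneratedBy (B' i) (V' i)) (hBB' : ∀ i, B i ⊆ B' i) :
    relMixedVolume B' ≤ relMixedVolume B := by
  obtain ⟨N₁, hN₁, hV⟩ := exists_forall_sum_lt V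
  obtain ⟨N₂, hN₂, hV'⟩ := exists_forall_sum_lt V'
  have hN0 : 0 < max N₁ N₂ := hN₁.trans_le (le_max_left _ _)
  replace hV : ∀ i, ∀ v ∈ V i, ∑ j, v j < max N₁ N₂ := fun i v hv =>
    (hV i v hv).trans_le (le_max_left _ _)
  replace hV' : ∀ i, ∀ v ∈ V' i, ∑ j, v j < max N₁ N₂ := fun i v hv =>
    (hV' i v hv).trans_le (le_max_right _ _)
  rw [relMixedVolume_eq hn h hN0 hV, relMixedVolume_eq hn h' hN0 hV']
  refine sub_le_sub_left (signedVolume_mono (affinelySpans_truncation h hN0 hV)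
    fun i => ?_) _
  rw [truncation_eq h' hN0 hV' i]
  refine (subset_convexHull ℝ _).trans ((truncation_eq h hN0 hV i).subset.trans ?_)
  exact Set.inter_subset_inter_left _ (hBB' i)

theorem prod_div_prod_le_relMixedVolume (hn : n ≠ 0) (h : ∀ i, IsGeneratedBy (B i) (V i))
    {w : Fin n → ℝ} (hw : ∀ j, 0 < w j) {d : Fin n → ℝ} (hd : ∀ i, 0 < d i)
    (hB : ∀ i, B i ⊆ cutOrthant fun j => d i / w j) :
    (∏ i, d i) / ∏ j, w j ≤ relMixedVolume B := by
  rw [← relMixedVolume_cutOrthant hw hd hn]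
  exact relMixedVolume_anti hn h
    (fun i => isGeneratedBy_cutOrthant fun j => div_pos (hd i) (hw j)) hB

theorem relMixedVolume_le_prod (hn : n ≠ 0) (h : ∀ i, IsGeneratedBy (B i) (V i))
    (σ : Equiv.Perm (Fin n)) {c : Fin n → ℝ} (hc : ∀ i, 0 ≤ c i)
    (hB : ∀ i, Pi.single (σ i) (c i) ∈ B i) : relMixedVolume B ≤ ∏ i, c i := by
  obtain ⟨N₁, hN₁, hV⟩ := exists_forall_sum_lt V
  set N := N₁ + ∑ i, c i with hN
  have hcs : ∀ i, c i ≤ ∑ i, c i := fun i =>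
    Finset.single_le_sum (f := c) (fun i _ => hc i) (Finset.mem_univ i)
  have hs0 : 0 ≤ ∑ i, c i := Finset.sum_nonneg fun i _ => hc i
  have hN0 : 0 < N := by linarith
  have hcN : ∀ i, c i < N := fun i => by linarith [hcs i]
  replace hV : ∀ i, ∀ v ∈ V i, ∑ j, v j < N := fun i v hv => by linarith [hV i v hv]
  have h1 := sub_prod_le_signedVolume_axis hN0 (fun i => c (σ.symm i)) (fun i => hc _)
    fun i => hcN _
  rw [Equiv.prod_comp σ.symm c] at h1
  have h2 : signedVolume (fun i => convexHull ℝ ((insert (Pi.single i (c (σ.symm i)))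
      (axisPoints n N) : Finset (Fin n → ℝ)) : Set (Fin n → ℝ)))
      ≤ signedVolume fun i => convexHull ℝ ((V (σ.symm i) ∪ axisPoints n N :
        Finset (Fin n → ℝ)) : Set (Fin n → ℝ)) := by
    refine signedVolume_mono (fun i => affinelySpans_insert_axisPoints hN0.ne'
      (by simpa using (hcN (σ.symm i)).ne)) fun i => ?_
    rw [truncation_eq h hN0 hV]
    intro u hu
    rw [Finset.mem_coe, Finset.mem_insert] at hu
    rcases hu with rfl | hu
    · refine ⟨?_, single_mem_cornerSimplex (hc _) (hcN _).le i⟩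
      have := hB (σ.symm i)
      rwa [Equiv.apply_symm_apply] at this
    · obtain ⟨j, rfl⟩ := mem_axisPoints.mp hu
      exact ⟨(h _).single_mem (hV _) j, single_mem_cornerSimplex hN0.le le_rfl j⟩
  rw [signedVolume_comp_perm (fun i => convexHull ℝ ((V i ∪ axisPoints n N :
        Finset (Fin n → ℝ)) : Set (Fin n → ℝ))) σ.symm] at h2
  rw [relMixedVolume_eq hn h hN0 hV]
  linarith

/-- Adding a point of the orthant to `B` adds it to the generators. In particular, the convex hull
is again stable under addition of elements of the orthant. -/
theorem convexHull_union_singleton {B : Set (Fin n → ℝ)} {V : Finset (Fin n → ℝ)} (hn : n ≠ 0)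
    (h : IsGeneratedBy B V) {δ : Fin n → ℝ} (hδ : δ ∈ posOrthant n) :
    IsGeneratedBy (convexHull ℝ (B ∪ {δ})) (insert δ V) := by
  classical
  have hsub : ((insert δ V : Finset (Fin n → ℝ)) : Set (Fin n → ℝ)) ⊆ posOrthant n := by
    intro v hv
    rw [Finset.mem_coe, Finset.mem_insert] at hv
    rcases hv with rfl | hv
    · exact hδ
    · exact h.subset_posOrthant hv
  refine ⟨hsub, fun j => ?_, ?_⟩
  · obtain ⟨r, hr⟩ := h.exists_axis j
    exact ⟨r, Finset.mem_insert_of_mem hr⟩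
  · refine Set.Subset.antisymm ?_ ?_
    · refine convexHull_min ?_ ((convex_convexHull ℝ _).add (convex_posOrthant n))
      rintro x (hx | rfl)
      · rw [h.eq_add] at hx
        exact Set.add_subset_add_right (convexHull_mono (by simp)) hx
      · exact ⟨x, subset_convexHull ℝ _ (by simp), 0, fun _ => le_rfl, add_zero x⟩
    · rintro _ ⟨v, hv, c, hc, rfl⟩
      obtain ⟨N, hN0, hN⟩ := exists_forall_sum_lt (fun _ : Fin n => V)
      have hN' := hN ⟨0, Nat.pos_of_ne_zero hn⟩
      -- `δ + c` lies on the segment from `δ` to the point `δ + t • c`, which is in `B` for large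
      -- `t`
      have hδc : ∀ c ∈ posOrthant n, δ + c ∈ convexHull ℝ (B ∪ {δ}) := by
        intro c hc
        rcases (Finset.sum_nonneg fun j (_ : j ∈ Finset.univ) => hc j).eq_or_lt with h0 | hpos
        · have hc0 : c = 0 := by
            rw [eq_comm, Finset.sum_eq_zero_iff_of_nonneg fun j _ => hc j] at h0
            ext j
            exact h0 j (Finset.mem_univ j)
          rw [hc0, add_zero]
          exact subset_convexHull ℝ _ (Or.inr rfl)
        · set t := 1 + N / ∑ j, c j with ht
          have ht1 : 1 ≤ t := by
            have : 0 ≤ N / ∑ j, c j := by positivity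
            linarith
          have ht0 : 0 < t := by linarith
          have hfar : δ + t • c ∈ B := by
            refine h.mem_of_le_sum hN0 hN' (fun j => add_nonneg (hδ j)
              (mul_nonneg ht0.le (hc j))) ?_
            have h1 : ∑ j, (δ + t • c) j = ∑ j, δ j + t * ∑ j, c j := by
              simp [Finset.sum_add_distrib, Finset.mul_sum]
            rw [h1, ht, add_mul, one_mul, div_mul_cancel₀ _ hpos.ne']
            have := Finset.sum_nonneg fun j (_ : j ∈ Finset.univ) => hδ j
            linarith
          have h2 : δ + c = (1 - t⁻¹) • δ + t⁻¹ • (δ + t • c) := by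
            rw [smul_add, inv_smul_smul₀ ht0.ne', ← add_assoc, ← add_smul, sub_add_cancel,
              one_smul]
          rw [h2]
          exact (convex_convexHull ℝ (B ∪ {δ})) (subset_convexHull ℝ _ (Or.inr rfl))
            (subset_convexHull ℝ _ (Or.inl hfar))
            (sub_nonneg.mpr (inv_le_one_of_one_le₀ ht1)) (inv_nonneg.mpr ht0.le) (by ring)
      have hsub2 : convexHull ℝ ((insert δ V : Finset (Fin n → ℝ)) : Set (Fin n → ℝ))
          ⊆ {v : Fin n → ℝ | v + c ∈ convexHull ℝ (B ∪ {δ})} := by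
        refine convexHull_min ?_ ?_
        · intro u hu
          rw [Finset.mem_coe, Finset.mem_insert] at hu
          rcases hu with rfl | hu
          · exact hδc c hc
          · exact subset_convexHull ℝ _ (Or.inl
              (h.add_mem (h.convexHull_subset (subset_convexHull ℝ _ hu)) hc))
        · exact (convex_convexHull ℝ _).translate_preimage_left c
      exact hsub2 hv

end IsGeneratedBy

end Bounds

/-! ### Lattice polyhedra that agree with the orthant up to a bounded set -/

section Polyhedra

variable {n : ℕ} {P : Set (Fin n → ℝ)}

theorem IsPolyhedron.convex (h : IsPolyhedron P) : Convex ℝ P := by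
  obtain ⟨m, a, b, rfl⟩ := h
  have : {x : Fin n → ℝ | ∀ r, b r ≤ ∑ j, a r j * x j} = ⋂ r, {x | b r ≤ a r ⬝ᵥ x} := by
    ext x
    simp [dotProduct]
  rw [this]
  exact convex_iInter fun r => convex_halfSpace_ge
    ⟨fun x y => dotProduct_add _ x y, fun c x => dotProduct_smul c _ x⟩ _

theorem IsPolyhedron.isClosed (h : IsPolyhedron P) : IsClosed P := by
  obtain ⟨m, a, b, rfl⟩ := h
  have : {x : Fin n → ℝ | ∀ r, b r ≤ ∑ j, a r j * x j}
      = ⋂ r, {x | b r ≤ ∑ j, a r j * x j} := by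
    ext x
    simp
  rw [this]
  exact isClosed_iInter fun r => isClosed_le continuous_const (by fun_prop)

/-- Outside of a cube, membership in `P` and in the orthant are the same. -/
theorem BoundedDiffOrthant.exists_bound (h : BoundedDiffOrthant P) :
    ∃ R : ℝ, 0 < R ∧ (∀ x ∈ posOrthant n, ∀ j, R < x j → x ∈ P) ∧
      ∀ x ∈ P, ∀ j, R < x j → x ∈ posOrthant n := by
  obtain ⟨R, hR⟩ := isBounded_iff_forall_norm_le.mp h
  refine ⟨max R 1, by positivity, fun x hx j hj => ?_, fun x hx j hj => ?_⟩
  · by_contra hxP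
    have h1 := hR x (Or.inl ⟨hx, hxP⟩)
    have h2 := (le_abs_self _).trans ((norm_le_pi_norm x j).trans h1)
    exact absurd ((le_max_left R 1).trans_lt hj) (not_lt.mpr h2)
  · by_contra hxP
    have h1 := hR x (Or.inr ⟨hx, hxP⟩)
    have h2 := (le_abs_self _).trans ((norm_le_pi_norm x j).trans h1)
    exact absurd ((le_max_left R 1).trans_lt hj) (not_lt.mpr h2)

theorem single_mem_posOrthant {r : ℝ} (hr : 0 ≤ r) (j : Fin n) :
    (Pi.single j r : Fin n → ℝ) ∈ posOrthant n := by
  intro i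
  by_cases h : i = j
  · subst h; simpa using hr
  · simp [h]

/-- Except on the line, a convex set with bounded difference from the orthant lies in the orthant:
from a point with a negative coordinate `j`, move halfway to a far point on another axis. -/
theorem subset_posOrthant_or_zero_mem (hconv : Convex ℝ P) (hP : BoundedDiffOrthant P) :
    P ⊆ posOrthant n ∨ (n = 1 ∧ 0 ∈ P) := by
  obtain ⟨R, hR0, hR, hR'⟩ := hP.exists_bound
  by_contra! hcon
  obtain ⟨hnot, hcon⟩ := hcon
  obtain ⟨x, hx, hxC⟩ := Set.not_subset.mp hnot
  obtain ⟨j, hj⟩ : ∃ j, x j < 0 := by simpa [posOrthant] using hxC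
  have hfar : ∀ t, R < t → ∀ i, (Pi.single i t : Fin n → ℝ) ∈ P := fun t ht i =>
    hR _ (single_mem_posOrthant (by linarith) i) i (by simpa using ht)
  by_cases hn : n = 1
  · subst hn
    refine hcon rfl ?_
    have hseg := hconv.segment_subset hx (hfar (R + 1) (by linarith) j)
    refine hseg ?_
    have hd : 0 < R + 1 - x j := by linarith
    refine ⟨(R + 1) / (R + 1 - x j), -x j / (R + 1 - x j), by positivity,
      div_nonneg (by linarith) hd.le, by field_simp; ring, ?_⟩
    ext i
    rw [Subsingleton.elim i j]
    simp
    field_simp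
    ring
  · have : Nontrivial (Fin n) := by
      rw [Fin.nontrivial_iff_two_le]
      have := j.pos
      omega
    obtain ⟨i, hij⟩ := exists_ne j
    set t := 2 * R + |x i| + 1 with ht
    have htR : R < t := by linarith [abs_nonneg (x i)]
    have hm := hconv hx (hfar t htR i) (by norm_num : (0 : ℝ) ≤ 1 / 2)
      (by norm_num : (0 : ℝ) ≤ 1 / 2) (by norm_num)
    have h1 := hR' _ hm i (by
      simp
      linarith [neg_abs_le (x i)]) j
    simp [hij.symm] at h1
    linarith

theorem add_mem_of_boundedDiff (hconv : Convex ℝ P) (hP : BoundedDiffOrthant P)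
    (hsub : P ⊆ posOrthant n) {b c : Fin n → ℝ} (hb : b ∈ P) (hc : c ∈ posOrthant n) :
    b + c ∈ P := by
  obtain ⟨R, hR0, hR, -⟩ := hP.exists_bound
  by_cases h0 : c = 0
  · rwa [h0, add_zero]
  obtain ⟨j, hj⟩ := Function.ne_iff.mp h0
  have hcj : 0 < c j := lt_of_le_of_ne (hc j) (Ne.symm hj)
  set t := 1 + R / c j with ht
  have ht1 : 1 ≤ t := by
    have : 0 ≤ R / c j := by positivity
    linarith
  have ht0 : 0 < t := by linarith
  have hfar : b + t • c ∈ P := by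
    refine hR _ (fun i => add_nonneg (hsub hb i) (mul_nonneg ht0.le (hc i))) j ?_
    have h1 : (b + t • c) j = b j + (c j + R) := by
      simp only [Pi.add_apply, Pi.smul_apply, smul_eq_mul, ht]
      field_simp
    rw [h1]
    linarith [hsub hb j]
  have h2 : b + c = (1 - t⁻¹) • b + t⁻¹ • (b + t • c) := by
    rw [smul_add, inv_smul_smul₀ ht0.ne', ← add_assoc, ← add_smul, sub_add_cancel, one_smul]
  rw [h2]
  exact hconv hb hfar (sub_nonneg.mpr (inv_le_one_of_one_le₀ ht1)) (inv_nonneg.mpr ht0.le)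
    (by ring)

/-- A functional with positive coefficients attains its minimum over `P` at an extreme point,
because its sublevel sets are compact. -/
theorem exists_extremePoint_le (hcl : IsClosed P) (hsub : P ⊆ posOrthant n) {φ : Fin n → ℝ}
    (hφ : ∀ j, 0 < φ j) {x : Fin n → ℝ} (hx : x ∈ P) :
    ∃ v ∈ P.extremePoints ℝ, φ ⬝ᵥ v ≤ φ ⬝ᵥ x := by
  have hcont : Continuous fun y : Fin n → ℝ => φ ⬝ᵥ y := continuous_const.dotProduct continuous_id
  have hcpt : ∀ t, IsCompact (P ∩ {y | φ ⬝ᵥ y ≤ t}) := by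
    intro t
    refine Metric.isCompact_of_isClosed_isBounded
      (hcl.inter (isClosed_le hcont continuous_const)) ?_
    refine (isCompact_Icc (a := (0 : Fin n → ℝ)) (b := fun j => t / φ j)).isBounded.subset ?_
    rintro y ⟨hy, hyt⟩
    refine ⟨hsub hy, fun j => (le_div_iff₀ (hφ j)).mpr ?_⟩
    rw [mul_comm]
    exact (Finset.single_le_sum (f := fun j => φ j * y j)
      (fun j _ => mul_nonneg (hφ j).le (hsub hy j)) (Finset.mem_univ j)).trans hyt
  obtain ⟨m, hm, hmin⟩ := (hcpt (φ ⬝ᵥ x)).exists_isMinOn ⟨x, hx, le_refl (φ ⬝ᵥ x)⟩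
    hcont.continuousOn
  have hmin' : ∀ y ∈ P, φ ⬝ᵥ m ≤ φ ⬝ᵥ y := by
    intro y hy
    by_cases hyx : φ ⬝ᵥ y ≤ φ ⬝ᵥ x
    · exact hmin ⟨hy, hyx⟩
    · exact (show φ ⬝ᵥ m ≤ φ ⬝ᵥ x from hm.2).trans (not_le.mp hyx).le
  obtain ⟨v, hv⟩ := (hcpt (φ ⬝ᵥ m)).extremePoints_nonempty ⟨m, hm.1, le_refl (φ ⬝ᵥ m)⟩
  have hexp : IsExposed ℝ P (P ∩ {y | φ ⬝ᵥ y ≤ φ ⬝ᵥ m}) := by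
    intro _
    refine ⟨-(LinearMap.toContinuousLinearMap
      (dotProductBilin ℝ ℝ φ : (Fin n → ℝ) →ₗ[ℝ] ℝ)), ?_⟩
    ext y
    constructor
    · rintro ⟨hy, hym⟩
      exact ⟨hy, fun z hz => neg_le_neg (show φ ⬝ᵥ y ≤ φ ⬝ᵥ z from le_trans hym (hmin' z hz))⟩
    · rintro ⟨hy, hym⟩
      exact ⟨hy, (neg_le_neg_iff.mp (hym m hm.1) : φ ⬝ᵥ y ≤ φ ⬝ᵥ m)⟩
  refine ⟨v, hexp.isExtreme.extremePoints_subset_extremePoints hv, ?_⟩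
  exact (show φ ⬝ᵥ v ≤ φ ⬝ᵥ m from hv.1.2).trans hm.2

theorem isClosed_posOrthant (n : ℕ) : IsClosed (posOrthant n) := by
  have : posOrthant n = ⋂ j, {x | 0 ≤ x j} := by
    ext x
    simp [posOrthant]
  rw [this]
  exact isClosed_iInter fun j => isClosed_le continuous_const (continuous_apply j)

/-- The generators are all lattice points of `P` in a large cube. They include the extreme points: a
point with a large coordinate `j` is the midpoint of its translates by `± e j`. That nothing else is
needed follows from the separation theorem, since a functional bounded below on the sum has
nonnegative coefficients. -/
theorem IsLatticePolyhedron.exists_isGeneratedBy (h : IsLatticePolyhedron P)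
    (hP : BoundedDiffOrthant P) (hsub : P ⊆ posOrthant n) :
    ∃ V : Finset (Fin n → ℝ), IsGeneratedBy P V ∧ ∀ v ∈ V, IsLatticePoint v := by
  classical
  obtain ⟨R, hR0, hR, -⟩ := hP.exists_bound
  have hconv := h.1.convex
  set K : ℤ := ⌈R⌉ + 1 with hK
  have hRK : R + 1 ≤ K := by
    rw [hK]
    push_cast
    linarith [Int.le_ceil R]
  have hfin : {v : Fin n → ℝ | v ∈ P ∧ IsLatticePoint v ∧ ∀ j, v j ≤ K}.Finite := by
    refine ((Set.finite_Icc (0 : Fin n → ℤ) fun _ => K).image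
      fun z j => ((z j : ℤ) : ℝ)).subset ?_
    rintro v ⟨hv, hvl, hvK⟩
    choose z hz using hvl
    refine ⟨z, ⟨fun j => ?_, fun j => ?_⟩, funext fun j => (hz j).symm⟩
    · have := hsub hv j
      rw [hz j] at this
      exact_mod_cast this
    · have := hvK j
      rw [hz j] at this
      exact_mod_cast this
  have hmem : ∀ {v}, v ∈ hfin.toFinset ↔ v ∈ P ∧ IsLatticePoint v ∧ ∀ j, v j ≤ K := by
    intro v
    rw [Set.Finite.mem_toFinset]
    rfl
  have hext : ∀ v ∈ P.extremePoints ℝ, v ∈ hfin.toFinset := by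
    intro v hv
    refine hmem.mpr ⟨hv.1, h.2 v hv, fun j => ?_⟩
    by_contra! hlt
    have h1 : v + Pi.single j 1 ∈ P := add_mem_of_boundedDiff hconv hP hsub hv.1
      (single_mem_posOrthant zero_le_one j)
    have h2 : v - Pi.single j 1 ∈ P := by
      refine hR _ (fun i => ?_) j ?_
      · by_cases hij : i = j
        · subst hij
          simp
          linarith
        · simpa [hij] using hsub hv.1 i
      · simp
        linarith
    have h3 := (mem_extremePoints.mp hv).2 _ h2 _ h1 ⟨1 / 2, 1 / 2, by norm_num, by norm_num,
      by norm_num, by ext i; simp; ring⟩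
    have h4 := congrFun h3.2 j
    simp at h4
  have haxis : ∀ j, (Pi.single j (K : ℝ) : Fin n → ℝ) ∈ hfin.toFinset := by
    intro j
    refine hmem.mpr ⟨hR _ (single_mem_posOrthant (by linarith) j) j (by simp; linarith),
      fun i => ?_, fun i => ?_⟩
    · by_cases hij : i = j
      · subst hij; exact ⟨K, by simp⟩
      · exact ⟨0, by simp [hij]⟩
    · by_cases hij : i = j
      · subst hij; simp
      · have hK0 : (0 : ℝ) ≤ K := by linarith
        rwa [Pi.single_eq_of_ne hij]
  refine ⟨hfin.toFinset, ⟨fun v hv => hsub (hmem.mp hv).1, fun j => ⟨K, haxis j⟩, ?_⟩,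
    fun v hv => (hmem.mp hv).2.1⟩
  refine Set.Subset.antisymm (fun x hx => ?_) ?_
  · by_contra hxT
    have hTcl : IsClosed (convexHull ℝ (hfin.toFinset : Set (Fin n → ℝ)) + posOrthant n) :=
      (isClosed_posOrthant n).add_left_of_isCompact
        ((Finset.finite_toSet _).isCompact_convexHull ℝ)
    obtain ⟨f, u, hfx, hfT⟩ := geometric_hahn_banach_point_closed
      ((convex_convexHull ℝ _).add (convex_posOrthant n)) hTcl hxT
    have hf : ∀ y, f y = (fun j => f (Pi.single j 1)) ⬝ᵥ y := by
      intro y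
      refine (LinearMap.pi_apply_eq_sum_univ (f : (Fin n → ℝ) →ₗ[ℝ] ℝ) y).trans ?_
      refine Finset.sum_congr rfl fun j _ => ?_
      have h1 : (fun i => if j = i then (1 : ℝ) else 0) = Pi.single j 1 := by
        ext i
        simp [Pi.single_apply, eq_comm]
      rw [h1, smul_eq_mul, mul_comm]
      rfl
    set φ : Fin n → ℝ := fun j => f (Pi.single j 1) with hφ
    have hφ0 : ∀ j, 0 ≤ φ j := by
      intro j
      by_contra! hneg
      set v : Fin n → ℝ := Pi.single j (K : ℝ)
      set t : ℝ := |f v - u| / (-φ j) with ht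
      have ht0 : 0 ≤ t := div_nonneg (abs_nonneg _) (by linarith)
      have h1 := hfT (v + Pi.single j t) ⟨v, subset_convexHull ℝ _ (haxis j), _,
        single_mem_posOrthant ht0 j, rfl⟩
      rw [map_add, hf (Pi.single j t), dotProduct_single] at h1
      have h2 : φ j * t = -|f v - u| := by
        rw [ht, div_neg, mul_neg, mul_div_cancel₀ _ hneg.ne]
      rw [h2] at h1
      linarith [le_abs_self (f v - u)]
    have hs0 : 0 ≤ ∑ j, x j := Finset.sum_nonneg fun j _ => hsub hx j
    -- a small perturbation makes all coefficients positive and still separates `x`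
    set ε : ℝ := (u - f x) / (∑ j, x j + 1) with hε
    have hε0 : 0 < ε := div_pos (by linarith) (by linarith)
    have hεx : ε * ∑ j, x j < u - f x := by
      have h1 : ε * (∑ j, x j + 1) = u - f x := div_mul_cancel₀ _ (by linarith)
      linarith
    obtain ⟨v, hv, hvx⟩ := exists_extremePoint_le h.1.isClosed hsub (φ := fun j => φ j + ε)
      (fun j => by linarith [hφ0 j]) hx
    have hdot : ∀ y : Fin n → ℝ, (fun j => φ j + ε) ⬝ᵥ y = f y + ε * ∑ j, y j := by
      intro y
      rw [hf y]
      simp only [dotProduct, add_mul, Finset.sum_add_distrib, Finset.mul_sum]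
    rw [hdot, hdot] at hvx
    have hvT := hfT v ⟨v, subset_convexHull ℝ _ (hext v hv), 0, fun _ => le_rfl, add_zero v⟩
    have hvs : 0 ≤ ε * ∑ j, v j := mul_nonneg hε0.le
      (Finset.sum_nonneg fun j _ => hsub hv.1 j)
    linarith
  · rintro _ ⟨v, hv, c, hc, rfl⟩
    exact add_mem_of_boundedDiff hconv hP hsub
      (convexHull_min (fun v hv => (hmem.mp hv).1) hconv hv) hc

namespace IsGeneratedBy

variable {B : Set (Fin n → ℝ)} {V : Finset (Fin n → ℝ)}

theorem boundedDiffOrthant (h : IsGeneratedBy B V) : BoundedDiffOrthant B := by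
  rcases Nat.eq_zero_or_pos n with rfl | hn
  · exact (Set.toFinite _).isBounded
  obtain ⟨N, hN0, hN⟩ := exists_forall_sum_lt (fun _ : Fin n => V)
  refine isBounded_iff_forall_norm_le.mpr ⟨N, fun x hx => ?_⟩
  rcases hx with ⟨hx, hxB⟩ | ⟨hx, hxC⟩
  · have hlt : ∑ j, x j < N := by
      by_contra! hle
      exact hxB (h.mem_of_le_sum hN0 (hN ⟨0, hn⟩) hx hle)
    refine (pi_norm_le_iff_of_nonneg hN0.le).mpr fun j => ?_
    rw [Real.norm_of_nonneg (hx j)]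
    exact (Finset.single_le_sum (fun j _ => hx j) (Finset.mem_univ j)).trans hlt.le
  · exact absurd (h.le_posOrthant hx) hxC

theorem extremePoints_subset (h : IsGeneratedBy B V) : B.extremePoints ℝ ⊆ V := by
  intro x hx
  obtain ⟨v, hv, c, hc, rfl⟩ := h.eq_add ▸ hx.1
  have hvB := h.convexHull_subset hv
  have h1 := (mem_extremePoints.mp hx).2 v hvB _ (h.add_mem hx.1 hc)
    ⟨1 / 2, 1 / 2, by norm_num, by norm_num, by norm_num, by ext i; simp; ring⟩
  rw [← h1.1] at hx
  have := extremePoints_convexHull_subset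
    (inter_extremePoints_subset_extremePoints_of_subset h.convexHull_subset ⟨hv, hx⟩)
  rw [← h1.1]
  exact this

end IsGeneratedBy

theorem isPolyhedron_cutOrthant (b : Fin n → ℝ) : IsPolyhedron (cutOrthant b) := by
  refine ⟨n + 1, Fin.cons (fun j => (b j)⁻¹) fun j => Pi.single j 1,
    Fin.cons 1 fun _ => 0, ?_⟩
  ext x
  simp [cutOrthant, posOrthant, Fin.forall_fin_succ, and_comm, div_eq_inv_mul, Pi.single_apply]

end Polyhedra

/-! ### Classification of the minimal tuples -/

section Classification

variable {n : ℕ}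

/-- The tuple whose `i`-th member has the vertices `2 • e j` for `i ∈ I` and `j ∈ J`, and `e j`
otherwise. -/
def blockTuple (I J : Finset (Fin n)) (i : Fin n) : Set (Fin n → ℝ) :=
  cutOrthant fun j => if i ∈ I ∧ j ∈ J then 2 else 1

theorem isGeneratedBy_blockTuple (I J : Finset (Fin n)) (i : Fin n) :
    IsGeneratedBy (blockTuple I J i)
      (Finset.univ.image fun j => Pi.single j (if i ∈ I ∧ j ∈ J then 2 else 1)) :=
  isGeneratedBy_cutOrthant fun j => by split_ifs <;> norm_num

theorem cutOrthant_subset_cutOrthant {a b : Fin n → ℝ} (hb : ∀ j, 0 < b j)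
    (h : ∀ j, b j ≤ a j) : cutOrthant a ⊆ cutOrthant b := by
  rintro x ⟨hx, hs⟩
  exact ⟨hx, hs.trans (Finset.sum_le_sum fun j _ =>
    div_le_div_of_nonneg_left (hx j) (hb j) (h j))⟩

/-- A nonzero lattice point of the orthant is excluded only by being a basis vector `e j` with
`i ∈ I` and `j ∈ J`. -/
theorem mem_blockTuple_of_isLatticePoint {I J : Finset (Fin n)} {i : Fin n} {v : Fin n → ℝ}
    (hv : v ∈ posOrthant n) (hl : IsLatticePoint v) (h0 : v ≠ 0)
    (h1 : i ∈ I → ∀ j ∈ J, v ≠ Pi.single j 1) : v ∈ blockTuple I J i := by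
  refine ⟨hv, ?_⟩
  set a : Fin n → ℝ := fun j => if i ∈ I ∧ j ∈ J then 2 else 1 with ha
  have ha0 : ∀ j, 0 < a j := fun j => by simp only [ha]; split_ifs <;> norm_num
  have ha2 : ∀ j, a j ≤ 2 := fun j => by simp only [ha]; split_ifs <;> norm_num
  have hge1 : ∀ j, v j ≠ 0 → 1 ≤ v j := by
    intro j hj
    obtain ⟨z, hz⟩ := hl j
    have h2 := hv j
    rw [hz] at h2 hj ⊢
    have h3 : 0 ≤ z := by exact_mod_cast h2
    have h4 : z ≠ 0 := by exact_mod_cast hj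
    exact_mod_cast (by omega : 1 ≤ z)
  have hterm : ∀ j, 0 ≤ v j / a j := fun j => div_nonneg (hv j) (ha0 j).le
  have hhalf : ∀ j, v j ≠ 0 → 1 / 2 ≤ v j / a j := fun j hj =>
    div_le_div₀ (hv j) (hge1 j hj) (ha0 j) (ha2 j)
  have hsingle : ∀ j, 1 ≤ v j / a j → 1 ≤ ∑ j, v j / a j := fun j hj =>
    hj.trans (Finset.single_le_sum (fun j _ => hterm j) (Finset.mem_univ j))
  obtain ⟨j, hj⟩ := Function.ne_iff.mp h0
  by_cases hij : i ∈ I ∧ j ∈ J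
  · have haj : a j = 2 := by simp [ha, hij]
    by_cases h2 : v j = 1
    · obtain ⟨l, hl⟩ := Function.ne_iff.mp (h1 hij.1 j hij.2)
      have hlj : l ≠ j := by
        rintro rfl
        exact hl (by simpa using h2)
      rw [Pi.single_eq_of_ne hlj] at hl
      calc (1 : ℝ) = 1 / 2 + 1 / 2 := by norm_num
        _ ≤ v l / a l + v j / a j := add_le_add (hhalf l hl) (hhalf j hj)
        _ = ∑ k ∈ {l, j}, v k / a k := (Finset.sum_pair (f := fun k => v k / a k) hlj).symm
        _ ≤ _ := Finset.sum_le_sum_of_subset_of_nonneg (Finset.subset_univ _)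
          fun k _ _ => hterm k
    · refine hsingle j ?_
      have h3 := hge1 j hj
      obtain ⟨z, hz⟩ := hl j
      rw [haj, hz, one_le_div two_pos]
      rw [hz] at h3 h2
      have h4 : 1 ≤ z := by exact_mod_cast h3
      have h5 : z ≠ 1 := by exact_mod_cast h2
      exact_mod_cast (by omega : 2 ≤ z)
  · refine hsingle j ?_
    have haj : a j = 1 := by simp only [ha, hij, if_false]
    rw [haj, div_one]
    exact hge1 j hj

/-- The members of `blockTuple I J` lie in the half-spaces `d i ≤ ∑ j, w j * x j` with `w = 1 / 2`
on `J` and `d = 1 / 2` off `I`, so that `(∏ d) / ∏ w = 2 ^ (|J| - (n - |I|)) = 2`. -/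
theorem two_le_relMixedVolume {I J : Finset (Fin n)} (hI : I.Nonempty)
    (hIJ : I.card + J.card = n + 1) {B : Fin n → Set (Fin n → ℝ)}
    {V : Fin n → Finset (Fin n → ℝ)} (h : ∀ i, IsGeneratedBy (B i) (V i))
    (hB : ∀ i, B i ⊆ blockTuple I J i) : 2 ≤ relMixedVolume B := by
  classical
  have hn : n ≠ 0 := by
    obtain ⟨i, -⟩ := hI
    exact i.pos.ne'
  set w : Fin n → ℝ := fun j => if j ∈ J then 1 / 2 else 1 with hw
  set d : Fin n → ℝ := fun i => if i ∈ I then 1 else 1 / 2 with hd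
  have hw0 : ∀ j, 0 < w j := fun j => by simp only [hw]; split_ifs <;> norm_num
  have hd0 : ∀ i, 0 < d i := fun i => by simp only [hd]; split_ifs <;> norm_num
  have h1 := IsGeneratedBy.prod_div_prod_le_relMixedVolume hn h hw0 hd0 fun i =>
    (hB i).trans (cutOrthant_subset_cutOrthant (fun j => div_pos (hd0 i) (hw0 j)) fun j => by
      simp only [hw, hd]
      by_cases hi : i ∈ I <;> by_cases hj : j ∈ J <;> norm_num [hi, hj])
  refine le_trans (le_of_eq ?_) h1
  have hpw : ∏ j, w j = (1 / 2) ^ J.card := by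
    simp [hw, Finset.prod_ite_mem]
  have hpd : ∏ i, d i = (1 / 2) ^ (n - I.card) := by
    have : ∀ i, d i = if i ∈ Iᶜ then 1 / 2 else 1 := fun i => by
      simp only [hd, Finset.mem_compl]
      split_ifs <;> simp_all
    simp_rw [this]
    rw [Finset.prod_ite_mem, Finset.univ_inter, Finset.prod_const, Finset.card_compl,
      Fintype.card_fin]
  have hle : I.card ≤ n := by simpa using Finset.card_le_univ I
  have hJ : J.card = (n - I.card) + 1 := by omega
  rw [hpw, hpd, hJ, pow_succ]
  have : ((1 : ℝ) / 2) ^ (n - I.card) ≠ 0 := by positivity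
  field_simp

theorem exists_perm_of_card_eq (p q : Fin n → Prop) [DecidablePred p] [DecidablePred q]
    [Fintype {i // p i}] [Fintype {i // q i}]
    (h : Fintype.card {i // p i} = Fintype.card {i // q i}) :
    ∃ σ : Equiv.Perm (Fin n), ∀ i, q (σ i) ↔ p i := by
  set e := Fintype.equivOfCardEq h
  exact ⟨e.extendSubtype, fun i => ⟨fun hq => by
    by_contra hp
    exact e.extendSubtype_not_mem i hp hq, e.extendSubtype_mem i⟩⟩

/-- Outside of the block `I × J`, there are perfect matchings that use any given entry of the block
in addition: match `I` with the complement of `J` and `j₀`, and then correct the partner of `i₀` by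
a transposition. -/
theorem exists_perm_matching {I J : Finset (Fin n)} (hIJ : I.card + J.card = n + 1)
    {i₀ j₀ : Fin n} (hi : i₀ ∈ I) (hj : j₀ ∈ J) :
    ∃ σ : Equiv.Perm (Fin n), σ i₀ = j₀ ∧ ∀ i, i ≠ i₀ → ¬ (i ∈ I ∧ σ i ∈ J) := by
  classical
  have hJn : J.card ≤ n := by simpa using Finset.card_le_univ J
  have hcard : Fintype.card {i // i ∈ I} = Fintype.card {j // j ∈ insert j₀ Jᶜ} := by
    rw [Fintype.card_coe, Fintype.card_coe, Finset.card_insert_of_notMem (by simpa using hj),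
      Finset.card_compl, Fintype.card_fin]
    omega
  obtain ⟨σ, hσ⟩ := exists_perm_of_card_eq (fun i => i ∈ I) (fun j => j ∈ insert j₀ Jᶜ) hcard
  refine ⟨Equiv.swap (σ i₀) j₀ * σ, by simp, ?_⟩
  rintro i hne ⟨hiI, hiJ⟩
  have hσi := (hσ i).mpr hiI
  have hσ0 := (hσ i₀).mpr hi
  rw [Equiv.Perm.mul_apply] at hiJ
  have hne' : σ i ≠ σ i₀ := fun h => hne (σ.injective h)
  by_cases h : σ i = j₀
  · rw [h, Equiv.swap_apply_right] at hiJ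
    rcases Finset.mem_insert.mp hσ0 with h' | h'
    · exact hne' (h.trans h'.symm)
    · exact Finset.mem_compl.mp h' hiJ
  · rw [Equiv.swap_apply_of_ne_of_ne hne' h] at hiJ
    rcases Finset.mem_insert.mp hσi with h' | h'
    · exact h h'
    · exact Finset.mem_compl.mp h' hiJ

theorem single_mem_blockTuple (I J : Finset (Fin n)) (i j : Fin n) :
    (Pi.single j (if i ∈ I ∧ j ∈ J then 2 else 1) : Fin n → ℝ) ∈ blockTuple I J i :=
  (isGeneratedBy_blockTuple I J i).convexHull_subset
    (subset_convexHull ℝ _ (by simp))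

/-- The upper bound comes from a matching with exactly one entry in the block `I × J`. -/
theorem relMixedVolume_blockTuple {I J : Finset (Fin n)} (hI : I.Nonempty)
    (hIJ : I.card + J.card = n + 1) : relMixedVolume (blockTuple I J) = 2 := by
  classical
  have hIn : I.card ≤ n := by simpa using Finset.card_le_univ I
  obtain ⟨i₀, hi₀⟩ := hI
  obtain ⟨j₀, hj₀⟩ : J.Nonempty := Finset.card_pos.mp (by omega)
  refine le_antisymm ?_ (two_le_relMixedVolume ⟨i₀, hi₀⟩ hIJ
    (isGeneratedBy_blockTuple I J) fun i => le_rfl)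
  obtain ⟨σ, hσ₀, hσ⟩ := exists_perm_matching hIJ hi₀ hj₀
  have h1 := IsGeneratedBy.relMixedVolume_le_prod i₀.pos.ne' (isGeneratedBy_blockTuple I J) σ
    (c := fun i => if i = i₀ then 2 else 1) (fun i => by split_ifs <;> norm_num) fun i => by
      have := single_mem_blockTuple I J i (σ i)
      by_cases hi : i = i₀
      · subst hi
        rw [hσ₀] at this ⊢
        simpa [hi₀, hj₀] using this
      · rw [if_neg (hσ i hi)] at this
        simpa [hi] using this
  simpa using h1

theorem relMixedVolume_nonpos_of_zero_mem (hn : n ≠ 0) {B : Fin n → Set (Fin n → ℝ)}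
    {V : Fin n → Finset (Fin n → ℝ)} (h : ∀ i, IsGeneratedBy (B i) (V i)) {i : Fin n}
    (hi : 0 ∈ B i) : relMixedVolume B ≤ 0 := by
  classical
  choose r hr using fun i => (h i).exists_axis i
  have h1 := IsGeneratedBy.relMixedVolume_le_prod hn h 1 (c := Function.update r i 0)
    (fun k => ?_) fun k => ?_
  · rwa [Finset.prod_eq_zero (Finset.mem_univ i) (by simp)] at h1
  · by_cases hk : k = i
    · simp [hk]
    · have := (h k).subset_posOrthant (hr k) k
      simpa [hk] using this
  · by_cases hk : k = i
    · subst hk; simpa using hi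
    · simpa [hk] using (h k).convexHull_subset (subset_convexHull ℝ _ (hr k))

theorem isMinimalTuple_blockTuple {I J : Finset (Fin n)} (hI : I.Nonempty)
    (hIJ : I.card + J.card = n + 1) : IsMinimalTuple (blockTuple I J) 2 := by
  classical
  refine ⟨relMixedVolume_blockTuple hI hIJ, fun i δ hδ hl => ?_⟩
  have hn : n ≠ 0 := i.pos.ne'
  have hgen : ∀ k, ∃ V, IsGeneratedBy (Function.update (blockTuple I J) i
      (convexHull ℝ (blockTuple I J i ∪ {δ})) k) V := by
    intro k
    by_cases hk : k = i
    · subst hk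
      rw [Function.update_self]
      exact ⟨_, (isGeneratedBy_blockTuple I J k).convexHull_union_singleton hn hδ.1⟩
    · rw [Function.update_of_ne hk]
      exact ⟨_, isGeneratedBy_blockTuple I J k⟩
  choose V hV using hgen
  have hδmem : δ ∈ Function.update (blockTuple I J) i
      (convexHull ℝ (blockTuple I J i ∪ {δ})) i := by
    rw [Function.update_self]
    exact subset_convexHull ℝ _ (Or.inr rfl)
  by_cases h0 : δ = 0
  · rw [h0] at hδmem
    subst h0
    exact (relMixedVolume_nonpos_of_zero_mem hn hV hδmem).trans_lt two_pos
  · have h1 : i ∈ I ∧ ∃ j ∈ J, δ = Pi.single j 1 := by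
      by_contra hcon
      refine hδ.2 (mem_blockTuple_of_isLatticePoint hδ.1 hl h0 fun hi j hj h => hcon ?_)
      exact ⟨hi, j, hj, h⟩
    obtain ⟨hi, j, hj, rfl⟩ := h1
    obtain ⟨σ, hσ₀, hσ⟩ := exists_perm_matching hIJ hi hj
    have h2 := IsGeneratedBy.relMixedVolume_le_prod hn hV σ (c := fun _ => 1)
      (fun _ => zero_le_one) fun k => by
        by_cases hk : k = i
        · subst hk
          rw [hσ₀]
          exact hδmem
        · have := single_mem_blockTuple I J k (σ k)
          rw [if_neg (hσ k hk)] at this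
          rwa [Function.update_of_ne hk]
    rw [Finset.prod_const_one] at h2
    linarith

theorem isLatticePolyhedron_blockTuple (I J : Finset (Fin n)) (i : Fin n) :
    IsLatticePolyhedron (blockTuple I J i) := by
  classical
  refine ⟨isPolyhedron_cutOrthant _, fun v hv => ?_⟩
  have := (isGeneratedBy_blockTuple I J i).extremePoints_subset hv
  rw [Finset.mem_coe, Finset.mem_image] at this
  obtain ⟨j, -, rfl⟩ := this
  intro k
  by_cases hk : k = j
  · subst hk
    rw [Pi.single_eq_same]
    split_ifs
    · exact ⟨2, by norm_num⟩
    · exact ⟨1, by norm_num⟩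
  · exact ⟨0, by simp [hk]⟩

/-- On the line, such a set covers the orthant but need not be contained in it. -/
theorem relMixedVolume_nonpos_of_dim_one {B : Fin 1 → Set (Fin 1 → ℝ)} (hconv : Convex ℝ (B 0))
    (hB : BoundedDiffOrthant (B 0)) (h0 : 0 ∈ B 0) : relMixedVolume B ≤ 0 := by
  have hsub : posOrthant 1 ⊆ B 0 := by
    obtain ⟨R, hR0, hR, -⟩ := hB.exists_bound
    intro x hx
    have hR' : (fun _ => R + 1 + x 0 : Fin 1 → ℝ) ∈ B 0 :=
      hR _ (fun j => by linarith [hx 0]) 0 (by linarith [hx 0])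
    have hpos : 0 < R + 1 + x 0 := by linarith [hx 0]
    have h1 := hconv h0 hR' (a := 1 - x 0 / (R + 1 + x 0)) (b := x 0 / (R + 1 + x 0))
      (sub_nonneg.mpr ((div_le_one hpos).mpr (by linarith))) (div_nonneg (hx 0) hpos.le) (by ring)
    convert! h1 using 1
    ext j
    rw [Subsingleton.elim j 0]
    simp
    field_simp
  have huniv : (Finset.univ : Finset (Finset (Fin 1))) = {∅, {0}} := by decide
  unfold relMixedVolume pairMixedVolume
  rw [huniv, Finset.sum_pair (by simp)]
  simp only [Finset.sum_empty, pairVolume_zero, Finset.sum_singleton]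
  have h2 : posOrthant 1 \ B 0 = ∅ := Set.sdiff_eq_empty.mpr hsub
  simp [pairVolume, h2]

/-- Hall's theorem provides `I` and `J` such that the members lie in those of `blockTuple I J`;
minimality then forces equality. -/
theorem exists_blockTuple_of_isMinimalTuple {B : Fin n → Set (Fin n → ℝ)}
    (hB : ∀ i, IsLatticePolyhedron (B i) ∧ BoundedDiffOrthant (B i)) (hmin : IsMinimalTuple B 2) :
    ∃ I J : Finset (Fin n), I.Nonempty ∧ I.card + J.card = n + 1 ∧ ∀ i, B i = blockTuple I J i := by
  classical
  -- in dimension zero, the mixed volume is `0`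
  have hn : n ≠ 0 := by
    rintro rfl
    have h1 := hmin.1
    rw [relMixedVolume, pairMixedVolume, Fintype.sum_unique,
      Subsingleton.elim default (∅ : Finset (Fin 0)), Finset.sum_empty,
      pairVolume_zero] at h1
    norm_num at h1
  have hsub : ∀ i, B i ⊆ posOrthant n := by
    intro i
    rcases subset_posOrthant_or_zero_mem (hB i).1.1.convex (hB i).2 with h | ⟨h, h0⟩
    · exact h
    · subst h
      obtain rfl := Subsingleton.elim i 0
      have h1 := relMixedVolume_nonpos_of_dim_one (hB 0).1.1.convex (hB 0).2 h0
      rw [hmin.1] at h1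
      norm_num at h1
  choose V hV hVl using fun i => (hB i).1.exists_isGeneratedBy (hB i).2 (hsub i)
  have hzero : ∀ i, 0 ∉ B i := by
    intro i hi
    have h1 := relMixedVolume_nonpos_of_zero_mem hn hV hi
    rw [hmin.1] at h1
    norm_num at h1
  -- the marriage condition for the relation `e j ∈ B i` fails, as a matching would give volume `1`
  set t : Fin n → Finset (Fin n) := fun i =>
    Finset.univ.filter fun j => (Pi.single j 1 : Fin n → ℝ) ∈ B i with ht
  have hHall : ¬ ∀ s : Finset (Fin n), s.card ≤ (s.biUnion t).card := by
    rw [Finset.all_card_le_biUnion_card_iff_exists_injective]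
    rintro ⟨f, hf, hft⟩
    have h1 := IsGeneratedBy.relMixedVolume_le_prod hn hV
      (Equiv.ofBijective f (Finite.injective_iff_bijective.mp hf)) (c := fun _ => 1)
      (fun _ => zero_le_one) fun i => by simpa [ht] using hft i
    rw [hmin.1, Finset.prod_const_one] at h1
    norm_num at h1
  obtain ⟨I, hI⟩ := not_forall.mp hHall
  rw [not_le] at hI
  have hIn : I.card ≤ n := by simpa using Finset.card_le_univ I
  have hI0 : I.Nonempty := Finset.card_pos.mp (by omega)
  obtain ⟨J, hJ, hJc⟩ := Finset.exists_subset_card_eq (s := (I.biUnion t)ᶜ)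
    (n := n + 1 - I.card) (by
      rw [Finset.card_compl, Fintype.card_fin]
      omega)
  have hnot : ∀ i ∈ I, ∀ j ∈ J, (Pi.single j 1 : Fin n → ℝ) ∉ B i := by
    intro i hi j hj hmem
    refine Finset.mem_compl.mp (hJ hj) (Finset.mem_biUnion.mpr ⟨i, hi, ?_⟩)
    simpa [ht] using hmem
  have hIJ : I.card + J.card = n + 1 := by omega
  have hBQ : ∀ i, B i ⊆ blockTuple I J i := by
    intro i
    have hVQ : (V i : Set (Fin n → ℝ)) ⊆ blockTuple I J i := by
      intro v hv
      have hvB : v ∈ B i := (hV i).convexHull_subset (subset_convexHull ℝ _ hv)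
      refine mem_blockTuple_of_isLatticePoint (hsub i hvB) (hVl i v hv) ?_ ?_
      · rintro rfl
        exact hzero i hvB
      · rintro hi j hj rfl
        exact hnot i hi j hj hvB
    rw [(hV i).eq_add]
    rintro _ ⟨v, hv, c, hc, rfl⟩
    exact (isGeneratedBy_blockTuple I J i).add_mem
      (convexHull_min hVQ (isGeneratedBy_blockTuple I J i).convex hv) hc
  refine ⟨I, J, hI0, hIJ, fun i => (hBQ i).antisymm ?_⟩
  by_contra hQB
  have hex : ∃ j, (Pi.single j (if i ∈ I ∧ j ∈ J then 2 else 1) : Fin n → ℝ) ∉ B i := by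
    by_contra! hall
    refine hQB ?_
    rw [(isGeneratedBy_blockTuple I J i).eq_add]
    rintro _ ⟨v, hv, c, hc, rfl⟩
    refine (hV i).add_mem (convexHull_min ?_ (hV i).convex hv) hc
    intro u hu
    obtain ⟨j, -, rfl⟩ := Finset.mem_image.mp hu
    exact hall j
  -- with the missing vertex `δ` the members still lie in those of `blockTuple I J`, so the volume
  -- remains at least `2`
  obtain ⟨j, hj⟩ := hex
  set δ : Fin n → ℝ := Pi.single j (if i ∈ I ∧ j ∈ J then 2 else 1) with hδ
  have hδQ : δ ∈ blockTuple I J i := single_mem_blockTuple I J i j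
  have hδl : IsLatticePoint δ := by
    intro k
    by_cases hk : k = j
    · subst hk
      rw [hδ, Pi.single_eq_same]
      split_ifs
      · exact ⟨2, by norm_num⟩
      · exact ⟨1, by norm_num⟩
    · exact ⟨0, by simp [hδ, hk]⟩
  have hlt := hmin.2 i δ ⟨hδQ.1, hj⟩ hδl
  have hgen : ∀ k, ∃ V', IsGeneratedBy (Function.update B i (convexHull ℝ (B i ∪ {δ})) k) V' := by
    intro k
    by_cases hk : k = i
    · subst hk
      rw [Function.update_self]
      exact ⟨_, (hV k).convexHull_union_singleton hn hδQ.1⟩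
    · rw [Function.update_of_ne hk]
      exact ⟨_, hV k⟩
  choose V' hV' using hgen
  refine absurd (two_le_relMixedVolume hI0 hIJ hV' fun k => ?_) (not_le.mpr hlt)
  by_cases hk : k = i
  · subst hk
    rw [Function.update_self]
    exact convexHull_min (Set.union_subset (hBQ k) (Set.singleton_subset_iff.mpr hδQ))
      (isGeneratedBy_blockTuple I J k).convex
  · rw [Function.update_of_ne hk]
    exact hBQ k

/-- A permutation of the coordinates permutes the coefficients. -/
theorem image_comp_eq_cutOrthant_iff {B : Set (Fin n → ℝ)} (τ : Equiv.Perm (Fin n))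
    (b : Fin n → ℝ) : (fun x : Fin n → ℝ => x ∘ τ) '' B = cutOrthant b ↔
      B = cutOrthant (b ∘ τ.symm) := by
  have hinj : Function.Injective fun x : Fin n → ℝ => x ∘ τ :=
    τ.surjective.injective_comp_right
  have himg : (fun x : Fin n → ℝ => x ∘ τ) '' cutOrthant (b ∘ τ.symm) = cutOrthant b := by
    ext y
    constructor
    · rintro ⟨x, ⟨hx, hs⟩, rfl⟩
      refine ⟨fun j => hx (τ j), ?_⟩
      rw [← Equiv.sum_comp τ] at hs
      simpa using hs
    · rintro ⟨hy, hs⟩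
      refine ⟨y ∘ τ.symm, ⟨fun j => hy _, ?_⟩, by ext j; simp⟩
      rw [← Equiv.sum_comp τ]
      simpa using hs
  rw [← himg]
  exact hinj.image_injective.eq_iff

/-- The parameter `k` is the number of elements of `I`. -/
theorem standardTuple_iff_blockTuple (B : Fin n → Set (Fin n → ℝ)) :
    (∃ k : ℕ, 1 ≤ k ∧ k ≤ n ∧ ∃ σ τ : Equiv.Perm (Fin n),
        ∀ i, (fun x : Fin n → ℝ => x ∘ τ) '' B (σ i) = standardTuple n k i) ↔
      ∃ I J : Finset (Fin n), I.Nonempty ∧ I.card + J.card = n + 1 ∧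
        ∀ i, B i = blockTuple I J i := by
  classical
  have hstd : ∀ k (i : Fin n), standardTuple n k i = cutOrthant fun j =>
      if (i : ℕ) < k ∧ ¬ ((j : ℕ) + 1 < k) then 2 else 1 := by
    intro k i
    unfold standardTuple
    by_cases h : (i : ℕ) < k
    · simp only [h, if_true, true_and, ite_not]
    · simp only [h, if_false, false_and]
  have hcard : ∀ k ≤ n, Fintype.card {i : Fin n // (i : ℕ) < k} = k := by
    intro k hk
    rw [Fintype.card_subtype]
    rw [Fin.card_filter_val_lt, min_eq_right hk]
  have hcard2 : ∀ k, 1 ≤ k → k ≤ n →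
      Fintype.card {j : Fin n // ¬ ((j : ℕ) + 1 < k)} = n + 1 - k := by
    intro k hk hkn
    have h1 := hcard (k - 1) (by omega)
    rw [Fintype.card_subtype_compl, Fintype.card_fin]
    have h2 : Fintype.card {j : Fin n // (j : ℕ) + 1 < k} = k - 1 := by
      rw [← h1]
      exact Fintype.card_congr (Equiv.subtypeEquivRight fun j => by omega)
    omega
  constructor
  · rintro ⟨k, hk, hkn, σ, τ, h⟩
    refine ⟨Finset.univ.filter fun i => (σ.symm i : ℕ) < k,
      Finset.univ.filter fun j => ¬ ((τ.symm j : ℕ) + 1 < k), ⟨σ ⟨0, by omega⟩, ?_⟩, ?_, ?_⟩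
    · simp
      omega
    · have h1 : (Finset.univ.filter fun i => (σ.symm i : ℕ) < k).card = k := by
        rw [← Fintype.card_subtype]
        exact (Fintype.card_congr (σ.symm.subtypeEquiv fun _ => Iff.rfl)).trans (hcard k hkn)
      have h2 : (Finset.univ.filter fun j => ¬ ((τ.symm j : ℕ) + 1 < k)).card = n + 1 - k := by
        rw [← Fintype.card_subtype]
        exact (Fintype.card_congr (τ.symm.subtypeEquiv fun _ => Iff.rfl)).trans (hcard2 k hk hkn)
      rw [h1, h2]
      omega
    · intro i
      have h1 := h (σ.symm i)
      rw [hstd, image_comp_eq_cutOrthant_iff, Equiv.apply_symm_apply] at h1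
      rw [h1, blockTuple]
      congr 1
      ext j
      simp
  · rintro ⟨I, J, hI, hIJ, h⟩
    have hIn : I.card ≤ n := by simpa using Finset.card_le_univ I
    have hI1 := hI.card_pos
    obtain ⟨σ, hσ⟩ := exists_perm_of_card_eq (fun i : Fin n => (i : ℕ) < I.card)
      (fun i => i ∈ I) (by rw [hcard _ hIn, Fintype.card_coe])
    obtain ⟨τ, hτ⟩ := exists_perm_of_card_eq (fun j : Fin n => ¬ ((j : ℕ) + 1 < I.card))
      (fun j => j ∈ J) (by
        rw [hcard2 _ hI1 hIn, Fintype.card_coe]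
        omega)
    refine ⟨I.card, hI1, hIn, σ, τ, fun i => ?_⟩
    rw [hstd, image_comp_eq_cutOrthant_iff, h, blockTuple]
    congr 1
    ext j
    have h1 := hτ (τ.symm j)
    rw [Equiv.apply_symm_apply] at h1
    simp only [Function.comp_apply, hσ, h1]

end Classification

theorem theorem4p1 (n : ℕ) (B : Fin n → Set (Fin n → ℝ)) :
    ((∀ i, IsLatticePolyhedron (B i) ∧ BoundedDiffOrthant (B i)) ∧ IsMinimalTuple B 2) ↔
      ∃ k : ℕ, 1 ≤ k ∧ k ≤ n ∧ ∃ σ τ : Equiv.Perm (Fin n),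
        ∀ i, (fun x : Fin n → ℝ => x ∘ τ) '' B (σ i) = standardTuple n k i := by
  rw [standardTuple_iff_blockTuple]
  constructor
  · rintro ⟨hB, hmin⟩
    exact exists_blockTuple_of_isMinimalTuple hB hmin
  · rintro ⟨I, J, hI, hIJ, h⟩
    obtain rfl : B = blockTuple I J := funext h
    exact ⟨fun i => ⟨isLatticePolyhedron_blockTuple I J i,
      (isGeneratedBy_blockTuple I J i).boundedDiffOrthant⟩, isMinimalTuple_blockTuple hI hIJ⟩
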